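/- **Setting.** Let $\mathbb G$ be a Carnot group: a finite-dimensional stratified real Lie algebra $\mathfrak g=V_1\oplus\dots\oplus V_s$ (with $[V_1,V_j]=V_{j+1}$), endowed with the group law given by the Baker–Campbell–Hausdorff formula, with the dilations $\delta_\lambda$ ($\delta_\lambda v=\lambda^j v$ for $v\in V_j$, $\lambda>0$), and with a distance $\rho$ that is left-invariant and satisfies $\rho(\delta_\lambda x,\delta_\lambda y)=\lambda\rho(x,y)$. A subgroup $\mathbb P$ is homogeneous if $\delta_\lambda\mathbb P=\mathbb P$ for all $\lambda>0$; its homogeneous dimension is the number $d$ with $(\delta_\lambda)_\#\theta=\lambda^{-d}\theta$ for all $\lambda>0$, where $\theta$ is a Haar measure of $\mathbb P$. Two homogeneous subgroups $\mathbb W,\mathbb V$ are complementary if $\mathbb G=\mathbb W\mathbb V$ and $\mathbb W\cap\mathbb V=\{0\}$; if moreover $\mathbb W$ is normal, $\mathbb G=\mathbb W\cdot\mathbb V$ is called a splitting, and $\mathbb W$ is said to split $\mathbb G$. The measure $\psi^d$ is either the Hausdorff measure (coverings by sets $E_j$ of small diameter, with weights $(\operatorname{diam}E_j)^d$) or the spherical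 measure (coverings by closed balls of $\mathbb G$ of small radii $r_j$, with weights $(2r_j)^d$) of $(\mathbb G,\rho)$, without normalization constants. A map $f:\Omega\to\mathbb G'$ from an open set $\Omega\subset\mathbb G$ to a Carnot group is of class $C^1_H$ if at every $p\in\Omega$ it has a Pansu differential $D_Hf_p$, i.e. a homogeneous morphism $L$ with $\rho'(f(p)^{-1}f(x),L(p^{-1}x))/\rho(p,x)\to0$ as $x\to p$, and $p\mapsto D_Hf_p$ is continuous. A set $\Sigma\subset\mathbb G$ is a $C^1_H$ submanifold if there is a Carnot group $\mathbb G'$ such that every $p\in\Sigma$ has an open neighbourhood $\Omega$ and a map $f\in C^1_H(\Omega;\mathbb G')$ with $\Sigma\cap\Omega=\{f=0\}$, $D_Hf_p$ surjective, and $\ker D_Hf_p$ splitting $\mathbb G$. Its homogeneous tangent subgroup at $p$ is $T^H_p\Sigma:=\ker D_Hf_p$ (it does not depend on $f$). Given a splitting $\mathbb G=\mathbb W\cdot\mathbb V$ and an open set $A\subset\mathbb W$, a map $\phi:A\to\mathbb V$ is of class $C^1_{\mathbb W,\mathbb V}(A)$ if its intrinsic graph $\Sigma=\{w\phi(w):w\in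 A\}$ is a $C^1_H$ submanifold and, for every $w\in A$, $T^H_{w\phi(w)}\Sigma$ is complementary to $\mathbb V$. **Theorem (Area formula).** Let $\mathbb G=\mathbb W\cdot\mathbb V$ be a splitting of a Carnot group with $\mathbb W$ normal, let $d$ be the homogeneous dimension of $\mathbb W$, and let $\psi^d$ be the Hausdorff or the spherical measure. There is a function $\mathcal A$, the area factor, which depends only on $(\mathbb G,\rho)$, $\mathbb W$, $\mathbb V$ and the choice of $\psi$, and is defined on the homogeneous subgroups $\mathbb P$ of $\mathbb G$ that are intrinsic graphs $\{w\phi_{\mathbb P}(w):w\in\mathbb W\}$ of maps $\phi_{\mathbb P}:\mathbb W\to\mathbb V$ (these include the subgroups $T^H_p\Sigma$ below), with the following properties. 1. $0<\mathcal A(\mathbb P)<\infty$ and, for $\Phi_{\mathbb P}(w):=w\phi_{\mathbb P}(w)$, $$\psi^d\llcorner\mathbb P=\mathcal A(\mathbb P)\,(\Phi_{\mathbb P})_\#(\psi^d\llcorner\mathbb W).$$ 2. $\mathcal A$ is continuous: for every $\mathbb P$ and every $\varepsilon>0$ there is $\delta>0$ such that $|\mathcal A(\mathbb P)-\mathcal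 A(\mathbb P')|<\varepsilon$ for every $\mathbb P'$ with $\rho(\phi_{\mathbb P}(w),\phi_{\mathbb P'}(w))<\delta$ for all $w$ in the projection to $\mathbb W$ (along $\mathbb V$) of the closed unit ball centered at $0$. 3. For every open set $A\subset\mathbb W$, every $\phi\in C^1_{\mathbb W,\mathbb V}(A)$ with intrinsic graph $\Sigma$, and every Borel function $h:\Sigma\to[0,+\infty)$, $$\int_\Sigma h\,d\psi^d=\int_A h(w\phi(w))\,\mathcal A\big(T^H_{w\phi(w)}\Sigma\big)\,d\psi^d(w).$$ -/

import Mathlib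

open MeasureTheory Topology Filter Set
open scoped ENNReal NNReal

namespace Carnot

universe u v

/-- The right-nested bracket `[a₁, [a₂, … [a_{k-1}, a_k] … ]]` of a list; a list with one entry
gives that entry. -/
def lieWord {𝔤 : Type u} [LieRing 𝔤] : List 𝔤 → 𝔤
  | [] => 0
  | [a] => a
  | a :: b :: l => ⁅a, lieWord (b :: l)⁆

/-- The Baker-Campbell-Hausdorff product (in Dynkin's form) on a Lie algebra that is nilpotent of
step at most `N`. The summation is over `1 ≤ n` and over the pairs `(rⱼ, sⱼ)`, `j = 1, …, n`, with
`rⱼ + sⱼ > 0`; the terms with `n > N`, `rⱼ > N` or `sⱼ > N` are iterated brackets of more than `N`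
elements, hence zero, and are left out. -/
noncomputable def bch {𝔤 : Type u} [LieRing 𝔤] [LieAlgebra ℝ 𝔤] (N : ℕ) (x y : 𝔤) : 𝔤 :=
  ∑ n ∈ Finset.Icc 1 N, ((-1 : ℝ) ^ (n - 1) / (n : ℝ)) •
    ∑ e : Fin n → Fin (N + 1) × Fin (N + 1) with
        ∀ j, 0 < ((e j).1 : ℕ) + ((e j).2 : ℕ),
      (((∑ j, (((e j).1 : ℕ) + ((e j).2 : ℕ))) *
        ∏ j, (Nat.factorial (e j).1 * Nat.factorial (e j).2) : ℕ) : ℝ)⁻¹ •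
      lieWord (List.ofFn fun j =>
        List.replicate ((e j).1 : ℕ) x ++ List.replicate ((e j).2 : ℕ) y).flatten

/-- A stratification `𝔤 = V₁ ⊕ … ⊕ V_s` of a real Lie algebra: `layer i` is `V_i` for
`1 ≤ i ≤ s`, and zero for the other indices. The zero algebra is stratified of step `0`. -/
structure Stratification (𝔤 : Type u) [LieRing 𝔤] [LieAlgebra ℝ 𝔤] where
  step : ℕ
  layer : ℕ → Submodule ℝ 𝔤
  isInternal : DirectSum.IsInternal layer
  layer_zero : layer 0 = ⊥
  layer_of_lt : ∀ i, step < i → layer i = ⊥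
  layer_step_ne_bot : 0 < step → layer step ≠ ⊥
  lie_mem : ∀ i j, ∀ x ∈ layer i, ∀ y ∈ layer j, ⁅x, y⁆ ∈ layer (i + j)
  span_lie : ∀ j, 1 ≤ j →
    Submodule.span ℝ {z : 𝔤 | ∃ x ∈ layer 1, ∃ y ∈ layer j, ⁅x, y⁆ = z} = layer (j + 1)

theorem Stratification.bijective {𝔤 : Type u} [LieRing 𝔤] [LieAlgebra ℝ 𝔤]
    (S : Stratification 𝔤) : Function.Bijective (DirectSum.coeLinearMap S.layer) :=
  S.isInternal

/-- The projection of `𝔤` onto its `i`-th layer along the other layers. -/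
noncomputable def Stratification.proj {𝔤 : Type u} [LieRing 𝔤] [LieAlgebra ℝ 𝔤]
    (S : Stratification 𝔤) (i : ℕ) : 𝔤 →ₗ[ℝ] 𝔤 :=
  (S.layer i).subtype ∘ₗ DirectSum.component ℝ ℕ (fun i => S.layer i) i ∘ₗ
    (LinearEquiv.ofBijective (DirectSum.coeLinearMap S.layer) S.bijective).symm.toLinearMap

/-- The dilation `δ_t`, which multiplies the elements of `V_i` by `t ^ i`. -/
noncomputable def Stratification.dilation {𝔤 : Type u} [LieRing 𝔤] [LieAlgebra ℝ 𝔤]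
    (S : Stratification 𝔤) (t : ℝ) : 𝔤 →ₗ[ℝ] 𝔤 :=
  ∑ i ∈ Finset.range (S.step + 1), t ^ i • S.proj i

/-- A Carnot group: a finite-dimensional real Lie algebra with a stratification, with the group
law that the Baker-Campbell-Hausdorff formula gives on it (so the group is identified with its Lie
algebra through the exponential map), and with a distance that is left-invariant and
`1`-homogeneous with respect to the dilations. -/
class CarnotGroup (G : Type u) extends LieRing G, LieAlgebra ℝ G, Group G, MetricSpace G where
  finiteDimensional : FiniteDimensional ℝ G
  strat : Stratification G
  mul_eq_bch : ∀ x y : G, x * y = bch strat.step x y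
  dist_mul_left' : ∀ g x y : G, dist (g * x) (g * y) = dist x y
  dist_dilation : ∀ t : ℝ, 0 < t → ∀ x y : G,
    dist (strat.dilation t x) (strat.dilation t y) = t * dist x y

/-- The dilations of a Carnot group. -/
noncomputable def dil {G : Type u} [CarnotGroup G] (t : ℝ) : G →ₗ[ℝ] G :=
  (CarnotGroup.strat (G := G)).dilation t

/-- Homogeneous morphisms: the morphisms of Lie algebras that map the `j`-th layer to the `j`-th
layer. -/
structure HomogeneousHom (G : Type u) (H : Type v) [CarnotGroup G] [CarnotGroup H]
    extends G →ₗ⁅ℝ⁆ H where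
  map_layer : ∀ j, ∀ x ∈ (CarnotGroup.strat (G := G)).layer j,
    toLieHom x ∈ (CarnotGroup.strat (G := H)).layer j

/-! ### Homogeneous subgroups and splittings -/

def IsHomogeneous {G : Type u} [CarnotGroup G] (P : Subgroup G) : Prop :=
  ∀ t : ℝ, 0 < t → (dil t : G → G) '' (P : Set G) = P

/-- `G = W V` and `W ∩ V` is trivial. -/
def Complementary {G : Type u} [CarnotGroup G] (W V : Subgroup G) : Prop :=
  (∀ g : G, ∃ w ∈ W, ∃ v ∈ V, g = w * v) ∧ W ⊓ V = ⊥

/-- The set of the homogeneous subgroups that are complementary to `V`. -/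
def complements {G : Type u} [CarnotGroup G] (V : Subgroup G) : Set (Subgroup G) :=
  {W | IsHomogeneous W ∧ Complementary W V}

/-- A splitting `G = W · V`: both subgroups are homogeneous, `W` is normal, and they are
complementary. -/
structure IsSplitting {G : Type u} [CarnotGroup G] (W V : Subgroup G) : Prop where
  normal : W.Normal
  homogeneous_left : IsHomogeneous W
  homogeneous_right : IsHomogeneous V
  complementary : Complementary W V

/-- `d` is the homogeneous dimension of `P`: the dilations multiply a Haar measure of `P` by
`(δ_t)_# θ = t ^ (-d) θ`. (Measures on `P` are viewed as measures on `G` supported on `P`.) -/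
def IsHomogeneousDimension {G : Type u} [CarnotGroup G] [MeasurableSpace G]
    (P : Subgroup G) (d : ℝ) : Prop :=
  ∃ θ : Measure P, θ.IsHaarMeasure ∧ ∀ t : ℝ, 0 < t →
    (θ.map (Subtype.val : P → G)).map (dil t : G → G) =
      ENNReal.ofReal (t ^ (-d)) • θ.map (Subtype.val : P → G)

/-! ### Hausdorff and spherical measures (without normalization constants) -/

/-- The spherical measure: countable coverings by closed balls `B` of small diameter, each one with
weight `(2 r) ^ d`, where `r` is the radius. A set that is not a closed ball has weight `∞`. -/
noncomputable def sphericalMeasure {X : Type u} [MetricSpace X] [MeasurableSpace X] [BorelSpace X]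
    (d : ℝ) : Measure X :=
  Measure.mkMetric' fun B : Set X =>
    ⨅ (x : X) (r : ℝ) (_ : 0 ≤ r) (_ : B = Metric.closedBall x r), ENNReal.ofReal (2 * r) ^ d

inductive MeasureKind
  | hausdorff
  | spherical

/-- `ψ^d`: either the Hausdorff or the spherical measure of dimension `d`. -/
noncomputable def psi {X : Type u} [MetricSpace X] [MeasurableSpace X] [BorelSpace X]
    (k : MeasureKind) (d : ℝ) : Measure X :=
  match k with
  | .hausdorff => Measure.hausdorffMeasure d
  | .spherical => sphericalMeasure d

/-! ### Pansu differentials, submanifolds, tangent subgroups -/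

/-- `L` is the Pansu differential of `f` at `p`. -/
def HasPansuDifferentialAt {G : Type u} {H : Type v} [CarnotGroup G] [CarnotGroup H]
    (f : G → H) (L : HomogeneousHom G H) (p : G) : Prop :=
  Tendsto (fun x => dist ((f p)⁻¹ * f x) (L.toLieHom (p⁻¹ * x)) / dist p x) (𝓝[≠] p) (𝓝 0)

/-- `f` is of class `C¹_H` on `Ω`: it has a Pansu differential at every point of `Ω`, and the
differential is continuous for the distance
`d(L, M) = sup {dist (L x) (M x) / ‖x‖ : x ≠ 0}` between homogeneous morphisms. -/
def IsC1H {G : Type u} {H : Type v} [CarnotGroup G] [CarnotGroup H]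
    (f : G → H) (Ω : Set G) : Prop :=
  ∃ D : G → HomogeneousHom G H,
    (∀ p ∈ Ω, HasPansuDifferentialAt f (D p) p) ∧
    ∀ p ∈ Ω, ∀ ε > 0, ∃ δ > 0, ∀ q ∈ Ω, dist q p < δ →
      ∀ x : G, dist ((D q).toLieHom x) ((D p).toLieHom x) ≤ ε * dist 0 x

/-- `p` is split-regular for `f`, and `T` is the kernel of the Pansu differential of `f` at `p`:
the differential is surjective and its kernel `T` splits `G`. -/
def IsSplitRegularAt {G : Type u} {H : Type v} [CarnotGroup G] [CarnotGroup H]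
    (f : G → H) (p : G) (T : Subgroup G) : Prop :=
  ∃ L : HomogeneousHom G H, HasPansuDifferentialAt f L p ∧ Function.Surjective L.toLieHom ∧
    (T : Set G) = {x | L.toLieHom x = 0} ∧ ∃ V : Subgroup G, IsSplitting T V

/-- In a neighbourhood of `p`, the set `S` is the zero level set of a `C¹_H` map `f` with values
in `H`, for which `p` is split-regular, and `T` is the kernel of the differential of `f` at `p`. -/
def IsLevelSetNear {G : Type u} [CarnotGroup G] (H : Type v) [CarnotGroup H]
    (S : Set G) (p : G) (T : Subgroup G) : Prop :=
  ∃ (Ω : Set G) (f : G → H), IsOpen Ω ∧ p ∈ Ω ∧ IsC1H f Ω ∧ IsSplitRegularAt f p T ∧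
    S ∩ Ω = {x ∈ Ω | f x = 0}

/-- Submanifolds of class `C¹_H`. -/
def IsC1HSubmanifold {G : Type u} [CarnotGroup G] (S : Set G) : Prop :=
  ∃ (H : Type u) (_ : CarnotGroup H), ∀ p ∈ S, ∃ T : Subgroup G, IsLevelSetNear H S p T

open Classical in
/-- The homogeneous tangent subgroup of `S` at `p`: the kernel of the Pansu differential at `p` of
a map that defines `S` near `p`. (All such maps have the same kernel; the trivial subgroup is a
default value where there is no such map.) -/
noncomputable def tangentSubgroup {G : Type u} [CarnotGroup G] (S : Set G) (p : G) : Subgroup G :=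
  if h : ∃ (T : Subgroup G) (H : Type u) (_ : CarnotGroup H), p ∈ S ∧ IsLevelSetNear H S p T then
    h.choose
  else ⊥

/-! ### Intrinsic graphs -/

/-- The graph map `w ↦ w φ(w)`. -/
def graphMap {G : Type u} [CarnotGroup G] {W V : Subgroup G} {A : Set W} (φ : A → V) (w : A) : G :=
  ((w : W) : G) * (φ w : G)

/-- The intrinsic graph `{w φ(w) : w ∈ A}`. -/
def intrinsicGraph {G : Type u} [CarnotGroup G] {W V : Subgroup G} {A : Set W} (φ : A → V) :
    Set G :=
  range (graphMap φ)

/-- The class `C¹_{W,V}(A)`. -/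
def IsC1WV {G : Type u} [CarnotGroup G] {W V : Subgroup G} {A : Set W} (φ : A → V) : Prop :=
  IsC1HSubmanifold (intrinsicGraph φ) ∧
    ∀ w : A, tangentSubgroup (intrinsicGraph φ) (graphMap φ w) ∈ complements V

/-- The homogeneous subgroup `P` is the intrinsic graph of the map `φ` defined on all of `W`. -/
def IsHomogeneousGraph {G : Type u} [CarnotGroup G] {W V : Subgroup G} (P : Subgroup G)
    (φ : W → V) : Prop :=
  IsHomogeneous P ∧ (P : Set G) = range fun w : W => (w : G) * (φ w : G)

/-- `𝒜` is the area factor of the splitting `W · V`: if the homogeneous subgroup `P` is the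
intrinsic graph of `φ : W → V`, with graph map `Φ`, then `𝒜 P` is positive and
`ψ^d ⌞ P = 𝒜 P • Φ_# (ψ^d ⌞ W)`. -/
def IsAreaFactor {G : Type u} [CarnotGroup G] [MeasurableSpace G] [BorelSpace G]
    (k : MeasureKind) (d : ℝ) (W V : Subgroup G) (𝒜 : Subgroup G → ℝ≥0) : Prop :=
  ∀ (P : Subgroup G) (φ : W → V), IsHomogeneousGraph P φ →
    0 < 𝒜 P ∧
    (psi k d).restrict (P : Set G) =
      (𝒜 P : ℝ≥0∞) • ((psi k d).comap (Subtype.val : W → G)).map fun w : W => (w : G) * (φ w : G)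

/-- `𝒜` is continuous on the set of the homogeneous subgroups `P` that are intrinsic graphs of maps
`φ_P : W → V`; the topology is that of the uniform convergence of `φ_P` on the projection to `W`
(along `V`) of the closed unit ball, i.e., since the maps commute with dilations, that of the
uniform convergence on bounded sets. -/
def IsContinuousOnGraphs {G : Type u} [CarnotGroup G]
    (W V : Subgroup G) (𝒜 : Subgroup G → ℝ≥0) : Prop :=
  ∀ (P : Subgroup G) (φ : W → V), IsHomogeneousGraph P φ →
    ∀ ε > 0, ∃ δ > 0, ∀ (P' : Subgroup G) (φ' : W → V), IsHomogeneousGraph P' φ' →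
      (∀ w : W, (∃ v ∈ V, (w : G) * v ∈ Metric.closedBall (0 : G) 1) →
        dist (φ w : G) (φ' w : G) < δ) →
      dist (𝒜 P) (𝒜 P') < ε

end Carnot

namespace Carnot

universe u v

/-! ### Projections onto the layers and the associated filtration -/

namespace Stratification

variable {𝔤 : Type u} [LieRing 𝔤] [LieAlgebra ℝ 𝔤] (S : Stratification 𝔤)

/-! Let `τ` be a Haar measure of `W`, seen on `G`, and let `π` be the projection to `W` along `V`.
Since `W` is normal, left translation by `g` acts on `π`-images as a conjugation of `W` followed by
a left translation in `W`. Both preserve `τ`: a conjugation multiplies `τ` by a constant and moves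
spheres of radius `r` only by a bounded amount, so letting `r → ∞` forces the constant to be 1.
Hence `E ↦ τ (π '' E)` is left-invariant under all of `G` and `d`-homogeneous under dilations
(`measure_proj_image_mul`, `measure_proj_image_dil`).

On a homogeneous complement `P` of `V`, the measure `E ↦ τ (π '' (E ∩ P))` therefore has the same
upper density with respect to `ψ^d` at all points, namely `areaDensity P`, its supremum over
admissible sets of size 1 that contain the identity. The density theorems (`measure_le_mul_psi`,
`mul_psi_le_measure`) turn this into the equality `measure_proj_image_eq`. Comparing `P` with `W`
gives the area factor `areaDensity W / areaDensity P`. It is continuous because replacing `P` by a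
nearby graph costs only a thickening of the competitors.

For a graph `Σ` of class `C¹_H`, the measure `E ↦ τ (π '' (E ∩ Σ))` should have density `areaDensity
(T_p Σ)` at `p`. Pansu differentiability places `Σ` near `p` within `o(r)` of `p T_p Σ`, which gives
the upper bound at every point (`exists_measure_proj_image_le`). The lower bound needs enough points
of `Σ` above the tangent, close to `p`. Instead of an implicit function theorem, the proof uses that
`Σ` is σ-compact: on a compact piece `K` the injective map `π` has a continuous inverse, and at
`ψ^d`-almost every point of `K` the set `π '' K` has density one (`psi_setOf_not_density`). The
latter is a Vitali argument with projected balls, in which the cone condition of `Σ` lifts a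
covering of `π '' K` to a covering of `K`. The density obtained, `upperDensity`, is Borel by
construction, and integrating against it gives the formula.

The groundwork shows that `dist` induces the linear topology and is proper, and that homogeneous
subgroups, not assumed closed, are closed. -/

theorem proj_mem (i : ℕ) (x : 𝔤) : S.proj i x ∈ S.layer i :=
  Subtype.property _

theorem proj_apply_of_mem {i : ℕ} {x : 𝔤} (hx : x ∈ S.layer i) (j : ℕ) :
    S.proj j x = if j = i then x else 0 := by
  have h : (LinearEquiv.ofBijective (DirectSum.coeLinearMap S.layer) S.bijective).symm x =
      DirectSum.lof ℝ ℕ (fun i => S.layer i) i ⟨x, hx⟩ := by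
    rw [LinearEquiv.symm_apply_eq]
    simp
  simp only [proj, LinearMap.comp_apply, LinearEquiv.coe_coe, h]
  split_ifs with hij
  · subst hij
    simp [DirectSum.component.lof_self]
  · rw [DirectSum.component.of, dif_neg (fun h => hij h.symm)]
    simp

theorem proj_of_ne {i j : ℕ} (h : j ≠ i) {x : 𝔤} (hx : x ∈ S.layer i) : S.proj j x = 0 := by
  simp [S.proj_apply_of_mem hx, h]

theorem induction_on {p : 𝔤 → Prop} (x : 𝔤) (zero : p 0) (layer : ∀ i, ∀ y ∈ S.layer i, p y)
    (add : ∀ y z, p y → p z → p (y + z)) : p x := by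
  obtain ⟨y, rfl⟩ := S.bijective.2 x
  induction y using DirectSum.induction_on with
  | zero => simpa using zero
  | of i y => simpa using layer i _ y.2
  | add y z hy hz => simpa using add _ _ hy hz

theorem sum_proj (x : 𝔤) : ∑ i ∈ Finset.range (S.step + 1), S.proj i x = x := by
  induction x using S.induction_on with
  | zero => simp
  | layer i y hy =>
    simp only [S.proj_apply_of_mem hy, Finset.sum_ite_eq', Finset.mem_range]
    split_ifs with h
    · rfl
    · rw [S.layer_of_lt i (by omega)] at hy
      exact hy.symm
  | add y z hy hz => simp only [map_add, Finset.sum_add_distrib, hy, hz]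

theorem dilation_of_mem (t : ℝ) {i : ℕ} {x : 𝔤} (hx : x ∈ S.layer i) :
    S.dilation t x = t ^ i • x := by
  simp only [dilation, LinearMap.sum_apply, LinearMap.smul_apply, S.proj_apply_of_mem hx,
    smul_ite, smul_zero, Finset.sum_ite_eq', Finset.mem_range]
  split_ifs with h
  · rfl
  · rw [S.layer_of_lt i (by omega), Submodule.mem_bot] at hx
    simp [hx]

theorem dilation_lie (t : ℝ) (x y : 𝔤) : S.dilation t ⁅x, y⁆ = ⁅S.dilation t x, S.dilation t y⁆ := by
  induction x using S.induction_on with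
  | zero => simp
  | add a b ha hb => simp only [add_lie, map_add, ha, hb]
  | layer i a ha =>
    induction y using S.induction_on with
    | zero => simp
    | add b c hb hc => simp only [lie_add, map_add, hb, hc]
    | layer j b hb =>
      rw [S.dilation_of_mem t ha, S.dilation_of_mem t hb, S.dilation_of_mem t (S.lie_mem i j a ha b hb),
        lie_smul, smul_lie, smul_smul, pow_add, mul_comm]

theorem dilation_dilation (s t : ℝ) (x : 𝔤) : S.dilation s (S.dilation t x) = S.dilation (s * t) x := by
  induction x using S.induction_on with
  | zero => simp
  | add a b ha hb => simp only [map_add, ha, hb]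
  | layer i a ha =>
    rw [S.dilation_of_mem t ha, map_smul, S.dilation_of_mem s ha, S.dilation_of_mem _ ha, smul_smul,
      mul_pow, mul_comm]

theorem dilation_one (x : 𝔤) : S.dilation 1 x = x := by
  induction x using S.induction_on with
  | zero => simp
  | add a b ha hb => simp only [map_add, ha, hb]
  | layer i a ha => rw [S.dilation_of_mem 1 ha, one_pow, one_smul]

/-- The elements whose components in the layers before the `k`-th one vanish. -/
noncomputable def filt (k : ℕ) : Submodule ℝ 𝔤 := ⨅ i : Fin k, LinearMap.ker (S.proj i)

theorem mem_filt {k : ℕ} {x : 𝔤} : x ∈ S.filt k ↔ ∀ i < k, S.proj i x = 0 := by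
  simp only [filt, Submodule.mem_iInf, LinearMap.mem_ker]
  exact ⟨fun h i hi => h ⟨i, hi⟩, fun h i => h i i.2⟩

theorem filt_anti {j k : ℕ} (h : j ≤ k) : S.filt k ≤ S.filt j := fun _ hx =>
  S.mem_filt.2 fun i hi => S.mem_filt.1 hx i (hi.trans_le h)

theorem layer_le_filt {j k : ℕ} (h : k ≤ j) : S.layer j ≤ S.filt k := fun _ hx =>
  S.mem_filt.2 fun _ hi => S.proj_of_ne (hi.trans_le h).ne hx

theorem filt_one : S.filt 1 = ⊤ := by
  refine eq_top_iff.2 fun x _ => S.mem_filt.2 fun i hi => ?_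
  have h := S.proj_mem i x
  rwa [Nat.lt_one_iff.1 hi, S.layer_zero, Submodule.mem_bot, ← Nat.lt_one_iff.1 hi] at h

theorem filt_eq_bot {k : ℕ} (h : S.step < k) : S.filt k = ⊥ := by
  refine eq_bot_iff.2 fun x hx => ?_
  rw [Submodule.mem_bot, ← S.sum_proj x]
  exact Finset.sum_eq_zero fun i hi => S.mem_filt.1 hx i ((Finset.mem_range_succ_iff.1 hi).trans_lt h)

theorem sub_proj_mem_filt {k : ℕ} {x : 𝔤} (hx : x ∈ S.filt k) : x - S.proj k x ∈ S.filt (k + 1) := by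
  refine S.mem_filt.2 fun i hi => ?_
  rw [map_sub, S.proj_apply_of_mem (S.proj_mem k x)]
  split_ifs with h
  · rw [h, sub_self]
  · rw [S.mem_filt.1 hx i (by omega), sub_zero]

theorem lie_mem_filt {j k : ℕ} {x y : 𝔤} (hx : x ∈ S.filt j) (hy : y ∈ S.filt k) :
    ⁅x, y⁆ ∈ S.filt (j + k) := by
  rw [← S.sum_proj x, ← S.sum_proj y]
  rw [sum_lie_sum]
  refine Submodule.sum_mem _ fun a _ => Submodule.sum_mem _ fun b _ => ?_
  by_cases ha : a < j
  · simp [S.mem_filt.1 hx a ha]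
  by_cases hb : b < k
  · simp [S.mem_filt.1 hy b hb]
  exact S.layer_le_filt (by omega) (S.lie_mem a b _ (S.proj_mem a x) _ (S.proj_mem b y))

theorem dilation_mem_filt (t : ℝ) {k : ℕ} {x : 𝔤} (hx : x ∈ S.filt k) : S.dilation t x ∈ S.filt k := by
  rw [← S.sum_proj x, map_sum]
  refine Submodule.sum_mem _ fun a _ => ?_
  by_cases ha : a < k
  · simp [S.mem_filt.1 hx a ha]
  rw [S.dilation_of_mem t (S.proj_mem a x)]
  exact Submodule.smul_mem _ _ (S.layer_le_filt (by omega) (S.proj_mem a x))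

theorem proj_dilation (t : ℝ) (k : ℕ) (x : 𝔤) : S.proj k (S.dilation t x) = t ^ k • S.proj k x := by
  induction x using S.induction_on with
  | zero => simp
  | add a b ha hb => simp only [map_add, ha, hb, smul_add]
  | layer i a ha =>
    rw [S.dilation_of_mem t ha, map_smul, S.proj_apply_of_mem ha]
    split_ifs with h
    · rw [h]
    · simp

end Stratification

/-! ### The Baker-Campbell-Hausdorff product -/

section Bch

theorem lieWord_cons {𝔤 : Type u} [LieRing 𝔤] {a : 𝔤} {l : List 𝔤} (hl : l ≠ []) :
    lieWord (a :: l) = ⁅a, lieWord l⁆ := by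
  cases l with
  | nil => exact absurd rfl hl
  | cons b l => rfl

theorem map_lieWord {𝔤 : Type u} [LieRing 𝔤] {𝔥 : Type v} [LieRing 𝔥] (f : 𝔤 → 𝔥) (h0 : f 0 = 0)
    (hf : ∀ x y, f ⁅x, y⁆ = ⁅f x, f y⁆) (l : List 𝔤) : f (lieWord l) = lieWord (l.map f) := by
  induction l with
  | nil => exact h0
  | cons a l ih =>
    cases l with
    | nil => rfl
    | cons b l =>
      rw [lieWord_cons (by simp), hf, ih]
      rfl

variable {𝔤 : Type u} [LieRing 𝔤] [LieAlgebra ℝ 𝔤]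

theorem lieWord_mem {I : Submodule ℝ 𝔤} {x y : 𝔤} (hx : ∀ z ∈ I, ⁅x, z⁆ ∈ I)
    (hy : ∀ z ∈ I, ⁅y, z⁆ ∈ I) (hxy : ⁅x, y⁆ ∈ I) {l : List 𝔤} (hl : ∀ a ∈ l, a = x ∨ a = y)
    (h2 : 2 ≤ l.length) : lieWord l ∈ I := by
  induction l with
  | nil => simp at h2
  | cons a l ih =>
    match l, ih, h2 with
    | [b], _, _ =>
      have hyx : ⁅y, x⁆ ∈ I := by
        rw [← lie_skew]
        exact I.neg_mem hxy
      rcases hl a (by simp) with rfl | rfl <;> rcases hl b (by simp) with rfl | rfl <;>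
        simp_all [lieWord]
    | b :: c :: l, ih, _ =>
      have h := ih (fun a ha => hl a (by simp_all)) (by simp)
      rw [lieWord_cons (by simp)]
      rcases hl a (by simp) with rfl | rfl
      · exact hx _ h
      · exact hy _ h

/-- The list of letters of a term of the Baker-Campbell-Hausdorff formula. -/
def bchList {α : Type*} {N n : ℕ} (e : Fin n → Fin (N + 1) × Fin (N + 1)) (x y : α) : List α :=
  (List.ofFn fun j =>
    List.replicate ((e j).1 : ℕ) x ++ List.replicate ((e j).2 : ℕ) y).flatten

theorem eq_or_eq_of_mem_bchList {α : Type*} {N n : ℕ} {e : Fin n → Fin (N + 1) × Fin (N + 1)}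
    {x y a : α} (h : a ∈ bchList e x y) : a = x ∨ a = y := by
  simp only [bchList, List.mem_flatten, List.mem_ofFn] at h
  obtain ⟨_, ⟨j, rfl⟩, h⟩ := h
  simp only [List.mem_append, List.mem_replicate] at h
  tauto

theorem length_bchList {α : Type*} {N n : ℕ} (e : Fin n → Fin (N + 1) × Fin (N + 1)) (x y : α) :
    (bchList e x y).length = ∑ j, (((e j).1 : ℕ) + ((e j).2 : ℕ)) := by
  simp [bchList, List.length_flatten, List.map_ofFn, List.sum_ofFn, Function.comp_def]

theorem map_bchList {α β : Type*} {N n : ℕ} (e : Fin n → Fin (N + 1) × Fin (N + 1)) (x y : α)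
    (f : α → β) : (bchList e x y).map f = bchList e (f x) (f y) := by
  simp [bchList, List.map_flatten, List.map_ofFn, Function.comp_def]

theorem bch_eq (N : ℕ) (x y : 𝔤) :
    bch N x y = ∑ n ∈ Finset.Icc 1 N, ((-1 : ℝ) ^ (n - 1) / (n : ℝ)) •
      ∑ e : Fin n → Fin (N + 1) × Fin (N + 1) with
          ∀ j, 0 < ((e j).1 : ℕ) + ((e j).2 : ℕ),
        (((∑ j, (((e j).1 : ℕ) + ((e j).2 : ℕ))) *
          ∏ j, (Nat.factorial (e j).1 * Nat.factorial (e j).2) : ℕ) : ℝ)⁻¹ •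
        lieWord (bchList e x y) := rfl

theorem map_bch (f : 𝔤 →ₗ[ℝ] 𝔤) (hf : ∀ x y, f ⁅x, y⁆ = ⁅f x, f y⁆) (N : ℕ) (x y : 𝔤) :
    f (bch N x y) = bch N (f x) (f y) := by
  simp only [bch_eq, map_sum, map_smul, map_lieWord f (map_zero f) hf, map_bchList]

/-- Every word of length at least two in `x`, `y` falls in `I`, so modulo `I` only the one-letter
words `x` and `y` survive in the series. Taking `I` to be a step of the filtration makes the group
law additive up to higher order. -/
theorem bch_sub_add_mem {I : Submodule ℝ 𝔤} {x y : 𝔤} (hx : ∀ z ∈ I, ⁅x, z⁆ ∈ I)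
    (hy : ∀ z ∈ I, ⁅y, z⁆ ∈ I) (hxy : ⁅x, y⁆ ∈ I) {N : ℕ} (hN : 1 ≤ N) :
    bch N x y - (x + y) ∈ I := by
  have key : ∀ (n : ℕ) (e : Fin n → Fin (N + 1) × Fin (N + 1)),
      2 ≤ ∑ j, (((e j).1 : ℕ) + ((e j).2 : ℕ)) → I.mkQ (lieWord (bchList e x y)) = 0 := by
    intro n e h
    rw [Submodule.mkQ_apply, Submodule.Quotient.mk_eq_zero]
    exact lieWord_mem hx hy hxy (fun a => eq_or_eq_of_mem_bchList) (by rwa [length_bchList])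
  rw [← Submodule.Quotient.mk_eq_zero, ← Submodule.mkQ_apply, map_sub, sub_eq_zero, bch_eq, map_sum]
  have h1 : (1 : ℕ) < N + 1 := by omega
  rw [Finset.sum_eq_single 1]
  · let e₁ : Fin 1 → Fin (N + 1) × Fin (N + 1) := fun _ => (⟨1, h1⟩, 0)
    let e₂ : Fin 1 → Fin (N + 1) × Fin (N + 1) := fun _ => (0, ⟨1, h1⟩)
    rw [map_smul, map_sum, Finset.sum_eq_add_of_mem e₁ e₂]
    · simp [e₁, e₂, bchList, lieWord]
    · refine Finset.mem_filter.2 ⟨Finset.mem_univ _, fun j => ?_⟩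
      change 0 < 1 + _
      omega
    · refine Finset.mem_filter.2 ⟨Finset.mem_univ _, fun j => ?_⟩
      change 0 < _ + 1
      omega
    · intro h
      have := congrArg (fun e => (e 0).1.1) h
      simp [e₁, e₂] at this
    · rintro e he ⟨hne₁, hne₂⟩
      rw [map_smul, key, smul_zero]
      simp only [Finset.mem_filter, Finset.mem_univ, true_and, Fin.forall_fin_one] at he
      simp only [Finset.univ_unique, Fin.default_eq_zero, Fin.isValue, Finset.sum_singleton]
      by_contra! hlt
      have h0 : ((e 0).1 : ℕ) + ((e 0).2 : ℕ) = 1 := by omega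
      rcases Nat.add_eq_one_iff.1 h0 with ⟨ha, hb⟩ | ⟨ha, hb⟩
      · refine hne₂ (funext fun j => ?_)
        rw [Subsingleton.elim j 0]
        exact Prod.ext (Fin.ext ha) (Fin.ext hb)
      · refine hne₁ (funext fun j => ?_)
        rw [Subsingleton.elim j 0]
        exact Prod.ext (Fin.ext ha) (Fin.ext hb)
  · intro n hn hn1
    rw [map_smul, map_sum, Finset.sum_eq_zero, smul_zero]
    intro e he
    rw [map_smul, key, smul_zero]
    simp only [Finset.mem_filter, Finset.mem_univ, true_and] at he
    rw [Finset.mem_Icc] at hn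
    calc 2 ≤ n := by omega
      _ = ∑ j : Fin n, 1 := by simp
      _ ≤ _ := Finset.sum_le_sum fun j _ => he j
  · intro h
    exact absurd (Finset.mem_Icc.2 ⟨le_rfl, hN⟩) h

end Bch

/-! ### Algebra of Carnot groups -/

section Algebra

variable {G : Type u} [CarnotGroup G]

/-- The stratification of a Carnot group. -/
abbrev str (G : Type u) [CarnotGroup G] : Stratification G := CarnotGroup.strat

theorem mul_sub_add_mem {I : Submodule ℝ G} {x y : G} (hx : ∀ z ∈ I, ⁅x, z⁆ ∈ I)
    (hy : ∀ z ∈ I, ⁅y, z⁆ ∈ I) (hxy : ⁅x, y⁆ ∈ I) : x * y - (x + y) ∈ I := by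
  rw [CarnotGroup.mul_eq_bch]
  -- In step 0 the truncated series is empty and does not contain `x + y`, but then the algebra is
  -- zero.
  rcases Nat.eq_zero_or_pos (str G).step with h | h
  · have h0 : bch (str G).step x y - (x + y) ∈ (str G).filt 1 := by
      rw [Stratification.filt_one]; trivial
    rw [Stratification.filt_eq_bot _ (by omega), Submodule.mem_bot] at h0
    change bch (str G).step x y - (x + y) ∈ I
    rw [h0]
    exact I.zero_mem
  · exact bch_sub_add_mem hx hy hxy h

theorem lie_filt_mem_filt (k : ℕ) (x : G) : ∀ z ∈ (str G).filt k, ⁅x, z⁆ ∈ (str G).filt k := by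
  intro z hz
  have hx : x ∈ (str G).filt 1 := by rw [Stratification.filt_one]; trivial
  exact (str G).filt_anti (by omega) ((str G).lie_mem_filt hx hz)

theorem mul_sub_add_mem_filt {k : ℕ} {x y : G} (h : ⁅x, y⁆ ∈ (str G).filt k) :
    x * y - (x + y) ∈ (str G).filt k :=
  mul_sub_add_mem (lie_filt_mem_filt k x) (lie_filt_mem_filt k y) h

theorem mul_eq_add_of_lie_eq_zero {x y : G} (h : ⁅x, y⁆ = 0) : x * y = x + y := by
  have := mul_sub_add_mem (I := ⊥) (x := x) (y := y) (by simp) (by simp) (by simpa using h)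
  rwa [Submodule.mem_bot, sub_eq_zero] at this

theorem one_eq_zero : (1 : G) = 0 := by
  have h : (0 : G) * 0 = 0 := by rw [mul_eq_add_of_lie_eq_zero (by simp), add_zero]
  exact (by simpa using h : (0 : G) = 1).symm

theorem inv_eq_neg (x : G) : x⁻¹ = -x := by
  rw [inv_eq_iff_mul_eq_one, mul_eq_add_of_lie_eq_zero (by simp), one_eq_zero, add_neg_cancel]

theorem mul_self_eq (x : G) : x * x = (2 : ℝ) • x := by
  rw [mul_eq_add_of_lie_eq_zero (by simp), two_smul]

theorem dil_mul (t : ℝ) (x y : G) : dil t (x * y) = dil t x * dil t y := by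
  simp only [CarnotGroup.mul_eq_bch, dil]
  exact map_bch _ ((str G).dilation_lie t) _ _ _

theorem dil_one_right (t : ℝ) : dil t (1 : G) = 1 := by
  rw [one_eq_zero, map_zero]

theorem dil_inv (t : ℝ) (x : G) : dil t x⁻¹ = (dil t x)⁻¹ := by
  rw [inv_eq_neg, inv_eq_neg, map_neg]

theorem dil_dil (s t : ℝ) (x : G) : dil s (dil t x) = dil (s * t) x :=
  (str G).dilation_dilation s t x

theorem dil_one_left (x : G) : dil 1 x = x := (str G).dilation_one x

theorem dil_of_mem (t : ℝ) {i : ℕ} {x : G} (hx : x ∈ (str G).layer i) : dil t x = t ^ i • x :=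
  (str G).dilation_of_mem t hx

theorem HomogeneousHom.map_dil {H : Type v} [CarnotGroup H] (L : HomogeneousHom G H) (t : ℝ)
    (x : G) : L.toLieHom (dil t x) = dil t (L.toLieHom x) := by
  induction x using (str G).induction_on with
  | zero => simp
  | add a b ha hb => simp only [map_add, ha, hb]
  | layer i a ha => rw [dil_of_mem t ha, dil_of_mem t (L.map_layer i a ha), map_smul]

end Algebra

/-! ### The homogeneous norm -/

section Norm

variable {G : Type u} [CarnotGroup G]

/-- The homogeneous norm: the distance from the identity. -/
noncomputable def gnorm (x : G) : ℝ := dist 1 x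

theorem gnorm_nonneg (x : G) : 0 ≤ gnorm x := dist_nonneg

@[simp] theorem gnorm_one : gnorm (1 : G) = 0 := dist_self _

theorem gnorm_eq_zero {x : G} : gnorm x = 0 ↔ x = 1 := by
  rw [gnorm, dist_eq_zero, eq_comm]

theorem dist_eq_gnorm (x y : G) : dist x y = gnorm (x⁻¹ * y) := by
  rw [gnorm, ← CarnotGroup.dist_mul_left' x 1, mul_one, mul_inv_cancel_left]

theorem gnorm_inv (x : G) : gnorm x⁻¹ = gnorm x := by
  rw [gnorm, ← CarnotGroup.dist_mul_left' x, mul_one, mul_inv_cancel, dist_comm, gnorm]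

theorem gnorm_mul_le (x y : G) : gnorm (x * y) ≤ gnorm x + gnorm y := by
  refine (dist_triangle 1 x (x * y)).trans_eq ?_
  rw [dist_eq_gnorm x, inv_mul_cancel_left, gnorm, gnorm]

theorem dist_dil {t : ℝ} (ht : 0 < t) (x y : G) : dist (dil t x) (dil t y) = t * dist x y :=
  CarnotGroup.dist_dilation t ht x y

theorem gnorm_dil {t : ℝ} (ht : 0 < t) (x : G) : gnorm (dil t x) = t * gnorm x := by
  rw [gnorm, ← dil_one_right t, dist_dil ht, gnorm]

theorem gnorm_smul_of_mem {k : ℕ} (hk : 1 ≤ k) {b : G} (hb : b ∈ (str G).layer k) (c : ℝ) :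
    gnorm (c • b) = |c| ^ (1 / (k : ℝ)) * gnorm b := by
  have hk0 : (k : ℝ) ≠ 0 := by positivity
  have pos : ∀ c : ℝ, 0 < c → gnorm (c • b) = c ^ (1 / (k : ℝ)) * gnorm b := by
    intro c hc
    rw [← gnorm_dil (Real.rpow_pos_of_pos hc _), dil_of_mem _ hb, ← Real.rpow_natCast,
      ← Real.rpow_mul hc.le, one_div_mul_cancel hk0, Real.rpow_one]
  rcases lt_trichotomy c 0 with hc | rfl | hc
  · rw [abs_of_neg hc, ← pos _ (neg_pos.2 hc), ← gnorm_inv, inv_eq_neg, neg_smul]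
  · rw [zero_smul, ← one_eq_zero, gnorm_one, abs_zero, Real.zero_rpow (by positivity), zero_mul]
  · rw [abs_of_pos hc, pos c hc]

end Norm

/-! ### Coordinates -/

section Coordinates

variable {G : Type u} [CarnotGroup G]

instance : FiniteDimensional ℝ G := CarnotGroup.finiteDimensional

/-- Linear coordinates on a Carnot group. -/
noncomputable def coord (G : Type u) [CarnotGroup G] :
    G ≃ₗ[ℝ] (Fin (Module.finrank ℝ G) → ℝ) :=
  (Module.finBasis ℝ G).equivFun

section Continuity

variable {X : Type*} [TopologicalSpace X] {f g : X → G}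

theorem continuous_coord_lie (hf : Continuous fun x => coord G (f x))
    (hg : Continuous fun x => coord G (g x)) : Continuous fun x => coord G ⁅f x, g x⁆ := by
  have h : ∀ x, coord G ⁅f x, g x⁆ = ∑ i, ∑ j, (coord G (f x) i * coord G (g x) j) •
      coord G ⁅Module.finBasis ℝ G i, Module.finBasis ℝ G j⁆ := by
    intro x
    conv_lhs =>
      rw [← (Module.finBasis ℝ G).sum_equivFun (f x), ← (Module.finBasis ℝ G).sum_equivFun (g x),
        sum_lie_sum]
    simp only [map_sum, smul_lie, lie_smul, map_smul, smul_smul]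
    refine Finset.sum_congr rfl fun i _ => Finset.sum_congr rfl fun j _ => ?_
    rw [mul_comm]
    rfl
  simp only [h]
  fun_prop

theorem continuous_coord_lieWord (l : List (X → G))
    (hl : ∀ f ∈ l, Continuous fun x => coord G (f x)) :
    Continuous fun x => coord G (lieWord (l.map fun f => f x)) := by
  induction l with
  | nil => simpa [lieWord] using continuous_const
  | cons f l ih =>
    rcases eq_or_ne l [] with rfl | h
    · exact hl f (by simp)
    · have h' : ∀ x, l.map (fun f => f x) ≠ [] := by simp [h]
      simp only [List.map_cons, lieWord_cons (h' _)]
      exact continuous_coord_lie (hl f (by simp)) (ih fun g hg => hl g (by simp [hg]))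

theorem continuous_coord_mul (hf : Continuous fun x => coord G (f x))
    (hg : Continuous fun x => coord G (g x)) : Continuous fun x => coord G (f x * g x) := by
  simp only [CarnotGroup.mul_eq_bch, bch_eq, map_sum, map_smul]
  refine continuous_finsetSum _ fun n _ => Continuous.fun_const_smul
    (continuous_finsetSum _ fun e _ => Continuous.fun_const_smul ?_ _) _
  have h := continuous_coord_lieWord (bchList e f g) (fun a ha => by
    rcases eq_or_eq_of_mem_bchList ha with rfl | rfl <;> assumption)
  simpa only [map_bchList] using h

theorem continuous_coord_inv (hf : Continuous fun x => coord G (f x)) :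
    Continuous fun x => coord G (f x)⁻¹ := by
  simpa only [inv_eq_neg, map_neg] using hf.fun_neg

end Continuity

theorem continuous_coord_symm_apply : Continuous fun p => coord G ((coord G).symm p) := by
  simpa using continuous_id'

theorem continuous_linear_coord {F : Type*} [AddCommGroup F] [Module ℝ F] [TopologicalSpace F]
    [IsTopologicalAddGroup F] [ContinuousSMul ℝ F] (L : G →ₗ[ℝ] F) :
    Continuous fun p => L ((coord G).symm p) :=
  LinearMap.continuous_of_finiteDimensional (L ∘ₗ (coord G).symm.toLinearMap)

/-- The neighbourhoods of the identity for the linear topology. -/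
noncomputable def linNhds (G : Type u) [CarnotGroup G] : Filter G := comap (coord G) (𝓝 0)

theorem tendsto_linNhds {f : G → G} (hf : Continuous fun p => coord G (f ((coord G).symm p)))
    (h1 : f 1 = 1) : Tendsto f (linNhds G) (linNhds G) := by
  refine tendsto_comap_iff.2 ?_
  have h := hf.tendsto 0
  simp only [map_zero, ← one_eq_zero, h1] at h
  rw [one_eq_zero, map_zero] at h
  refine (h.comp tendsto_comap).congr fun x => ?_
  simp

/-- Factor `x` as `(c x • b) * y`, with `c` a linear functional that vanishes on `U` and equals 1 at
`b`. The remainder `y` lies in `U` because products are additive modulo `filt (k + 1)`. Both factors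
are small: the first by homogeneity along the layer, the second by the assumption on `U`. -/
theorem gnorm_tendsto_sup_span {k : ℕ} (hk : 1 ≤ k) {U : Submodule ℝ G}
    (h1 : (str G).filt (k + 1) ≤ U) (h2 : U ≤ (str G).filt k)
    (hU : Tendsto gnorm (linNhds G ⊓ 𝓟 (U : Set G)) (𝓝 0)) {b : G} (hb : b ∈ (str G).layer k) :
    Tendsto gnorm (linNhds G ⊓ 𝓟 ((U ⊔ Submodule.span ℝ {b} : Submodule ℝ G) : Set G)) (𝓝 0) := by
  by_cases hbU : b ∈ U
  · rwa [sup_eq_left.2 ((Submodule.span_singleton_le_iff_mem _ _).2 hbU)]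
  obtain ⟨f, hfb, hfU⟩ := Submodule.exists_le_ker_of_notMem hbU
  replace hfb : f b ≠ 0 := hfb
  set c : G → ℝ := fun x => (f b)⁻¹ * f x with hc
  have hbk := (str G).layer_le_filt (le_refl k) hb
  have hmem : ∀ x ∈ U ⊔ Submodule.span ℝ {b}, (c x • b)⁻¹ * x ∈ U := by
    intro x hx
    obtain ⟨y, hy, z, hz, rfl⟩ := Submodule.mem_sup.1 hx
    obtain ⟨a, rfl⟩ := Submodule.mem_span_singleton.1 hz
    have hfy : f y = 0 := hfU hy
    have hca : c (y + a • b) = a := by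
      simp only [hc, map_add, hfy, map_smul, smul_eq_mul, zero_add]
      field_simp
    rw [hca, inv_eq_neg]
    have h3 : -(a • b) * (y + a • b) - (-(a • b) + (y + a • b)) ∈ (str G).filt (k + 1) := by
      refine mul_sub_add_mem_filt ((str G).filt_anti (by omega : k + 1 ≤ k + k)
        ((str G).lie_mem_filt ?_ ?_))
      · exact Submodule.neg_mem _ (Submodule.smul_mem _ _ hbk)
      · exact Submodule.add_mem _ (h2 hy) (Submodule.smul_mem _ _ hbk)
    have h4 := U.add_mem (h1 h3) hy
    convert h4 using 1
    abel
  have hccont : Continuous fun p => c ((coord G).symm p) :=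
    continuous_const.mul (continuous_linear_coord f)
  have hcb : Continuous fun p => coord G (c ((coord G).symm p) • b) := by
    simp only [map_smul]
    exact hccont.smul continuous_const
  have hy : Tendsto (fun x => gnorm ((c x • b)⁻¹ * x))
      (linNhds G ⊓ 𝓟 ((U ⊔ Submodule.span ℝ {b} : Submodule ℝ G) : Set G)) (𝓝 0) := by
    refine hU.comp (tendsto_inf.2 ⟨(tendsto_linNhds ?_ ?_).mono_left inf_le_left,
      tendsto_principal.2 (eventually_inf_principal.2 (Eventually.of_forall hmem))⟩)
    · exact continuous_coord_mul (continuous_coord_inv hcb) continuous_coord_symm_apply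
    · have : c 1 = 0 := by simp [hc, one_eq_zero]
      rw [this, zero_smul, ← one_eq_zero, inv_one, one_mul]
  have hx : Tendsto (fun x => gnorm (c x • b)) (linNhds G) (𝓝 0) := by
    simp only [gnorm_smul_of_mem hk hb]
    have h0 : Tendsto c (linNhds G) (𝓝 0) := by
      have := hccont.tendsto 0
      simp only [map_zero, hc, mul_zero] at this
      refine (this.comp (tendsto_comap (f := coord G))).congr fun x => ?_
      simp [hc]
    have h3 := (h0.abs.rpow_const (p := 1 / (k : ℝ)) (Or.inr (by positivity))).mul_const (gnorm b)
    rwa [abs_zero, Real.zero_rpow (by positivity), zero_mul] at h3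
  refine squeeze_zero (fun x => gnorm_nonneg x) (fun x => ?_)
    (by simpa using (hx.mono_left inf_le_left).add hy)
  calc gnorm x = gnorm (c x • b * ((c x • b)⁻¹ * x)) := by rw [mul_inv_cancel_left]
    _ ≤ _ := gnorm_mul_le _ _

/-- Downward induction on `k` from the trivial `filt (step + 1)`; each layer is adjoined one
generator at a time. -/
theorem gnorm_tendsto_filt (j : ℕ) : ∀ k, k + j = (str G).step + 1 → 1 ≤ k →
    Tendsto gnorm (linNhds G ⊓ 𝓟 ((str G).filt k : Set G)) (𝓝 0) := by
  induction j with
  | zero =>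
    intro k hk _
    rw [Stratification.filt_eq_bot _ (by omega)]
    refine tendsto_const_nhds.congr' ?_
    filter_upwards [mem_inf_of_right (mem_principal_self _)] with x hx
    rw [SetLike.mem_coe, Submodule.mem_bot, ← one_eq_zero] at hx
    rw [hx, gnorm_one]
  | succ j ih =>
    intro k hk hk1
    have ih' := ih (k + 1) (by omega) (by omega)
    have key : ∀ s : Finset G, (∀ b ∈ s, b ∈ (str G).layer k) →
        Tendsto gnorm (linNhds G ⊓
          𝓟 (((str G).filt (k + 1) ⊔ Submodule.span ℝ (s : Set G) : Submodule ℝ G) : Set G)) (𝓝 0) := by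
      intro s
      classical
      induction s using Finset.induction_on with
      | empty => intro _; simpa using ih'
      | insert b s hb hs =>
        intro h
        have hs' := hs fun b hb => h b (Finset.mem_insert_of_mem hb)
        have := gnorm_tendsto_sup_span hk1 le_sup_left (sup_le ((str G).filt_anti (by omega))
          (Submodule.span_le.2 fun x hx => (str G).layer_le_filt le_rfl
            (h x (Finset.mem_insert_of_mem hx)))) hs' (h b (Finset.mem_insert_self _ _))
        rwa [sup_assoc, ← Submodule.span_union, union_comm, ← insert_eq, ← Finset.coe_insert] at this
    obtain ⟨s, hs⟩ := (IsNoetherian.noetherian ((str G).layer k))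
    have h := key s (fun b hb => hs ▸ Submodule.subset_span hb)
    refine h.mono_left (inf_le_inf_left _ (principal_mono.2 fun x hx => ?_))
    rw [hs]
    have := Submodule.add_mem_sup ((str G).sub_proj_mem_filt hx) ((str G).proj_mem k x)
    rwa [sub_add_cancel] at this

theorem gnorm_tendsto_linNhds : Tendsto (gnorm : G → ℝ) (linNhds G) (𝓝 0) := by
  have h := gnorm_tendsto_filt (G := G) (str G).step 1 (by omega) le_rfl
  rwa [Stratification.filt_one, Submodule.top_coe, principal_univ, inf_top_eq] at h

theorem continuous_coord_symm : Continuous ((coord G).symm : _ → G) := by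
  refine continuous_iff_continuousAt.2 fun p => ?_
  refine tendsto_iff_dist_tendsto_zero.2 ?_
  simp only [dist_comm _ ((coord G).symm p), dist_eq_gnorm]
  refine gnorm_tendsto_linNhds.comp (tendsto_comap_iff.2 ?_)
  have h : Continuous fun q => coord G (((coord G).symm p)⁻¹ * (coord G).symm q) :=
    continuous_coord_mul continuous_const continuous_coord_symm_apply
  have := h.tendsto p
  rwa [inv_mul_cancel, one_eq_zero, map_zero] at this

theorem continuous_gnorm : Continuous (gnorm : G → ℝ) := continuous_const.dist continuous_id

/-- On the Euclidean sphere of radius `ρ` the homogeneous norm has a positive minimum. A point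
outside that sphere is brought onto it by some `dil t` with `0 < t ≤ 1`, by the intermediate value
theorem, and this does not increase `gnorm`. -/
theorem exists_gnorm_lt_imp_norm_coord_lt {ρ : ℝ} (hρ : 0 < ρ) :
    ∃ c > 0, ∀ x : G, gnorm x < c → ‖coord G x‖ < ρ := by
  have hcont : Continuous fun p => gnorm ((coord G).symm p : G) :=
    continuous_gnorm.comp continuous_coord_symm
  obtain ⟨c, hc, hmin⟩ : ∃ c > 0, ∀ x : G, ‖coord G x‖ = ρ → c ≤ gnorm x := by
    rcases (Metric.sphere (0 : Fin (Module.finrank ℝ G) → ℝ) ρ).eq_empty_or_nonempty with h | h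
    · refine ⟨1, one_pos, fun x hx => ?_⟩
      exact absurd (show coord G x ∈ Metric.sphere 0 ρ by simpa using hx) (by simp [h])
    · obtain ⟨p, hp, hmin⟩ := (isCompact_sphere _ ρ).exists_isMinOn h hcont.continuousOn
      refine ⟨gnorm ((coord G).symm p), ?_, fun x hx => ?_⟩
      · refine lt_of_le_of_ne (gnorm_nonneg _) fun h0 => ?_
        rw [eq_comm, gnorm_eq_zero, one_eq_zero, LinearEquiv.map_eq_zero_iff] at h0
        rw [h0, mem_sphere_zero_iff_norm, norm_zero] at hp
        exact hρ.ne hp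
      · have := hmin (show coord G x ∈ Metric.sphere 0 ρ by simpa using hx)
        simpa using this
  refine ⟨c, hc, fun x hx => ?_⟩
  by_contra! hge
  have hd : Continuous fun t : ℝ => ‖coord G (dil t x)‖ := by
    simp only [dil, Stratification.dilation, LinearMap.sum_apply, LinearMap.smul_apply, map_sum,
      map_smul]
    fun_prop
  have h0 : dil 0 x = 0 := by
    clear hx hge hd
    induction x using (str G).induction_on with
    | zero => exact map_zero _
    | add a b ha hb => rw [map_add, ha, hb, add_zero]
    | layer i a ha =>
      rw [dil_of_mem 0 ha]
      rcases Nat.eq_zero_or_pos i with rfl | hi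
      · rw [(str G).layer_zero, Submodule.mem_bot] at ha
        rw [ha, smul_zero]
      · rw [zero_pow hi.ne', zero_smul]
  have hI := intermediate_value_Icc (zero_le_one' ℝ) hd.continuousOn
  obtain ⟨t, ⟨ht0, ht1⟩, ht⟩ := hI (show ρ ∈ _ from ⟨by simp [h0, hρ.le], by rwa [dil_one_left]⟩)
  have htpos : 0 < t := by
    refine lt_of_le_of_ne ht0 fun h => ?_
    rw [← h] at ht
    simp only [h0, map_zero, norm_zero] at ht
    exact hρ.ne ht
  have := hmin _ ht
  rw [gnorm_dil htpos] at this
  nlinarith [gnorm_nonneg x]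

theorem continuous_coord : Continuous (coord G) := by
  have h1 : Tendsto (coord G) (𝓝 1) (𝓝 0) := by
    refine Metric.tendsto_nhds_nhds.2 fun ε hε => ?_
    obtain ⟨c, hc, h⟩ := exists_gnorm_lt_imp_norm_coord_lt (G := G) hε
    exact ⟨c, hc, fun {x} hx => by simpa using h x (by rwa [dist_comm] at hx)⟩
  refine continuous_iff_continuousAt.2 fun x => ?_
  have h2 : Tendsto (fun y => x⁻¹ * y) (𝓝 x) (𝓝 1) := by
    refine tendsto_iff_dist_tendsto_zero.2 ?_
    refine (tendsto_iff_dist_tendsto_zero.1 (tendsto_id (x := 𝓝 x))).congr fun y => ?_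
    rw [id, ← CarnotGroup.dist_mul_left' x⁻¹ y x, inv_mul_cancel]
  have h3 : Continuous fun p => coord G (x * (coord G).symm p) :=
    continuous_coord_mul continuous_const continuous_coord_symm_apply
  have h4 := (h3.tendsto 0).comp (h1.comp h2)
  rw [map_zero, ← one_eq_zero, mul_one] at h4
  refine h4.congr fun y => ?_
  simp

theorem continuous_of_coord {X : Type*} [TopologicalSpace X] {f : X → G}
    (h : Continuous fun x => coord G (f x)) : Continuous f := by
  simpa [Function.comp_def] using continuous_coord_symm.comp h

instance : IsTopologicalGroup G where
  continuous_mul := continuous_of_coord (continuous_coord_mul (continuous_coord.comp continuous_fst)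
    (continuous_coord.comp continuous_snd))
  continuous_inv := continuous_of_coord (continuous_coord_inv continuous_coord)

theorem continuous_of_linear {H : Type v} [CarnotGroup H] (L : G →ₗ[ℝ] H) : Continuous L := by
  refine continuous_of_coord ?_
  have h : Continuous fun p => coord H (L ((coord G).symm p)) :=
    continuous_linear_coord ((coord H).toLinearMap ∘ₗ L)
  simpa [Function.comp_def] using h.comp continuous_coord

theorem isClosed_submodule (U : Submodule ℝ G) : IsClosed (U : Set G) := by
  have h : IsClosed (U.map (coord G).toLinearMap : Set (Fin (Module.finrank ℝ G) → ℝ)) :=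
    Submodule.closed_of_finiteDimensional _
  have h2 := h.preimage (continuous_coord (G := G))
  convert h2 using 1
  ext x
  simp

/-- A contraction by a dilation takes a given ball into the region where the coordinates have norm
at most one, so the ball is a closed subset of a dilated compact set. -/
instance : ProperSpace G := by
  have h : ∀ R > 0, IsCompact (Metric.closedBall (1 : G) R) := by
    intro R hR
    obtain ⟨c, hc, h⟩ := exists_gnorm_lt_imp_norm_coord_lt (G := G) one_pos
    have hK : IsCompact ((fun x : G => dil (2 * R / c) x) ''
        ((coord G).symm '' Metric.closedBall 0 1)) :=
      ((isCompact_closedBall _ _).image continuous_coord_symm).image (continuous_of_linear _)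
    refine hK.of_isClosed_subset Metric.isClosed_closedBall fun x hx => ?_
    have hx' : gnorm x ≤ R := by rwa [Metric.mem_closedBall, dist_comm] at hx
    refine ⟨dil (c / (2 * R)) x, ⟨coord G (dil (c / (2 * R)) x), ?_, by simp⟩, ?_⟩
    · rw [mem_closedBall_zero_iff]
      refine (h _ ?_).le
      rw [gnorm_dil (by positivity)]
      calc c / (2 * R) * gnorm x ≤ c / (2 * R) * R := by gcongr
        _ = c / 2 := by field_simp
        _ < c := by linarith
    · have : 2 * R / c * (c / (2 * R)) = 1 := by field_simp
      simp only [dil_dil, this, dil_one_left]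
  refine ⟨fun x r => ?_⟩
  have hR : 0 < max r 1 := lt_max_of_lt_right one_pos
  refine ((h _ hR).image (continuous_const_mul x)).of_isClosed_subset
    Metric.isClosed_closedBall fun y hy => ⟨x⁻¹ * y, ?_, by simp⟩
  rw [Metric.mem_closedBall, ← CarnotGroup.dist_mul_left' x, mul_one, mul_inv_cancel_left]
  exact (Metric.mem_closedBall.1 hy).trans (le_max_left _ _)

end Coordinates

/-! ### Homogeneous subgroups are closed -/

namespace IsHomogeneous

variable {G : Type u} [CarnotGroup G] {P : Subgroup G}

theorem dil_mem (hP : IsHomogeneous P) {t : ℝ} (ht : 0 < t) {x : G} (hx : x ∈ P) : dil t x ∈ P := by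
  have : dil t x ∈ (dil t : G → G) '' (P : Set G) := mem_image_of_mem _ hx
  rwa [hP t ht] at this

/-- The space of the components in the `k`-th layer of the elements of a homogeneous subgroup whose
components in the previous layers vanish. -/
noncomputable def leading (hP : IsHomogeneous P) {k : ℕ} (hk : 1 ≤ k) : Submodule ℝ G where
  carrier := {q | ∃ p ∈ P, p ∈ (str G).filt k ∧ (str G).proj k p = q}
  add_mem' := by
    rintro _ _ ⟨p, hp, hpk, rfl⟩ ⟨p', hp', hpk', rfl⟩
    have h := mul_sub_add_mem_filt ((str G).filt_anti (by omega : k + 1 ≤ k + k)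
      ((str G).lie_mem_filt hpk hpk'))
    refine ⟨p * p', P.mul_mem hp hp', ?_, ?_⟩
    · have := Submodule.add_mem _ ((str G).filt_anti (Nat.le_succ k) h)
        (Submodule.add_mem _ hpk hpk')
      rwa [sub_add_cancel] at this
    · have := (str G).mem_filt.1 h k (Nat.lt_succ_self k)
      rwa [map_sub, map_add, sub_eq_zero] at this
  zero_mem' := ⟨1, P.one_mem, by simp [one_eq_zero], by simp [one_eq_zero]⟩
  smul_mem' := by
    have hk0 : (k : ℝ) ≠ 0 := by positivity
    have pos : ∀ c : ℝ, 0 < c → ∀ p ∈ P, p ∈ (str G).filt k →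
        ∃ p' ∈ P, p' ∈ (str G).filt k ∧ (str G).proj k p' = c • (str G).proj k p := by
      intro c hc p hp hpk
      refine ⟨_, hP.dil_mem (Real.rpow_pos_of_pos hc (1 / (k : ℝ))) hp,
        (str G).dilation_mem_filt _ hpk, ?_⟩
      rw [dil, Stratification.proj_dilation, ← Real.rpow_natCast, ← Real.rpow_mul hc.le,
        one_div_mul_cancel hk0, Real.rpow_one]
    rintro c _ ⟨p, hp, hpk, rfl⟩
    rcases lt_trichotomy c 0 with hc | rfl | hc
    · obtain ⟨p', h1, h2, h3⟩ := pos (-c) (neg_pos.2 hc) p hp hpk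
      refine ⟨p'⁻¹, P.inv_mem h1, ?_, ?_⟩
      · rw [inv_eq_neg]; exact Submodule.neg_mem _ h2
      · rw [inv_eq_neg, map_neg, h3, neg_smul, neg_neg]
    · exact ⟨1, P.one_mem, by simp [one_eq_zero], by simp [one_eq_zero]⟩
    · exact pos c hc p hp hpk

theorem mem_layer_of_mem_leading (hP : IsHomogeneous P) {k : ℕ} (hk : 1 ≤ k) {q : G}
    (hq : q ∈ hP.leading hk) : q ∈ (str G).layer k := by
  obtain ⟨p, -, -, rfl⟩ := hq
  exact (str G).proj_mem k p

/-- From an approximation `p ∈ P` of `q` up to the `m`-th layer one gets a better one, if the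
leading terms of order `m` belong to `P`. -/
theorem exists_sub_mem_filt_succ (hP : IsHomogeneous P) {k m : ℕ} (hk : 1 ≤ k) (hkm : k < m)
    (hm : ∀ q ∈ hP.leading (hk.trans hkm.le), q ∈ P) {p q : G} (hq : q ∈ (str G).layer k)
    (hp : p ∈ P) (hpq : p - q ∈ (str G).filt m) : ∃ p' ∈ P, p' - q ∈ (str G).filt (m + 1) := by
  have hk0 : (k : ℝ) ≠ 0 := by positivity
  have hqk := (str G).layer_le_filt le_rfl hq
  set r := p - q with hr
  have hpr : p = q + r := by rw [hr]; abel
  -- With this `a` the dilation doubles `q`, so `p * p * (dil a p)⁻¹` cancels `q` and keeps `(2 - a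
  -- ^ m)` times the component of order `m`. The factor is nonzero because `a ^ m > a ^ k = 2`.
  set a : ℝ := 2 ^ (1 / (k : ℝ)) with ha
  have ha1 : 1 < a := Real.one_lt_rpow one_lt_two (by positivity)
  have hak : a ^ k = 2 := by
    rw [ha, ← Real.rpow_natCast, ← Real.rpow_mul zero_le_two, one_div_mul_cancel hk0, Real.rpow_one]
  have ham : 2 - a ^ m ≠ 0 := by
    have : a ^ k < a ^ m := pow_lt_pow_right₀ ha1 hkm
    linarith
  have hda : dil a p = (2 : ℝ) • q + dil a r := by
    rw [hpr, map_add, dil_of_mem a hq, hak]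
  set s : G := (2 : ℝ) • r - dil a r with hs
  have hsm : s ∈ (str G).filt m :=
    Submodule.sub_mem _ (Submodule.smul_mem _ _ hpq) ((str G).dilation_mem_filt a hpq)
  have hz : p * p * (dil a p)⁻¹ - s ∈ (str G).filt (m + 1) := by
    have hlie : ⁅(2 : ℝ) • p, -dil a p⁆ ∈ (str G).filt (m + 1) := by
      -- The two elements differ by `s`, of order `m`, so their bracket has order at least `m + k`.
      have e : (2 : ℝ) • p = dil a p + s := by
        rw [hda, hs, hpr, smul_add]; abel
      rw [e, lie_neg, add_lie, lie_self, zero_add]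
      refine Submodule.neg_mem _ ((str G).filt_anti (by omega : m + 1 ≤ m + k)
        ((str G).lie_mem_filt hsm ?_))
      rw [hda]
      exact Submodule.add_mem _ (Submodule.smul_mem _ _ hqk)
        ((str G).filt_anti hkm.le ((str G).dilation_mem_filt a hpq))
    have h := mul_sub_add_mem_filt hlie
    rw [mul_self_eq, inv_eq_neg]
    convert h using 2
    rw [hda, hs, hpr, smul_add]
    abel
  have hzP : p * p * (dil a p)⁻¹ ∈ P :=
    P.mul_mem (P.mul_mem hp hp) (P.inv_mem (hP.dil_mem (by linarith) hp))
  have hlead : (2 - a ^ m) • (str G).proj m r ∈ hP.leading (hk.trans hkm.le) := by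
    refine ⟨_, hzP, ?_, ?_⟩
    · have := Submodule.add_mem _ ((str G).filt_anti (Nat.le_succ m) hz) hsm
      rwa [sub_add_cancel] at this
    · have := (str G).mem_filt.1 hz m (Nat.lt_succ_self m)
      rw [map_sub, sub_eq_zero] at this
      rw [this, hs, map_sub, map_smul, dil, Stratification.proj_dilation, sub_smul]
  have hrP : (str G).proj m r ∈ P := by
    refine hm _ ?_
    have := Submodule.smul_mem _ (2 - a ^ m)⁻¹ hlead
    rwa [smul_smul, inv_mul_cancel₀ ham, one_smul] at this
  refine ⟨p * ((str G).proj m r)⁻¹, P.mul_mem hp (P.inv_mem hrP), ?_⟩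
  have hprojm := (str G).layer_le_filt le_rfl ((str G).proj_mem m r)
  have h := mul_sub_add_mem_filt (x := p) (y := -(str G).proj m r)
    ((str G).filt_anti (by omega : m + 1 ≤ k + m) ((str G).lie_mem_filt (k := m)
      (by
        rw [hpr]
        exact Submodule.add_mem _ hqk ((str G).filt_anti hkm.le hpq))
      (Submodule.neg_mem _ hprojm)))
  have := Submodule.add_mem _ h ((str G).sub_proj_mem_filt hpq)
  rw [inv_eq_neg]
  convert this using 1
  rw [hr]
  abel

/-- Downward induction on `k`: with the later leading spaces already inside `P`, the approximation
of `q` by elements of `P` improves one layer at a time until the error lies in a trivial filtration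
term. -/
theorem leading_subset_aux (hP : IsHomogeneous P) (j : ℕ) : ∀ k (hk : 1 ≤ k),
    (str G).step < k + j → ∀ q ∈ hP.leading hk, q ∈ P := by
  induction j with
  | zero =>
    intro k hk hj q hq
    have := hP.mem_layer_of_mem_leading hk hq
    rw [(str G).layer_of_lt k (by omega), Submodule.mem_bot] at this
    rw [this, ← one_eq_zero]
    exact P.one_mem
  | succ j ih =>
    intro k hk hj q hq
    have step : ∀ i, ∃ p ∈ P, p - q ∈ (str G).filt (k + 1 + i) := by
      intro i
      induction i with
      | zero =>
        obtain ⟨p, hp, hpk, rfl⟩ := hq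
        exact ⟨p, hp, (str G).sub_proj_mem_filt hpk⟩
      | succ i ihi =>
        obtain ⟨p, hp, hpq⟩ := ihi
        have hi : k < k + 1 + i := by omega
        exact hP.exists_sub_mem_filt_succ (m := k + 1 + i) hk hi (ih _ _ (by omega))
          (hP.mem_layer_of_mem_leading hk hq) hp hpq
    obtain ⟨p, hp, hpq⟩ := step (str G).step
    rw [Stratification.filt_eq_bot _ (by omega), Submodule.mem_bot, sub_eq_zero] at hpq
    rwa [← hpq]

theorem leading_subset (hP : IsHomogeneous P) {k : ℕ} (hk : 1 ≤ k) {q : G}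
    (hq : q ∈ hP.leading hk) : q ∈ P :=
  hP.leading_subset_aux ((str G).step + 1) k hk (by omega) q hq

/-- The first component of a limit point belongs to `leading`, a finite-dimensional space and hence
closed, and so it belongs to `P`. Dividing by it leaves a limit point of the next filtration term.
-/
theorem closure_inter_filt_subset (hP : IsHomogeneous P) (j : ℕ) : ∀ k, 1 ≤ k →
    (str G).step < k + j → closure ((P : Set G) ∩ (str G).filt k) ⊆ P := by
  induction j with
  | zero =>
    intro k hk hj
    rw [Stratification.filt_eq_bot _ (by omega)]
    have : ((⊥ : Submodule ℝ G) : Set G) = {0} := rfl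
    rw [this]
    refine (closure_mono inter_subset_right).trans ?_
    rw [closure_singleton, singleton_subset_iff, ← one_eq_zero]
    exact P.one_mem
  | succ j ih =>
    intro k hk hj x hx
    have hproj : Continuous ((str G).proj k) := continuous_of_linear _
    have h1 : (str G).proj k x ∈ (hP.leading hk : Set G) :=
      (isClosed_submodule _).closure_subset_iff.2 Subset.rfl
        (map_mem_closure hproj hx fun y hy => ⟨y, hy.1, hy.2, rfl⟩)
    have h2 : ((str G).proj k x)⁻¹ * x ∈ closure ((P : Set G) ∩ (str G).filt (k + 1)) := by
      refine map_mem_closure (f := fun y => ((str G).proj k y)⁻¹ * y)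
        (hproj.inv.mul continuous_id) hx fun y hy => ⟨?_, ?_⟩
      · exact P.mul_mem (P.inv_mem (hP.leading_subset hk ⟨y, hy.1, hy.2, rfl⟩)) hy.1
      · simp only [inv_eq_neg]
        change _ ∈ (str G).filt (k + 1)
        have hyk := hy.2
        have h := mul_sub_add_mem_filt (x := -(str G).proj k y) (y := y)
          ((str G).filt_anti (by omega : k + 1 ≤ k + k) ((str G).lie_mem_filt
            (Submodule.neg_mem _ ((str G).layer_le_filt le_rfl ((str G).proj_mem k y))) hyk))
        have := Submodule.add_mem _ h ((str G).sub_proj_mem_filt hyk)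
        convert this using 1
        abel
    have h3 := P.mul_mem (hP.leading_subset hk h1) (ih (k + 1) (by omega) (by omega) h2)
    rwa [mul_inv_cancel_left] at h3

protected theorem isClosed (hP : IsHomogeneous P) : IsClosed (P : Set G) := by
  have h := hP.closure_inter_filt_subset ((str G).step + 1) 1 le_rfl (by omega)
  rw [Stratification.filt_one, Submodule.top_coe, inter_univ] at h
  exact isClosed_of_closure_subset h

end IsHomogeneous

/-! ### Coverings for the Hausdorff and the spherical measure -/

section Gauge

variable {X : Type u} [MetricSpace X]

/-- The set `E` may be used in the coverings that define `ψ^d`, with weight `s ^ d`. -/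
def Adm (k : MeasureKind) (E : Set X) (s : ℝ) : Prop :=
  match k with
  | .hausdorff => ∀ x ∈ E, ∀ y ∈ E, dist x y ≤ s
  | .spherical => ∃ x, E ⊆ Metric.closedBall x (s / 2)

namespace Adm

variable {k : MeasureKind} {E F : Set X} {s t : ℝ}

theorem mono (h : Adm k E s) (hF : F ⊆ E) (hst : s ≤ t) : Adm k F t := by
  cases k with
  | hausdorff => exact fun x hx y hy => (h x (hF hx) y (hF hy)).trans hst
  | spherical =>
    obtain ⟨x, hx⟩ := h
    exact ⟨x, hF.trans (hx.trans (Metric.closedBall_subset_closedBall (by linarith)))⟩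

theorem dist_le (h : Adm k E s) {x y : X} (hx : x ∈ E) (hy : y ∈ E) : dist x y ≤ s := by
  cases k with
  | hausdorff => exact h x hx y hy
  | spherical =>
    obtain ⟨z, hz⟩ := h
    have h1 := hz hx
    have h2 := hz hy
    rw [Metric.mem_closedBall] at h1 h2
    linarith [dist_triangle_right x y z]

theorem closure (h : Adm k E s) : Adm k (closure E) s := by
  cases k with
  | hausdorff =>
    intro x hx y hy
    exact closure_minimal (s := E ×ˢ E) (t := {p : X × X | dist p.1 p.2 ≤ s})
      (fun p hp => h _ hp.1 _ hp.2) (isClosed_le continuous_dist continuous_const)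
      (by rw [closure_prod_eq]; exact ⟨hx, hy⟩ : (x, y) ∈ _root_.closure (E ×ˢ E))
  | spherical =>
    obtain ⟨x, hx⟩ := h
    exact ⟨x, closure_minimal hx Metric.isClosed_closedBall⟩

theorem thicken (h : Adm k E s) (ε : ℝ) : Adm k {y | ∃ x ∈ E, dist y x ≤ ε} (s + 2 * ε) := by
  cases k with
  | hausdorff =>
    rintro x ⟨x', hx', hx⟩ y ⟨y', hy', hy⟩
    have := h x' hx' y' hy'
    linarith [dist_triangle4_right x y x' y']
  | spherical =>
    obtain ⟨z, hz⟩ := h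
    refine ⟨z, fun y hy => ?_⟩
    obtain ⟨x, hx, hyx⟩ := hy
    have := hz hx
    rw [Metric.mem_closedBall] at this ⊢
    linarith [dist_triangle y x z]

theorem image (h : Adm k E s) {f : X → X} {c : ℝ} (hc : 0 ≤ c)
    (hf : ∀ x y, dist (f x) (f y) = c * dist x y) : Adm k (f '' E) (c * s) := by
  cases k with
  | hausdorff =>
    rintro _ ⟨x, hx, rfl⟩ _ ⟨y, hy, rfl⟩
    rw [hf]
    exact mul_le_mul_of_nonneg_left (h x hx y hy) hc
  | spherical =>
    obtain ⟨z, hz⟩ := h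
    refine ⟨f z, ?_⟩
    rintro _ ⟨x, hx, rfl⟩
    rw [Metric.mem_closedBall, hf, mul_div_assoc]
    exact mul_le_mul_of_nonneg_left (hz hx) hc

theorem closedBall (k : MeasureKind) (x : X) (r : ℝ) : Adm k (Metric.closedBall x r) (2 * r) := by
  cases k with
  | hausdorff =>
    intro y hy z hz
    rw [Metric.mem_closedBall] at hy hz
    linarith [dist_triangle_right y z x]
  | spherical => exact ⟨x, by rw [mul_div_cancel_left₀ _ two_ne_zero]⟩

end Adm

/-- The weight of a set in the construction of `ψ^d`. -/
noncomputable def weight (k : MeasureKind) (d : ℝ) (B : Set X) : ℝ≥0∞ :=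
  match k with
  | .hausdorff => Metric.ediam B ^ d
  | .spherical =>
    ⨅ (x : X) (r : ℝ) (_ : 0 ≤ r) (_ : B = Metric.closedBall x r), ENNReal.ofReal (2 * r) ^ d

/-- The outer measure that approximates `ψ^d` by coverings of mesh `δ`. -/
noncomputable def psiPre (k : MeasureKind) (d δ : ℝ) : OuterMeasure X :=
  OuterMeasure.mkMetric'.pre (weight k d) (ENNReal.ofReal δ)

theorem psiPre_le {k : MeasureKind} {d : ℝ} (hd : 0 ≤ d) {δ s : ℝ} {E : Set X} (hs : 0 ≤ s)
    (hsδ : s ≤ δ) (hE : Adm k E s) : psiPre k d δ E ≤ ENNReal.ofReal s ^ d := by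
  cases k with
  | hausdorff =>
    have h : Metric.ediam E ≤ ENNReal.ofReal s := by
      refine Metric.ediam_le fun x hx y hy => ?_
      rw [edist_dist]
      exact ENNReal.ofReal_le_ofReal (hE x hx y hy)
    exact (OuterMeasure.mkMetric'.pre_le (h.trans (ENNReal.ofReal_le_ofReal hsδ))).trans
      (ENNReal.rpow_le_rpow h hd)
  | spherical =>
    obtain ⟨x, hx⟩ := hE
    have h : Metric.ediam (Metric.closedBall x (s / 2)) ≤ ENNReal.ofReal δ := by
      refine Metric.ediam_le fun y hy z hz => ?_
      rw [edist_dist]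
      refine ENNReal.ofReal_le_ofReal (le_trans ?_ hsδ)
      rw [Metric.mem_closedBall] at hy hz
      linarith [dist_triangle_right y z x]
    refine (measure_mono hx).trans ((OuterMeasure.mkMetric'.pre_le h).trans ?_)
    refine iInf_le_of_le x (iInf_le_of_le (s / 2) (iInf_le_of_le (by positivity)
      (iInf_le_of_le rfl ?_)))
    rw [mul_div_cancel₀ _ two_ne_zero]

variable [MeasurableSpace X] [BorelSpace X]

theorem psi_eq (k : MeasureKind) (d : ℝ) :
    (psi k d : Measure X) = Measure.mkMetric' (weight k d) := by
  cases k <;> rfl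

/-- Coverings can be taken measurable at no cost: passing to the closure keeps the diameter, and
closed balls are Borel. This allows `psi` to be estimated by coverings on arbitrary sets. -/
theorem trim_pre_weight (k : MeasureKind) (d : ℝ) (r : ℝ≥0∞) :
    (OuterMeasure.mkMetric'.pre (weight k d : Set X → ℝ≥0∞) r).trim =
      OuterMeasure.mkMetric'.pre (weight k d) r := by
  cases k with
  | hausdorff => exact OuterMeasure.mkMetric'.trim_pre _ (fun s => by simp [weight]) _
  | spherical =>
    refine le_antisymm (OuterMeasure.mkMetric'.le_pre.2 fun s hs => ?_) (OuterMeasure.le_trim _)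
    by_cases h : MeasurableSet s
    · rw [OuterMeasure.trim_eq _ h]
      exact OuterMeasure.mkMetric'.pre_le hs
    · refine le_top.trans_eq (Eq.symm ?_)
      simp only [weight, iInf_eq_top]
      rintro x r _ rfl
      exact absurd Metric.isClosed_closedBall.measurableSet h

theorem psi_le_of_psiPre_le {k : MeasureKind} {d : ℝ} {B : Set X} {c : ℝ≥0∞}
    (h : ∀ δ > 0, psiPre k d δ B ≤ c) : psi k d B ≤ c := by
  have h1 : psi k d B = (OuterMeasure.mkMetric' (weight k d)).trim B := by
    rw [psi_eq]; rfl
  rw [h1, OuterMeasure.mkMetric'.eq_iSup_nat, OuterMeasure.trim_iSup, OuterMeasure.iSup_apply]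
  refine iSup_le fun n => ?_
  rw [trim_pre_weight]
  refine le_trans (OuterMeasure.mkMetric'.mono_pre _ ?_ B) (h (1 / (n + 1)) (by positivity))
  rw [ENNReal.ofReal_div_of_pos (by positivity), ENNReal.ofReal_one, one_div, ENNReal.inv_le_inv,
    ENNReal.ofReal_add (by positivity) zero_le_one, ENNReal.ofReal_natCast]
  exact le_self_add

/-- An outer measure that is bounded by `s ^ d` on the small sets of the coverings is bounded by
`ψ^d`. -/
theorem le_psi {k : MeasureKind} {d : ℝ} (hd : 0 ≤ d) {ν : OuterMeasure X} {δ : ℝ} (hδ : 0 < δ)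
    (h : ∀ (E : Set X) (s : ℝ), 0 ≤ s → s ≤ δ → Adm k E s → ν E ≤ ENNReal.ofReal s ^ d)
    (B : Set X) : ν B ≤ psi k d B := by
  have h1 : ν ≤ OuterMeasure.mkMetric' (weight k d) := by
    refine le_trans ?_ (le_iSup₂ (f := fun r (_ : r > 0) =>
      OuterMeasure.mkMetric'.pre (weight k d : Set X → ℝ≥0∞) r) (ENNReal.ofReal (δ / 2))
      (ENNReal.ofReal_pos.2 (half_pos hδ)))
    refine OuterMeasure.mkMetric'.le_pre.2 fun E hE => ?_
    rcases E.eq_empty_or_nonempty with rfl | ⟨z, hz⟩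
    · simp
    have hfin : Metric.ediam E ≠ ∞ := (hE.trans_lt ENNReal.ofReal_lt_top).ne
    cases k with
    | hausdorff =>
      have h2 := h E (Metric.ediam E).toReal ENNReal.toReal_nonneg (by
        have := ENNReal.toReal_mono ENNReal.ofReal_ne_top hE
        rw [ENNReal.toReal_ofReal (by positivity)] at this
        linarith) (fun x hx y hy => Metric.dist_le_diam_of_mem' hfin hx hy)
      rwa [ENNReal.ofReal_toReal hfin] at h2
    | spherical =>
      refine le_iInf fun x => le_iInf fun r => le_iInf fun hr => le_iInf fun hB => ?_
      have hx : x ∈ E := by rw [hB]; exact Metric.mem_closedBall_self hr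
      -- A ball of small diameter may have been written with a large radius. Since its center
      -- belongs to it, the radius can be capped at the bound `δ / 2` for the diameter.
      refine (h E (2 * min r (δ / 2)) (by positivity) ?_ ⟨x, fun y hy => ?_⟩).trans
        (ENNReal.rpow_le_rpow (ENNReal.ofReal_le_ofReal ?_) hd)
      · linarith [min_le_right r (δ / 2)]
      · rw [mul_div_cancel_left₀ _ two_ne_zero, Metric.mem_closedBall, le_min_iff]
        refine ⟨by rwa [hB] at hy, ?_⟩
        have := (Metric.edist_le_ediam_of_mem hy hx).trans hE
        rwa [edist_dist, ENNReal.ofReal_le_ofReal_iff (by positivity)] at this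
      · linarith [min_le_left r (δ / 2)]
  rw [psi_eq]
  exact (h1 B).trans (le_toMeasure_apply _ _ _)

/-! ### Density theorems -/

/-- If the upper density of `μ` is at most `t` at the points of `B`, then `μ B ≤ t ψ^d(B)`. -/
theorem measure_le_mul_psi {k : MeasureKind} {d : ℝ} (hd : 0 ≤ d) {μ : Measure X} {B : Set X}
    {t : ℝ≥0} (ht : t ≠ 0)
    (h : ∀ p ∈ B, ∃ δ > 0, ∀ (E : Set X) (s : ℝ), p ∈ E → 0 < s → s ≤ δ → Adm k E s →
      μ E ≤ t * ENNReal.ofReal s ^ d) : μ B ≤ t * psi k d B := by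
  have ht0 : (t : ℝ≥0∞) ≠ 0 := by simpa using ht
  -- The points where the density bound holds at the uniform scale `1 / (n + 1)`; on them the
  -- covering bound of `le_psi` applies.
  let C : ℕ → Set X := fun n => {p ∈ B | ∀ (E : Set X) (s : ℝ), p ∈ E → 0 < s →
    s ≤ 1 / ((n : ℝ) + 1) → Adm k E s → μ E ≤ t * ENNReal.ofReal s ^ d}
  have hmono : Monotone C := fun m n hmn p hp => ⟨hp.1, fun E s hpE hs hsn =>
    hp.2 E s hpE hs (hsn.trans (one_div_le_one_div_of_le (by positivity) (by gcongr)))⟩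
  have hunion : B = ⋃ n, C n := by
    refine Subset.antisymm (fun p hp => ?_) (iUnion_subset fun n p hp => hp.1)
    obtain ⟨δ, hδ, hδ'⟩ := h p hp
    obtain ⟨n, hn⟩ := exists_nat_one_div_lt hδ
    exact mem_iUnion.2 ⟨n, hp, fun E s hpE hs hsn => hδ' E s hpE hs (hsn.trans hn.le)⟩
  have hC : ∀ n, μ (C n) ≤ t * psi k d B := by
    intro n
    have hδ : (0 : ℝ) < 1 / ((n : ℝ) + 1) := by positivity
    have key := le_psi (k := k) hd (ν := (t : ℝ≥0∞)⁻¹ • OuterMeasure.restrict (C n) μ.toOuterMeasure)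
      (half_pos hδ) (fun E s hs hsδ hE => ?_) (C n)
    · rw [smul_apply, OuterMeasure.restrict_apply, inter_self, smul_eq_mul,
        Measure.coe_toOuterMeasure, ENNReal.inv_mul_le_iff ht0 ENNReal.coe_ne_top] at key
      refine key.trans ?_
      gcongr
      exact fun p hp => hp.1
    · rw [smul_apply, OuterMeasure.restrict_apply, smul_eq_mul,
        Measure.coe_toOuterMeasure, ENNReal.inv_mul_le_iff ht0 ENNReal.coe_ne_top]
      rcases (E ∩ C n).eq_empty_or_nonempty with h0 | ⟨p, hpE, hpC⟩
      · rw [h0, measure_empty]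
        exact zero_le
      refine (measure_mono inter_subset_left).trans ?_
      -- Approaching `s` from above also covers `s = 0`, where the density assumption says nothing.
      have hlim : Tendsto (fun s' => (t : ℝ≥0∞) * ENNReal.ofReal s' ^ d) (𝓝[>] s)
          (𝓝 (t * ENNReal.ofReal s ^ d)) := by
        refine ENNReal.Tendsto.const_mul ?_ (Or.inr ENNReal.coe_ne_top)
        exact (((ENNReal.continuous_rpow_const.comp ENNReal.continuous_ofReal).tendsto s).mono_left
          nhdsWithin_le_nhds)
      refine ge_of_tendsto hlim ?_
      filter_upwards [Ioo_mem_nhdsGT (show s < 1 / ((n : ℝ) + 1) by linarith)] with s' hs'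
      exact hpC.2 E s' hpE (hs.trans_lt hs'.1) hs'.2.le (hE.mono Subset.rfl hs'.1.le)
  calc μ B = ⨆ n, μ (C n) := by rw [← hmono.measure_iUnion, ← hunion]
    _ ≤ _ := iSup_le hC

/-- If the upper density of `μ` is at least `t` at the points of `B`, then `t ψ^d(B) ≤ μ B`. -/
theorem mul_psi_le_measure {k : MeasureKind} {d : ℝ} (hd : 0 ≤ d) {μ : Measure X}
    [μ.OuterRegular] {B : Set X} {t : ℝ≥0} (ht : t ≠ 0)
    (h : ∀ p ∈ B, ∀ δ > 0, ∃ (E : Set X) (s : ℝ), IsClosed E ∧ p ∈ E ∧ 0 < s ∧ s ≤ δ ∧ Adm k E s ∧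
      t * ENNReal.ofReal s ^ d ≤ μ E) : t * psi k d B ≤ μ B := by
  have ht0 : (t : ℝ≥0∞) ≠ 0 := by simpa using ht
  refine ENNReal.le_of_forall_pos_le_add fun ε hε hB => ?_
  obtain ⟨U, hBU, hU, hμU⟩ := B.exists_isOpen_lt_add hB.ne (ENNReal.coe_pos.2 hε).ne'
  refine le_trans ?_ hμU.le
  have hUfin : μ U ≠ ∞ := hμU.ne_top
  rw [mul_comm, ← ENNReal.le_div_iff_mul_le (Or.inl ht0) (Or.inl ENNReal.coe_ne_top)]
  refine psi_le_of_psiPre_le fun δ hδ => ?_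
  -- The Vitali enlargement of a set of size `s` is its `2 s`-neighbourhood, of size `s + 4 s = 5
  -- s`; the bound `δ / 5` keeps it within the mesh `δ`.
  let T : Set (Set X × ℝ) := {a | IsClosed a.1 ∧ a.1.Nonempty ∧ 0 < a.2 ∧ a.2 ≤ δ / 5 ∧
    Adm k a.1 a.2 ∧ t * ENNReal.ofReal a.2 ^ d ≤ μ a.1 ∧ a.1 ⊆ U}
  obtain ⟨u, huT, hdisj, hu⟩ := Vitali.exists_disjoint_subfamily_covering_enlargement
    (fun a : Set X × ℝ => a.1) T (fun a => a.2) 2 one_lt_two (fun a ha => ha.2.2.1.le) (δ / 5)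
    (fun a ha => ha.2.2.2.1) (fun a ha => ha.2.1)
  have hdisj' : Pairwise (Function.onFun Disjoint fun a : u => a.1.1) := fun a b hab =>
    hdisj a.2 b.2 (fun h => hab (Subtype.ext h))
  have hmeas : ∀ a : u, MeasurableSet a.1.1 := fun a => (huT a.2).1.measurableSet
  have hsubU : ⋃ a : u, a.1.1 ⊆ U := iUnion_subset fun a => (huT a.2).2.2.2.2.2.2
  have hsum : ∑' a : u, ENNReal.ofReal a.1.2 ^ d ≤ μ U / t := by
    rw [ENNReal.le_div_iff_mul_le (Or.inl ht0) (Or.inl ENNReal.coe_ne_top), mul_comm,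
      ← ENNReal.tsum_mul_left]
    calc _ ≤ ∑' a : u, μ a.1.1 := ENNReal.tsum_le_tsum fun a => (huT a.2).2.2.2.2.2.1
      _ ≤ μ (⋃ a : u, a.1.1) := tsum_meas_le_meas_iUnion_of_disjoint μ hmeas hdisj'
      _ ≤ μ U := measure_mono hsubU
  have hcount : Countable u := by
    have h1 := Measure.countable_meas_pos_of_disjoint_of_meas_iUnion_ne_top μ hmeas hdisj'
      (ne_top_of_le_ne_top hUfin (measure_mono hsubU))
    have h2 : {a : u | 0 < μ a.1.1} = univ := by
      refine eq_univ_of_forall fun a => ?_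
      refine lt_of_lt_of_le ?_ (huT a.2).2.2.2.2.2.1
      exact ENNReal.mul_pos ht0
        (ENNReal.rpow_pos (ENNReal.ofReal_pos.2 (huT a.2).2.2.1) ENNReal.ofReal_ne_top).ne'
    rw [h2] at h1
    exact countable_univ_iff.1 h1
  have hsumfin : ∑' a : u, ENNReal.ofReal a.1.2 ^ d ≠ ∞ :=
    ne_top_of_le_ne_top (ENNReal.div_ne_top hUfin ht0) hsum
  let N : u → Set X := fun a => {y | ∃ x ∈ a.1.1, dist y x ≤ 2 * a.1.2}
  -- Finitely many selected sets are used without enlargement: a point off their closed union has a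
  -- small competitor disjoint from it, which must meet one of the other selected sets. The factor
  -- `5 ^ d` then affects only the tail of a convergent series, and the sharp constant survives.
  have hcover : ∀ F : Finset u, B ⊆ (⋃ a ∈ F, a.1.1) ∪ ⋃ a : {a : u // a ∉ F}, N a := by
    intro F p hp
    by_cases hpF : p ∈ ⋃ a ∈ F, a.1.1
    · exact Or.inl hpF
    right
    have hclosed : IsClosed (⋃ a ∈ F, a.1.1) :=
      isClosed_biUnion_finset fun a _ => (huT a.2).1
    obtain ⟨r, hr, hrsub⟩ := Metric.isOpen_iff.1 (hU.inter hclosed.isOpen_compl) p ⟨hBU hp, hpF⟩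
    obtain ⟨E, s, hEcl, hpE, hs, hsle, hE, hEμ⟩ := h p hp (min (r / 2) (δ / 5)) (by positivity)
    have hEsub : E ⊆ U ∩ (⋃ a ∈ F, a.1.1)ᶜ := fun y hy => hrsub (by
      rw [Metric.mem_ball]
      linarith [hE.dist_le hy hpE, min_le_left (r / 2) (δ / 5)])
    obtain ⟨b, hbu, ⟨z, hzE, hzb⟩, hsb⟩ := hu (E, s) ⟨hEcl, ⟨p, hpE⟩, hs,
      hsle.trans (min_le_right _ _), hE, hEμ, fun y hy => (hEsub hy).1⟩
    refine mem_iUnion.2 ⟨⟨⟨b, hbu⟩, fun hbF => ?_⟩, z, hzb, ?_⟩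
    · exact (hEsub hzE).2 (mem_biUnion hbF hzb)
    · exact (hE.dist_le hpE hzE).trans hsb
  have hbound : ∀ F : Finset u, psiPre k d δ B ≤ ∑' a : u, ENNReal.ofReal a.1.2 ^ d +
      ENNReal.ofReal 5 ^ d * ∑' a : {a : u // a ∉ F}, ENNReal.ofReal a.1.1.2 ^ d := by
    intro F
    calc psiPre k d δ B ≤ psiPre k d δ (⋃ a ∈ F, a.1.1) +
          psiPre k d δ (⋃ a : {a : u // a ∉ F}, N a) :=
          (measure_mono (hcover F)).trans (measure_union_le _ _)
      _ ≤ _ := by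
        refine add_le_add ?_ ?_
        · refine (measure_biUnion_finset_le F _).trans (le_trans (Finset.sum_le_sum fun a _ => ?_)
            (ENNReal.sum_le_tsum F))
          have := huT a.2
          exact psiPre_le hd this.2.2.1.le (this.2.2.2.1.trans (by linarith)) this.2.2.2.2.1
        · refine (measure_iUnion_le _).trans ?_
          rw [← ENNReal.tsum_mul_left]
          refine ENNReal.tsum_le_tsum fun a => ?_
          have := huT a.1.2
          have h5 := this.2.2.2.2.1.thicken (2 * a.1.1.2)
          rw [← ENNReal.mul_rpow_of_nonneg _ _ hd, ← ENNReal.ofReal_mul (by norm_num)]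
          refine psiPre_le hd (by linarith [this.2.2.1]) (by linarith [this.2.2.2.1])
            (h5.mono Subset.rfl (by linarith))
  have hlim : Tendsto (fun F : Finset u => ∑' a : u, ENNReal.ofReal a.1.2 ^ d +
      ENNReal.ofReal 5 ^ d * ∑' a : {a : u // a ∉ F}, ENNReal.ofReal a.1.1.2 ^ d) atTop
      (𝓝 (∑' a : u, ENNReal.ofReal a.1.2 ^ d + ENNReal.ofReal 5 ^ d * 0)) := by
    refine tendsto_const_nhds.add (ENNReal.Tendsto.const_mul
      (ENNReal.tendsto_tsum_compl_atTop_zero hsumfin) (Or.inr ?_))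
    exact ENNReal.rpow_ne_top_of_nonneg hd ENNReal.ofReal_ne_top
  rw [mul_zero, add_zero] at hlim
  exact (ge_of_tendsto' hlim hbound).trans hsum

/-- The upper density of a measure with respect to `ψ^d`. -/
noncomputable def upperDensity (k : MeasureKind) (d : ℝ) (μ : Measure X) (p : X) : ℝ≥0∞ :=
  ⨅ n : ℕ, ⨆ (a : Set X × ℝ) (_ : p ∈ interior a.1 ∧ 0 < a.2 ∧ a.2 ≤ 1 / ((n : ℝ) + 1) ∧
    Adm k a.1 a.2), μ a.1 / ENNReal.ofReal a.2 ^ d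

/-- Since the competitors contain the point in their interior, the superlevel sets of each supremum
are unions of open sets. -/
theorem measurable_upperDensity (k : MeasureKind) (d : ℝ) (μ : Measure X) :
    Measurable (upperDensity k d μ) := by
  refine Measurable.iInf fun n => measurable_of_Ioi fun t => IsOpen.measurableSet ?_
  have : (fun p => ⨆ (a : Set X × ℝ) (_ : p ∈ interior a.1 ∧ 0 < a.2 ∧ a.2 ≤ 1 / ((n : ℝ) + 1) ∧
      Adm k a.1 a.2), μ a.1 / ENNReal.ofReal a.2 ^ d) ⁻¹' Ioi t =
      ⋃ (a : Set X × ℝ) (_ : 0 < a.2 ∧ a.2 ≤ 1 / ((n : ℝ) + 1) ∧ Adm k a.1 a.2 ∧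
        t < μ a.1 / ENNReal.ofReal a.2 ^ d), interior a.1 := by
    ext p
    simp only [mem_preimage, mem_Ioi, lt_iSup_iff, mem_iUnion, exists_prop]
    exact exists_congr fun a => by tauto
  rw [this]
  exact isOpen_iUnion fun a => isOpen_iUnion fun _ => isOpen_interior

omit [BorelSpace X] in
theorem upperDensity_eq {k : MeasureKind} {d : ℝ} {μ : Measure X} {p : X} {g : ℝ≥0∞}
    (upper : ∀ t : ℝ≥0, g < t → ∃ δ > 0, ∀ (E : Set X) (s : ℝ), p ∈ E → 0 < s → s ≤ δ →
      Adm k E s → μ E ≤ t * ENNReal.ofReal s ^ d)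
    (lower : ∀ t : ℝ≥0, t < g → ∀ δ > 0, ∃ (E : Set X) (s : ℝ), IsClosed E ∧ p ∈ interior E ∧
      0 < s ∧ s ≤ δ ∧ Adm k E s ∧ t * ENNReal.ofReal s ^ d ≤ μ E) :
    upperDensity k d μ p = g := by
  have hpos : ∀ s : ℝ, 0 < s → ENNReal.ofReal s ^ d ≠ 0 := fun s hs =>
    (ENNReal.rpow_pos (ENNReal.ofReal_pos.2 hs) ENNReal.ofReal_ne_top).ne'
  have hfin : ∀ s : ℝ, 0 < s → ENNReal.ofReal s ^ d ≠ ∞ := fun s hs =>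
    ENNReal.rpow_ne_top_of_ne_zero (ENNReal.ofReal_pos.2 hs).ne' ENNReal.ofReal_ne_top
  refine le_antisymm ?_ ?_
  · refine le_of_forall_gt_imp_ge_of_dense fun c hc => ?_
    obtain ⟨t, ht, htc⟩ := ENNReal.lt_iff_exists_nnreal_btwn.1 hc
    refine le_trans ?_ htc.le
    obtain ⟨δ, hδ, h⟩ := upper t ht
    obtain ⟨n, hn⟩ := exists_nat_one_div_lt hδ
    refine iInf_le_of_le n (iSup₂_le fun a ha => ?_)
    rw [ENNReal.div_le_iff (hpos _ ha.2.1) (hfin _ ha.2.1)]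
    exact h a.1 a.2 (interior_subset ha.1) ha.2.1 (ha.2.2.1.trans hn.le) ha.2.2.2
  · refine ENNReal.le_of_forall_nnreal_lt fun t ht => le_iInf fun n => ?_
    obtain ⟨E, s, -, hpE, hs, hsn, hE, hμ⟩ := lower t ht (1 / ((n : ℝ) + 1)) (by positivity)
    refine le_iSup₂_of_le (E, s) ⟨hpE, hs, hsn, hE⟩ ?_
    rwa [ENNReal.le_div_iff_mul_le (Or.inl (hpos s hs)) (Or.inl (hfin s hs))]

end Gauge

/-- Two measures whose ratio is controlled by the values of `g` have density `g` with respect to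
each other. -/
theorem measure_eq_setLIntegral_of_forall_le {X : Type*} [MeasurableSpace X] {μ ν : Measure X}
    {g : X → ℝ≥0∞} (hg : Measurable g) {S : Set X}
    (h0 : ∀ p ∈ S, g p ≠ 0) (htop : ∀ p ∈ S, g p ≠ ∞)
    (hle : ∀ B ⊆ S, ∀ t : ℝ≥0, t ≠ 0 → (∀ p ∈ B, g p < t) → μ B ≤ t * ν B)
    (hge : ∀ B ⊆ S, ∀ t : ℝ≥0, t ≠ 0 → (∀ p ∈ B, t < g p) → t * ν B ≤ μ B)
    {B : Set X} (hB : MeasurableSet B) (hBS : B ⊆ S) : μ B = ∫⁻ p in B, g p ∂ν := by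
  set ρ := ν.withDensity g with hρ
  rw [← withDensity_apply g hB, ← hρ]
  have decomp : ∀ (m : Measure X) (t : ℝ≥0), 1 < t →
      m B = ∑' n : ℤ, m (B ∩ g ⁻¹' Ico ((t : ℝ≥0∞) ^ n) ((t : ℝ≥0∞) ^ (n + 1))) := by
    intro m t ht
    rw [measure_eq_measure_preimage_add_measure_tsum_Ico_zpow m hg hB ht]
    have e1 : B ∩ g ⁻¹' {0} = ∅ := by
      ext p; simpa using fun hp => h0 p (hBS hp)
    have e2 : B ∩ g ⁻¹' {∞} = ∅ := by
      ext p; simpa using fun hp => htop p (hBS hp)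
    simp [e1, e2]
  have main : ∀ t : ℝ≥0, 1 < t → μ B ≤ t * ρ B ∧ ρ B ≤ (t : ℝ≥0∞) ^ 2 * μ B := by
    intro t ht
    have t0' : t ≠ 0 := (zero_lt_one.trans ht).ne'
    have t0 : (t : ℝ≥0∞) ≠ 0 := by simpa using t0'
    have hmeas : ∀ n : ℤ, MeasurableSet
        (B ∩ g ⁻¹' Ico ((t : ℝ≥0∞) ^ n) ((t : ℝ≥0∞) ^ (n + 1))) :=
      fun n => hB.inter (hg measurableSet_Ico)
    rw [decomp μ t ht, decomp ρ t ht, ← ENNReal.tsum_mul_left, ← ENNReal.tsum_mul_left]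
    refine ⟨ENNReal.tsum_le_tsum fun n => ?_, ENNReal.tsum_le_tsum fun n => ?_⟩
    · have h1 := hle (B ∩ g ⁻¹' Ico ((t : ℝ≥0∞) ^ n) ((t : ℝ≥0∞) ^ (n + 1)))
        (inter_subset_left.trans hBS) (t ^ (n + 1)) (zpow_ne_zero _ t0') (fun p hp => by
          rw [ENNReal.coe_zpow t0']; exact hp.2.2)
      have h2 : ((t ^ (n + 1) : ℝ≥0) : ℝ≥0∞) = t * (t : ℝ≥0∞) ^ n := by
        rw [ENNReal.coe_zpow t0', add_comm, ENNReal.zpow_add t0 ENNReal.coe_ne_top, zpow_one]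
      rw [h2, mul_assoc] at h1
      refine h1.trans ?_
      gcongr
      rw [hρ, withDensity_apply _ (hmeas n), ← setLIntegral_const]
      exact setLIntegral_mono hg fun p hp => hp.2.1
    -- The strict inequality required by `hge` forces the exponent `n - 1`, hence the factor `t ^
    -- 2`, which is harmless as `t → 1`.
    · have h1 := hge (B ∩ g ⁻¹' Ico ((t : ℝ≥0∞) ^ n) ((t : ℝ≥0∞) ^ (n + 1)))
        (inter_subset_left.trans hBS) (t ^ (n - 1)) (zpow_ne_zero _ t0') (fun p hp => by
          refine lt_of_lt_of_le ?_ hp.2.1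
          rw [← ENNReal.coe_zpow t0', ENNReal.coe_lt_coe]
          exact zpow_lt_zpow_right₀ ht (by omega))
      calc ρ _ ≤ (t : ℝ≥0∞) ^ (n + 1) * ν _ := by
            rw [hρ, withDensity_apply _ (hmeas n), ← setLIntegral_const]
            exact setLIntegral_mono measurable_const fun p hp => hp.2.2.le
        _ = (t : ℝ≥0∞) ^ (2 : ℤ) * ((t : ℝ≥0∞) ^ (n - 1) * ν _) := by
            rw [← mul_assoc, ← ENNReal.zpow_add t0 ENNReal.coe_ne_top]
            congr 2
            abel
        _ ≤ (t : ℝ≥0∞) ^ 2 * μ _ := by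
            rw [ENNReal.coe_zpow t0'] at h1
            exact mul_le_mul' (le_of_eq (by norm_cast)) h1
  have l1 : ∀ c : ℝ≥0∞, Tendsto (fun t : ℝ≥0 => (t : ℝ≥0∞) * c) (𝓝[>] 1) (𝓝 (1 * c)) := by
    intro c
    refine ENNReal.Tendsto.mul_const ?_ (Or.inl (by simp))
    exact (ENNReal.tendsto_coe.2 tendsto_id).mono_left nhdsWithin_le_nhds
  have l2 : ∀ c : ℝ≥0∞, Tendsto (fun t : ℝ≥0 => (t : ℝ≥0∞) ^ 2 * c) (𝓝[>] 1) (𝓝 (1 ^ 2 * c)) := by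
    intro c
    refine ENNReal.Tendsto.mul_const (ENNReal.Tendsto.pow ?_) (Or.inl (by simp))
    exact (ENNReal.tendsto_coe.2 tendsto_id).mono_left nhdsWithin_le_nhds
  refine le_antisymm ?_ ?_
  · have := ge_of_tendsto (l1 (ρ B)) (eventually_mem_nhdsWithin.mono fun t ht => (main t ht).1)
    rwa [one_mul] at this
  · have := ge_of_tendsto (l2 (μ B)) (eventually_mem_nhdsWithin.mono fun t ht => (main t ht).2)
    rwa [one_pow, one_mul] at this

/-! ### The projection onto a subgroup along a complementary one -/

section Projection

variable {G : Type u} [CarnotGroup G] {P V : Subgroup G}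

namespace Complementary

/-- The projection onto `P` along `V`. -/
noncomputable def fst (h : Complementary P V) (g : G) : G := (h.1 g).choose

theorem fst_mem (h : Complementary P V) (g : G) : h.fst g ∈ P := (h.1 g).choose_spec.1

theorem inv_fst_mul_mem (h : Complementary P V) (g : G) : (h.fst g)⁻¹ * g ∈ V := by
  obtain ⟨v, hv, hg⟩ := (h.1 g).choose_spec.2
  have : (h.fst g)⁻¹ * g = v := by
    rw [inv_mul_eq_iff_eq_mul]
    exact hg
  rwa [this]

theorem eq_of_inv_mul_mem (h : Complementary P V) {p q : G} (hp : p ∈ P) (hq : q ∈ P)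
    (hpq : p⁻¹ * q ∈ V) : p = q := by
  have : p⁻¹ * q ∈ P ⊓ V := ⟨P.mul_mem (P.inv_mem hp) hq, hpq⟩
  rw [h.2, Subgroup.mem_bot, inv_mul_eq_one] at this
  exact this

theorem fst_eq (h : Complementary P V) {g p : G} (hp : p ∈ P) (hg : p⁻¹ * g ∈ V) : h.fst g = p := by
  refine h.eq_of_inv_mul_mem (h.fst_mem g) hp ?_
  have := V.mul_mem (h.inv_fst_mul_mem g) (V.inv_mem hg)
  rwa [mul_inv_rev, inv_inv, mul_assoc, mul_inv_cancel_left] at this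

theorem fst_mul_right (h : Complementary P V) (g : G) {v : G} (hv : v ∈ V) :
    h.fst (g * v) = h.fst g :=
  h.fst_eq (h.fst_mem g) (by rw [← mul_assoc]; exact V.mul_mem (h.inv_fst_mul_mem g) hv)

theorem fst_of_mem (h : Complementary P V) {p : G} (hp : p ∈ P) : h.fst p = p :=
  h.fst_eq hp (by rw [inv_mul_cancel]; exact V.one_mem)

theorem fst_one (h : Complementary P V) : h.fst 1 = 1 := h.fst_of_mem P.one_mem

theorem fst_of_mem_right (h : Complementary P V) {v : G} (hv : v ∈ V) : h.fst v = 1 :=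
  h.fst_eq P.one_mem (by simpa using hv)

theorem fst_dil (h : Complementary P V) (hP : IsHomogeneous P) (hV : IsHomogeneous V) {t : ℝ}
    (ht : 0 < t) (g : G) : h.fst (dil t g) = dil t (h.fst g) := by
  refine h.fst_eq (hP.dil_mem ht (h.fst_mem g)) ?_
  rw [← dil_inv, ← dil_mul]
  exact hV.dil_mem ht (h.inv_fst_mul_mem g)

/-- The unit sphere of `P` is compact and misses the closed set `V`, so `gnorm (p * v)` is bounded
below for unit `p`; dilations remove the normalization. -/
theorem exists_gnorm_fst_le (h : Complementary P V) (hP : IsHomogeneous P) (hV : IsHomogeneous V) :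
    ∃ C > 0, ∀ g : G, gnorm (h.fst g) ≤ C * gnorm g := by
  have hK : IsCompact ((P : Set G) ∩ Metric.sphere 1 1) :=
    (isCompact_sphere _ _).inter_left hP.isClosed
  have hdisj : Disjoint ((P : Set G) ∩ Metric.sphere 1 1) (V : Set G) := by
    refine Set.disjoint_left.2 fun x hx hxV => ?_
    have : x ∈ P ⊓ V := ⟨hx.1, hxV⟩
    rw [h.2, Subgroup.mem_bot] at this
    have h1 := hx.2
    rw [this, Metric.mem_sphere, dist_self] at h1
    exact zero_ne_one h1
  obtain ⟨r, hr, hrV⟩ := Metric.exists_pos_forall_lt_edist hK hV.isClosed hdisj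
  have hr' : (0 : ℝ) < r := hr
  refine ⟨(r : ℝ)⁻¹, by positivity, fun g => ?_⟩
  rcases (gnorm_nonneg (h.fst g)).eq_or_lt with h0 | h0
  · rw [← h0]
    exact mul_nonneg (by positivity) (gnorm_nonneg g)
  set R := gnorm (h.fst g) with hR
  have hRi : 0 < R⁻¹ := inv_pos.2 h0
  have h1 : (dil R⁻¹ (h.fst g))⁻¹ ∈ (P : Set G) ∩ Metric.sphere 1 1 := by
    refine ⟨P.inv_mem (hP.dil_mem hRi (h.fst_mem g)), ?_⟩
    rw [Metric.mem_sphere, dist_comm]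
    change gnorm _ = 1
    rw [gnorm_inv, gnorm_dil hRi, ← hR, inv_mul_cancel₀ h0.ne']
  have h2 := hrV _ h1 (dil R⁻¹ ((h.fst g)⁻¹ * g)) (hV.dil_mem hRi (h.inv_fst_mul_mem g))
  rw [edist_dist, dist_eq_gnorm, inv_inv, ← dil_mul, mul_inv_cancel_left, gnorm_dil hRi,
    ← ENNReal.ofReal_coe_nnreal] at h2
  replace h2 := (ENNReal.ofReal_lt_ofReal_iff_of_nonneg r.coe_nonneg).1 h2
  rw [lt_inv_mul_iff₀ h0] at h2
  rw [← div_eq_inv_mul, le_div_iff₀ hr']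
  exact h2.le

/-- The linear bound keeps the values near `g` in a compact set. Every cluster value `y` satisfies
`y ∈ P` and `y⁻¹ * g ∈ V` by closedness, and uniqueness of the decomposition identifies it. -/
theorem continuous_fst (h : Complementary P V) (hP : IsHomogeneous P) (hV : IsHomogeneous V) :
    Continuous h.fst := by
  obtain ⟨C, hC, hbound⟩ := h.exists_gnorm_fst_le hP hV
  refine continuous_iff_continuousAt.2 fun g => ?_
  have hK : IsCompact (Metric.closedBall (1 : G) (C * (gnorm g + 1))) := isCompact_closedBall _ _
  refine hK.tendsto_nhds_of_unique_mapClusterPt ?_ fun y _ hy => ?_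
  · have : ∀ᶠ x in 𝓝 g, gnorm x < gnorm g + 1 :=
      continuous_gnorm.continuousAt.eventually_lt continuousAt_const (by linarith)
    filter_upwards [this] with x hx
    rw [Metric.mem_closedBall, dist_comm]
    exact (hbound x).trans (by gcongr)
  · obtain ⟨U, hU, hUy⟩ := mapClusterPt_iff_ultrafilter.1 hy
    have hyP : y ∈ P := hP.isClosed.mem_of_tendsto hUy (Eventually.of_forall fun x => h.fst_mem x)
    have hyV : y⁻¹ * g ∈ V := hV.isClosed.mem_of_tendsto (hUy.inv.mul (tendsto_id.mono_left hU))
      (Eventually.of_forall fun x => h.inv_fst_mul_mem x)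
    exact (h.fst_eq hyP hyV).symm

/-- The action of `g` on `W` that corresponds to the left translation by `g` of the graphs over
`W`. -/
theorem fst_mul_left {W : Subgroup G} (h : Complementary W V) (hW : W.Normal) (g x : G) :
    h.fst (g * x) = h.fst g *
      (((h.fst g)⁻¹ * g) * h.fst x * ((h.fst g)⁻¹ * g)⁻¹) := by
  refine h.fst_eq (W.mul_mem (h.fst_mem g) (hW.conj_mem _ (h.fst_mem x) _)) ?_
  have := V.mul_mem (h.inv_fst_mul_mem g) (h.inv_fst_mul_mem x)
  convert this using 1
  group

end Complementary

end Projection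

/-! ### Haar measures of normal homogeneous subgroups -/

/-- `τ` is (the image in `G` of) a Haar measure on the homogeneous normal subgroup `W`; it is
invariant under the inner automorphisms of `G`. -/
structure IsHomogeneousHaar {G : Type u} [CarnotGroup G] [MeasurableSpace G] (W : Subgroup G)
    (d : ℝ) (τ : Measure G) : Prop where
  finite : IsFiniteMeasureOnCompacts τ
  nonneg : 0 ≤ d
  mul_left : ∀ w ∈ W, ∀ E : Set G, τ ((fun x => w * x) '' E) = τ E
  conj : ∀ (g : G) (E : Set G), τ ((fun x => g * x * g⁻¹) '' E) = τ E
  dil : ∀ t : ℝ, 0 < t → ∀ E : Set G, τ ((dil t : G → G) '' E) = ENNReal.ofReal t ^ d * τ E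
  ne_zero : τ W ≠ 0

section Haar

variable {G : Type u} [CarnotGroup G] [MeasurableSpace G] [BorelSpace G]

/-- The homeomorphism `δ_t`. -/
noncomputable def dilHomeo (t : ℝ) (ht : 0 < t) : G ≃ₜ G where
  toFun := dil t
  invFun := dil t⁻¹
  left_inv x := by rw [dil_dil, inv_mul_cancel₀ ht.ne', dil_one_left]
  right_inv x := by rw [dil_dil, mul_inv_cancel₀ ht.ne', dil_one_left]
  continuous_toFun := continuous_of_linear _
  continuous_invFun := continuous_of_linear _

theorem ofReal_rpow_ne_zero {t : ℝ} (ht : 0 < t) (d : ℝ) : ENNReal.ofReal t ^ d ≠ 0 :=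
  (ENNReal.rpow_pos (ENNReal.ofReal_pos.2 ht) ENNReal.ofReal_ne_top).ne'

theorem ofReal_rpow_ne_top {t : ℝ} (ht : 0 < t) (d : ℝ) : ENNReal.ofReal t ^ d ≠ ∞ :=
  ENNReal.rpow_ne_top_of_ne_zero (ENNReal.ofReal_pos.2 ht).ne' ENNReal.ofReal_ne_top

theorem measure_image_homeomorph {X : Type*} [TopologicalSpace X] [MeasurableSpace X]
    [BorelSpace X] {τ : Measure X} (f : X ≃ₜ X) (hf : τ.map f = τ) (E : Set X) :
    τ (f '' E) = τ E := by
  have h := f.toMeasurableEquiv.map_apply (μ := τ) (f '' E)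
  change τ.map f (f '' E) = τ (f ⁻¹' (f '' E)) at h
  rwa [hf, f.injective.preimage_image] at h

theorem measure_image_dil {W : Subgroup G} {d : ℝ} {θ : Measure W}
    (hθ : ∀ t : ℝ, 0 < t → (θ.map (Subtype.val : W → G)).map (Carnot.dil t : G → G) =
      ENNReal.ofReal (t ^ (-d)) • θ.map (Subtype.val : W → G)) {t : ℝ} (ht : 0 < t) (E : Set G) :
    θ.map (Subtype.val : W → G) ((dil t : G → G) '' E) =
      ENNReal.ofReal t ^ d * θ.map (Subtype.val : W → G) E := by
  set τ := θ.map (Subtype.val : W → G)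
  have h := (dilHomeo (G := G) t ht).toMeasurableEquiv.map_apply (μ := τ) ((dil t : G → G) '' E)
  change τ.map (dil t : G → G) _ = τ ((dil t : G → G) ⁻¹' _) at h
  have hinj : Function.Injective (dil t : G → G) := (dilHomeo (G := G) t ht).injective
  rw [hinj.preimage_image, hθ t ht, Measure.smul_apply, smul_eq_mul,
    ← ENNReal.ofReal_rpow_of_pos ht, ENNReal.rpow_neg] at h
  rw [← h, ← mul_assoc, ENNReal.mul_inv_cancel (ofReal_rpow_ne_zero ht d) (ofReal_rpow_ne_top ht d),
    one_mul]

/-- Inner automorphisms do not change the Haar measures of a normal homogeneous subgroup. -/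
theorem map_conjNormal_eq {W : Subgroup G} (hW : W.Normal) (hWcl : IsClosed (W : Set G)) {d : ℝ}
    (hd : 0 ≤ d)
    {θ : Measure W} (hH : θ.IsHaarMeasure)
    (hball : ∀ r : ℝ, 0 < r → θ (Metric.closedBall 1 r) =
      ENNReal.ofReal r ^ d * θ (Metric.closedBall 1 1)) (g : G) :
    θ.map (MulAut.conjNormal g : W ≃* W) = θ := by
  have : LocallyCompactSpace W := hWcl.locallyCompactSpace
  have hcont : ∀ g : G, Continuous (MulAut.conjNormal g : W ≃* W) := fun g =>
    Continuous.subtype_mk ((continuous_const.mul continuous_subtype_val).mul continuous_const) _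
  have key : ∀ g : G, θ.map (MulAut.conjNormal g : W ≃* W) ≤ θ := by
    intro g
    have hsymm : Continuous (MulAut.conjNormal g : W ≃* W).symm := by
      have := hcont g⁻¹
      rwa [map_inv] at this
    have : (θ.map (MulAut.conjNormal g : W ≃* W)).IsHaarMeasure :=
      MulEquiv.isHaarMeasure_map θ _ (hcont g) hsymm
    have heq := Measure.isMulLeftInvariant_eq_smul (θ.map (MulAut.conjNormal g : W ≃* W)) θ
    set c := Measure.haarScalarFactor (θ.map (MulAut.conjNormal g : W ≃* W)) θ
    have hpos : θ (Metric.closedBall 1 1) ≠ 0 :=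
      (Metric.measure_closedBall_pos θ 1 one_pos).ne'
    have hfin : θ (Metric.closedBall 1 1) ≠ ∞ := by
      have hK : IsCompact (Metric.closedBall (1 : W) 1) := by
        rw [Subtype.isCompact_iff]
        have : Subtype.val '' Metric.closedBall (1 : W) 1 = (W : Set G) ∩ Metric.closedBall 1 1 := by
          ext x
          constructor
          · rintro ⟨y, hy, rfl⟩
            exact ⟨y.2, hy⟩
          · rintro ⟨h1, h2⟩
            exact ⟨⟨x, h1⟩, h2, rfl⟩
        rw [this]
        exact (isCompact_closedBall _ _).inter_left hWcl
      exact hK.measure_ne_top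
    -- Undoing the conjugation by `g` enlarges the radius `r` by at most `2 * gnorm g`. As `r → ∞`
    -- the ratio of the volumes tends to 1.
    have hc : ∀ r : ℝ, 0 < r → (c : ℝ≥0∞) ≤ ENNReal.ofReal ((r + 2 * gnorm g) / r) ^ d := by
      intro r hr
      have hr' : 0 < r + 2 * gnorm g := by linarith [gnorm_nonneg g]
      have h1 : θ.map (MulAut.conjNormal g : W ≃* W) (Metric.closedBall 1 r) =
          c * θ (Metric.closedBall 1 r) := by
        conv_lhs => rw [heq]
        rfl
      rw [Measure.map_apply (hcont g).measurable Metric.isClosed_closedBall.measurableSet,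
        hball r hr] at h1
      have h2 : (MulAut.conjNormal g : W ≃* W) ⁻¹' Metric.closedBall 1 r ⊆
          Metric.closedBall 1 (r + 2 * gnorm g) := by
        intro w hw
        have hw' : gnorm (g * w * g⁻¹) ≤ r := by
          rw [mem_preimage, Metric.mem_closedBall, dist_comm] at hw
          exact hw
        rw [Metric.mem_closedBall, dist_comm]
        change gnorm (w : G) ≤ _
        calc gnorm (w : G) = gnorm (g⁻¹ * (g * w * g⁻¹) * g) := by group
          _ ≤ gnorm g⁻¹ + gnorm (g * w * g⁻¹) + gnorm g :=
            (gnorm_mul_le _ _).trans (add_le_add_left (gnorm_mul_le _ _) _)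
          _ ≤ r + 2 * gnorm g := by rw [gnorm_inv]; linarith
      have h3 := measure_mono (μ := θ) h2
      rw [h1, hball _ hr', ← mul_assoc, ENNReal.mul_le_mul_iff_left hpos hfin] at h3
      rw [ENNReal.ofReal_div_of_pos hr, ENNReal.div_rpow_of_nonneg _ _ hd,
        ENNReal.le_div_iff_mul_le (Or.inl (ofReal_rpow_ne_zero hr d))
          (Or.inl (ofReal_rpow_ne_top hr d))]
      exact h3
    have hc1 : (c : ℝ≥0∞) ≤ 1 := by
      have hlim : Tendsto (fun r : ℝ => ENNReal.ofReal ((r + 2 * gnorm g) / r) ^ d) atTop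
          (𝓝 (ENNReal.ofReal 1 ^ d)) := by
        refine ((ENNReal.continuous_rpow_const.comp ENNReal.continuous_ofReal).tendsto 1).comp ?_
        have : Tendsto (fun r : ℝ => 1 + 2 * gnorm g / r) atTop (𝓝 (1 + 0)) :=
          tendsto_const_nhds.add (tendsto_const_nhds.div_atTop tendsto_id)
        rw [add_zero] at this
        refine this.congr' ?_
        filter_upwards [eventually_gt_atTop 0] with r hr
        field_simp
      rw [ENNReal.ofReal_one, ENNReal.one_rpow] at hlim
      exact ge_of_tendsto hlim (eventually_gt_atTop 0 |>.mono hc)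
    rw [heq]
    refine Measure.le_iff.2 fun s _ => ?_
    calc (c • θ) s = c * θ s := rfl
      _ ≤ 1 * θ s := by gcongr
      _ = θ s := one_mul _
  refine le_antisymm (key g) ?_
  -- Pushing the inequality for `g⁻¹` forward by `g` gives the reverse inequality.
  have h := Measure.map_mono (key g⁻¹) (hcont g).measurable
  rw [Measure.map_map (hcont g).measurable (hcont g⁻¹).measurable] at h
  convert h using 1
  conv_lhs => rw [← Measure.map_id (μ := θ)]
  congr 1
  ext w
  simp

theorem IsSplitting.exists_isHomogeneousHaar {W V : Subgroup G} (hWV : IsSplitting W V) {d : ℝ}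
    (hd : IsHomogeneousDimension W d) : ∃ τ : Measure G, IsHomogeneousHaar W d τ := by
  obtain ⟨θ, hH, hθ⟩ := hd
  have hWcl := hWV.homogeneous_left.isClosed
  have hW := hWV.normal
  have hemb : MeasurableEmbedding (Subtype.val : W → G) :=
    MeasurableEmbedding.subtype_coe hWcl.measurableSet
  have hpre : ∀ r, (Subtype.val : W → G) ⁻¹' Metric.closedBall 1 r = Metric.closedBall 1 r :=
    fun r => rfl
  set τ := θ.map (Subtype.val : W → G) with hτ
  have hdil : ∀ t : ℝ, 0 < t → ∀ E : Set G,
      τ ((dil t : G → G) '' E) = ENNReal.ofReal t ^ d * τ E :=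
    fun t ht E => measure_image_dil hθ ht E
  have hdilball : ∀ r : ℝ, 0 < r →
      (dil r : G → G) '' Metric.closedBall 1 1 = Metric.closedBall 1 r := by
    intro r hr
    ext x
    simp only [mem_image, Metric.mem_closedBall, dist_comm _ (1 : G)]
    constructor
    · rintro ⟨y, hy, rfl⟩
      change gnorm _ ≤ r
      rw [gnorm_dil hr]
      exact mul_le_of_le_one_right hr.le hy
    · intro hx
      refine ⟨dil r⁻¹ x, ?_, by rw [dil_dil, mul_inv_cancel₀ hr.ne', dil_one_left]⟩
      change gnorm _ ≤ 1
      rw [gnorm_dil (inv_pos.2 hr), inv_mul_le_iff₀ hr, mul_one]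
      exact hx
  have hball : ∀ r : ℝ, 0 < r → θ (Metric.closedBall 1 r) =
      ENNReal.ofReal r ^ d * θ (Metric.closedBall 1 1) := by
    intro r hr
    have := hdil r hr (Metric.closedBall 1 1)
    rwa [hdilball r hr, hτ, hemb.map_apply, hemb.map_apply, hpre, hpre] at this
  have hfinite : IsFiniteMeasureOnCompacts τ := by
    refine ⟨fun K hK => ?_⟩
    rw [hτ, hemb.map_apply]
    exact (hWcl.isClosedEmbedding_subtypeVal.isCompact_preimage hK).measure_lt_top
  have hpos : θ (Metric.closedBall 1 1) ≠ 0 := (Metric.measure_closedBall_pos θ 1 one_pos).ne'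
  have hfin : θ (Metric.closedBall 1 1) ≠ ∞ := by
    have := (isCompact_closedBall (1 : G) 1).measure_ne_top (μ := τ)
    rwa [hτ, hemb.map_apply, hpre] at this
  -- A negative `d` would make the ball of radius 2 smaller in measure than the unit ball inside it.
  have hd0 : 0 ≤ d := by
    by_contra! hneg
    have h1 : θ (Metric.closedBall 1 1) ≤ θ (Metric.closedBall 1 2) :=
      measure_mono (Metric.closedBall_subset_closedBall one_le_two)
    rw [hball 2 two_pos] at h1
    have h2 : ENNReal.ofReal 2 ^ d < 1 := by
      refine ENNReal.rpow_lt_one_of_one_lt_of_neg ?_ hneg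
      rw [← ENNReal.ofReal_one, ENNReal.ofReal_lt_ofReal_iff two_pos]
      exact one_lt_two
    exact h1.not_gt ((ENNReal.mul_lt_mul_iff_left hpos hfin).2 h2 |>.trans_eq (one_mul _))
  refine ⟨τ, hfinite, hd0, ?_, ?_, hdil, ?_⟩
  · intro w hw E
    refine measure_image_homeomorph (Homeomorph.mulLeft w) ?_ E
    change τ.map (fun x => w * x) = τ
    rw [hτ, Measure.map_map (measurable_const_mul w) hemb.measurable]
    have : (fun x => w * x) ∘ (Subtype.val : W → G) =
        Subtype.val ∘ fun x : W => (⟨w, hw⟩ : W) * x := rfl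
    rw [this, ← Measure.map_map hemb.measurable (measurable_const_mul _), map_mul_left_eq_self]
  · intro g E
    let f : G ≃ₜ G := (Homeomorph.mulLeft g).trans (Homeomorph.mulRight g⁻¹)
    have hf : Continuous fun x : G => g * x * g⁻¹ := f.continuous
    refine measure_image_homeomorph f ?_ E
    change τ.map (fun x => g * x * g⁻¹) = τ
    rw [hτ, Measure.map_map hf.measurable hemb.measurable]
    have : (fun x => g * x * g⁻¹) ∘ (Subtype.val : W → G) =
        Subtype.val ∘ (MulAut.conjNormal g : W ≃* W) := rfl
    have hc : Measurable (MulAut.conjNormal g : W ≃* W) :=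
      (Continuous.subtype_mk (hf.comp continuous_subtype_val) _).measurable
    rw [this, ← Measure.map_map hemb.measurable hc, map_conjNormal_eq hW hWcl hd0 hH hball g]
  · rw [hτ, hemb.map_apply]
    intro h0
    exact hpos (measure_mono_null (fun x _ => x.2) h0)

end Haar

/-! ### The area factor -/

section AreaDensity

variable {G : Type u} [CarnotGroup G]

theorem Complementary.fst_eq_fst_iff {W V : Subgroup G} (h : Complementary W V) {x y : G} :
    h.fst x = h.fst y ↔ x⁻¹ * y ∈ V := by
  constructor
  · intro hxy
    have := V.mul_mem (V.inv_mem (h.inv_fst_mul_mem x)) (h.inv_fst_mul_mem y)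
    rwa [hxy, mul_inv_rev, inv_inv, mul_assoc, mul_inv_cancel_left] at this
  · intro hxy
    rw [← h.fst_mul_right x hxy, mul_inv_cancel_left]

theorem Complementary.injOn_fst {W V P : Subgroup G} (h : Complementary W V)
    (hP : Complementary P V) : InjOn h.fst P := fun _ hx _ hy hxy =>
  hP.eq_of_inv_mul_mem hx hy (h.fst_eq_fst_iff.1 hxy)

theorem Complementary.fst_fst {W V P : Subgroup G} (h : Complementary W V)
    (hP : Complementary P V) (g : G) : h.fst (hP.fst g) = h.fst g :=
  h.fst_eq_fst_iff.2 (hP.inv_fst_mul_mem g)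

theorem dist_mul_left (g x y : G) : dist (g * x) (g * y) = dist x y :=
  CarnotGroup.dist_mul_left' g x y

theorem mem_closedBall_one {x : G} {r : ℝ} : x ∈ Metric.closedBall 1 r ↔ gnorm x ≤ r := by
  rw [Metric.mem_closedBall, dist_comm, gnorm]

theorem Adm.mul_left {k : MeasureKind} {E : Set G} {s : ℝ} (h : Adm k E s) (g : G) :
    Adm k ((fun x => g * x) '' E) s := by
  simpa using h.image zero_le_one (f := fun x => g * x) fun x y => by rw [dist_mul_left, one_mul]

theorem Adm.dil {k : MeasureKind} {E : Set G} {s t : ℝ} (h : Adm k E s) (ht : 0 < t) :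
    Adm k ((dil t : G → G) '' E) (t * s) :=
  h.image ht.le fun x y => dist_dil ht x y

variable {W V : Subgroup G}

namespace IsSplitting

variable (hWV : IsSplitting W V)

/-- The projection onto `W` along `V`. -/
noncomputable abbrev proj : G → G := hWV.complementary.fst

theorem continuous_proj : Continuous hWV.proj :=
  hWV.complementary.continuous_fst hWV.homogeneous_left hWV.homogeneous_right

theorem left_mem_complements (hWV : IsSplitting W V) : W ∈ complements V :=
  ⟨hWV.homogeneous_left, hWV.complementary⟩

theorem proj_mul (g x : G) : hWV.proj (g * x) = hWV.proj g *
    (((hWV.proj g)⁻¹ * g) * hWV.proj x * ((hWV.proj g)⁻¹ * g)⁻¹) :=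
  hWV.complementary.fst_mul_left hWV.normal g x

theorem proj_dil {t : ℝ} (ht : 0 < t) (x : G) : hWV.proj (dil t x) = dil t (hWV.proj x) :=
  hWV.complementary.fst_dil hWV.homogeneous_left hWV.homogeneous_right ht x

section Graph

variable {P : Subgroup G} {φ : W → V}

theorem map_eq_of_isHomogeneousGraph (h : IsHomogeneousGraph P φ) {p : G} (hp : p ∈ P) :
    ∃ w : W, (w : G) = hWV.proj p ∧ p = w * φ w := by
  have : p ∈ range fun w : W => (w : G) * (φ w : G) := h.2 ▸ hp
  obtain ⟨w, rfl⟩ := this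
  exact ⟨w, (hWV.complementary.fst_eq w.2 (by simp)).symm, rfl⟩

theorem mul_mem_of_isHomogeneousGraph (h : IsHomogeneousGraph P φ) (w : W) :
    (w : G) * φ w ∈ P := by
  have : (w : G) * φ w ∈ (P : Set G) := h.2 ▸ mem_range_self w
  exact this

theorem mem_complements_of_isHomogeneousGraph (hWV : IsSplitting W V) (h : IsHomogeneousGraph P φ) :
    P ∈ complements V := by
  refine ⟨h.1, fun g => ?_, ?_⟩
  · obtain ⟨w, hw, v, hv, rfl⟩ := hWV.complementary.1 g
    exact ⟨w * φ ⟨w, hw⟩, mul_mem_of_isHomogeneousGraph h ⟨w, hw⟩, (φ ⟨w, hw⟩ : G)⁻¹ * v,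
      V.mul_mem (V.inv_mem (φ _).2) hv, by group⟩
  · have key : ∀ x ∈ P, x ∈ V → ∃ y : V, x = φ 1 := by
      intro x hx hxV
      obtain ⟨w, hw, rfl⟩ := hWV.map_eq_of_isHomogeneousGraph h hx
      rw [proj, hWV.complementary.fst_of_mem_right hxV] at hw
      have : w = 1 := Subtype.ext hw
      subst this
      exact ⟨1, by simp⟩
    obtain ⟨_, h1⟩ := key 1 P.one_mem V.one_mem
    refine (Subgroup.eq_bot_iff_forall _).2 fun x hx => ?_
    obtain ⟨_, h2⟩ := key x hx.1 hx.2
    rw [h2, ← h1]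

theorem graph_eq_fst (h : IsHomogeneousGraph P φ) (w : W) :
    (w : G) * φ w = (hWV.mem_complements_of_isHomogeneousGraph h).2.fst w :=
  ((hWV.mem_complements_of_isHomogeneousGraph h).2.fst_eq
    (mul_mem_of_isHomogeneousGraph h w) (by simp)).symm

end Graph

variable [MeasurableSpace G] {d : ℝ} {τ : Measure G}

/-- By `proj_mul`, translation by `g` acts on projections as a conjugation followed by a translation
in `W`, both of which preserve `τ`. -/
theorem measure_proj_image_mul (hτ : IsHomogeneousHaar W d τ) (g : G) (E : Set G) :
    τ (hWV.proj '' ((fun x => g * x) '' E)) = τ (hWV.proj '' E) := by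
  have h : hWV.proj '' ((fun x => g * x) '' E) = (fun x => hWV.proj g * x) ''
      ((fun x => ((hWV.proj g)⁻¹ * g) * x * ((hWV.proj g)⁻¹ * g)⁻¹) '' (hWV.proj '' E)) := by
    simp only [image_image, hWV.proj_mul g]
  rw [h, hτ.mul_left _ (hWV.complementary.fst_mem g), hτ.conj]

theorem measure_proj_image_dil (hτ : IsHomogeneousHaar W d τ) {t : ℝ} (ht : 0 < t) (E : Set G) :
    τ (hWV.proj '' ((dil t : G → G) '' E)) = ENNReal.ofReal t ^ d * τ (hWV.proj '' E) := by
  rw [← hτ.dil t ht, image_image, image_image]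
  simp only [hWV.proj_dil ht]

/-- The constant that relates the Haar measure of `P` that corresponds to `τ` and `ψ^d ⌞ P`. -/
noncomputable def areaDensity (τ : Measure G) (k : MeasureKind) (P : Subgroup G) : ℝ≥0∞ :=
  ⨆ (E : Set G) (_ : 1 ∈ E ∧ Adm k E 1), τ (hWV.proj '' (E ∩ P))

variable {k : MeasureKind} {P : Subgroup G}

theorem measure_le_areaDensity_mul (hτ : IsHomogeneousHaar W d τ) (hP : P ∈ complements V)
    {E : Set G} {s : ℝ} (h1 : 1 ∈ E) (hs : 0 < s) (hE : Adm k E s) :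
    τ (hWV.proj '' (E ∩ P)) ≤ hWV.areaDensity τ k P * ENNReal.ofReal s ^ d := by
  have hE' : Adm k ((dil s⁻¹ : G → G) '' E) 1 := by
    have := hE.dil (inv_pos.2 hs)
    rwa [inv_mul_cancel₀ hs.ne'] at this
  have h : (dil s : G → G) '' ((dil s⁻¹ : G → G) '' E ∩ P) = E ∩ P := by
    ext x
    constructor
    · rintro ⟨_, ⟨⟨y, hy, rfl⟩, hyP⟩, rfl⟩
      have := hP.1.dil_mem hs hyP
      rw [dil_dil, mul_inv_cancel₀ hs.ne', dil_one_left] at this ⊢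
      exact ⟨hy, this⟩
    · rintro ⟨hx, hxP⟩
      exact ⟨dil s⁻¹ x, ⟨⟨x, hx, rfl⟩, hP.1.dil_mem (inv_pos.2 hs) hxP⟩, by
        rw [dil_dil, mul_inv_cancel₀ hs.ne', dil_one_left]⟩
  rw [← h, hWV.measure_proj_image_dil hτ hs, mul_comm]
  gcongr
  exact le_iSup₂_of_le (f := fun (E : Set G) (_ : 1 ∈ E ∧ Adm k E 1) => τ (hWV.proj '' (E ∩ P)))
    ((dil s⁻¹ : G → G) '' E) ⟨⟨1, h1, dil_one_right _⟩, hE'⟩ le_rfl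

theorem exists_lt_of_lt_areaDensity {t : ℝ≥0∞} (ht : t < hWV.areaDensity τ k P) :
    ∃ E : Set G, 1 ∈ E ∧ Adm k E 1 ∧ t < τ (hWV.proj '' (E ∩ P)) := by
  simp only [areaDensity, lt_iSup_iff] at ht
  obtain ⟨E, hE, h⟩ := ht
  exact ⟨E, hE.1, hE.2, h⟩

theorem areaDensity_ne_top (hτ : IsHomogeneousHaar W d τ) : hWV.areaDensity τ k P ≠ ∞ := by
  have := hτ.finite
  refine ne_top_of_le_ne_top (IsCompact.measure_ne_top (μ := τ)
    ((isCompact_closedBall (1 : G) 1).image hWV.continuous_proj)) (iSup₂_le fun E hE => measure_mono ?_)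
  exact image_mono fun x hx => hE.2.dist_le hx.1 hE.1

/-- If the density vanished, every ball intersected with `P` would have a null projection by
scaling; countably many of these projections cover `W`. -/
theorem areaDensity_ne_zero (hτ : IsHomogeneousHaar W d τ) (hP : P ∈ complements V) :
    hWV.areaDensity τ k P ≠ 0 := by
  intro h0
  refine hτ.ne_zero (measure_mono_null (t := ⋃ n : ℕ, hWV.proj ''
    (Metric.closedBall 1 ((n : ℝ) + 1) ∩ P)) ?_ (measure_iUnion_null fun n => ?_))
  · intro w hw
    obtain ⟨n, hn⟩ := exists_nat_ge (gnorm (hP.2.fst w))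
    refine mem_iUnion.2 ⟨n, hP.2.fst w, ⟨mem_closedBall_one.2 (by linarith), hP.2.fst_mem w⟩, ?_⟩
    rw [proj, Complementary.fst_fst, Complementary.fst_of_mem _ hw]
  · have hn : (0 : ℝ) < (n : ℝ) + 1 := by positivity
    have := hWV.measure_le_areaDensity_mul hτ hP (Metric.mem_closedBall_self hn.le)
      (by positivity) (Adm.closedBall k (1 : G) ((n : ℝ) + 1))
    rwa [h0, zero_mul, nonpos_iff_eq_zero] at this

/-- The area factor of a splitting. -/
noncomputable def areaFactor (τ : Measure G) (k : MeasureKind) (P : Subgroup G) : ℝ≥0 :=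
  (hWV.areaDensity τ k W / hWV.areaDensity τ k P).toNNReal

theorem coe_areaFactor (hτ : IsHomogeneousHaar W d τ) (hP : P ∈ complements V) :
    (hWV.areaFactor τ k P : ℝ≥0∞) = hWV.areaDensity τ k W / hWV.areaDensity τ k P :=
  ENNReal.coe_toNNReal (ENNReal.div_ne_top (hWV.areaDensity_ne_top hτ)
    (hWV.areaDensity_ne_zero hτ hP))

theorem areaFactor_pos (hτ : IsHomogeneousHaar W d τ) (hP : P ∈ complements V) :
    0 < hWV.areaFactor τ k P := by
  rw [← ENNReal.coe_pos, hWV.coe_areaFactor hτ hP]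
  exact ENNReal.div_pos (hWV.areaDensity_ne_zero hτ hWV.left_mem_complements)
    (hWV.areaDensity_ne_top hτ)

/-- A competitor for `P` lies in the unit ball, where `w * φ w` can be moved to `w * φ' w` without
changing its projection. Its `δ`-thickening, of size `1 + 2 * δ`, then competes for `P'`. -/
theorem areaDensity_le_of_dist_lt (hτ : IsHomogeneousHaar W d τ) {P' : Subgroup G} {φ φ' : W → V}
    (h : IsHomogeneousGraph P φ) (h' : IsHomogeneousGraph P' φ') {δ : ℝ} (hδ : 0 < δ)
    (hφ : ∀ w : W, (∃ v ∈ V, (w : G) * v ∈ Metric.closedBall (0 : G) 1) →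
        dist (φ w : G) (φ' w : G) < δ) :
    hWV.areaDensity τ k P ≤ hWV.areaDensity τ k P' * ENNReal.ofReal (1 + 2 * δ) ^ d := by
  refine iSup₂_le fun E hE => ?_
  refine le_trans (measure_mono ?_) (hWV.measure_le_areaDensity_mul hτ
    (hWV.mem_complements_of_isHomogeneousGraph h') (E := {y | ∃ x ∈ E, dist y x ≤ δ})
    ⟨1, hE.1, by rw [dist_self]; exact hδ.le⟩ (by positivity) (hE.2.thicken δ))
  rintro _ ⟨p, ⟨hpE, hp⟩, rfl⟩
  obtain ⟨w, hw, rfl⟩ := hWV.map_eq_of_isHomogeneousGraph h hp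
  refine ⟨w * φ' w, ⟨⟨_, hpE, ?_⟩, mul_mem_of_isHomogeneousGraph h' w⟩, ?_⟩
  · rw [dist_mul_left, dist_comm]
    refine (hφ w ⟨_, (φ w).2, ?_⟩).le
    rw [← one_eq_zero]
    exact hE.2.dist_le hpE hE.1
  · rw [← hw]
    exact hWV.complementary.fst_eq w.2 (by simp)

theorem isContinuousOnGraphs (hτ : IsHomogeneousHaar W d τ) :
    IsContinuousOnGraphs W V (hWV.areaFactor τ k) := by
  intro P φ h ε hε
  have hP := hWV.mem_complements_of_isHomogeneousGraph h
  set a : ℝ := ((hWV.areaFactor τ k P : ℝ≥0) : ℝ) with ha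
  have ha0 : 0 < a := hWV.areaFactor_pos hτ hP
  -- Both area factors will lie between `a * (1 + 2 * δ) ^ (-d)` and `a * (1 + 2 * δ) ^ d`, so the
  -- length of this interval must be made less than `ε`.
  have hlim : Tendsto (fun δ : ℝ => a * ((1 + 2 * δ) ^ d - (1 + 2 * δ) ^ (-d))) (𝓝[>] 0) (𝓝 0) := by
    have hc : ContinuousAt (fun δ : ℝ => a * ((1 + 2 * δ) ^ d - (1 + 2 * δ) ^ (-d))) 0 := by
      have h1 : ContinuousAt (fun δ : ℝ => 1 + 2 * δ) 0 := by fun_prop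
      exact continuousAt_const.mul ((h1.rpow_const (Or.inl (by norm_num))).sub
        (h1.rpow_const (Or.inl (by norm_num))))
    have := hc.tendsto
    simp only [mul_zero, add_zero, Real.one_rpow, sub_self] at this
    exact this.mono_left nhdsWithin_le_nhds
  obtain ⟨δ, hδε, hδ⟩ := ((hlim.eventually (gt_mem_nhds hε)).and self_mem_nhdsWithin).exists
  refine ⟨δ, hδ, fun P' φ' h' hφ => ?_⟩
  have hP' := hWV.mem_complements_of_isHomogeneousGraph h'
  have hδ' : (0 : ℝ) < 1 + 2 * δ := by have : 0 < δ := hδ; positivity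
  have h1 := hWV.areaDensity_le_of_dist_lt (k := k) hτ h h' hδ hφ
  have key : ∀ w : W, (∃ v ∈ V, (w : G) * v ∈ Metric.closedBall (0 : G) 1) →
      dist (φ' w : G) (φ w : G) < δ := fun w hw => by rw [dist_comm]; exact hφ w hw
  have h2 := hWV.areaDensity_le_of_dist_lt (k := k) hτ h' h hδ key
  set c : ℝ := (1 + 2 * δ) ^ d with hc
  have hc0 : 0 < c := Real.rpow_pos_of_pos hδ' d
  have hac : ∀ Q : Subgroup G, Q ∈ complements V → (hWV.areaFactor τ k Q : ℝ) =
      (hWV.areaDensity τ k W).toReal / (hWV.areaDensity τ k Q).toReal := by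
    intro Q hQ
    rw [← ENNReal.toReal_div, ← hWV.coe_areaFactor hτ hQ]
    rfl
  rw [ENNReal.ofReal_rpow_of_pos hδ', ← hc] at h1 h2
  have r1 := ENNReal.toReal_mono (ENNReal.mul_ne_top (hWV.areaDensity_ne_top hτ)
    ENNReal.ofReal_ne_top) h1
  have r2 := ENNReal.toReal_mono (ENNReal.mul_ne_top (hWV.areaDensity_ne_top hτ)
    ENNReal.ofReal_ne_top) h2
  rw [ENNReal.toReal_mul, ENNReal.toReal_ofReal hc0.le] at r1 r2
  have p0 : ∀ Q : Subgroup G, Q ∈ complements V → 0 < (hWV.areaDensity τ k Q).toReal := fun Q hQ =>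
    ENNReal.toReal_pos (hWV.areaDensity_ne_zero hτ hQ) (hWV.areaDensity_ne_top hτ)
  have pW := p0 W hWV.left_mem_complements
  have b1 : (hWV.areaFactor τ k P' : ℝ) ≤ a * c := by
    rw [ha, hac P hP, hac P' hP', div_mul_eq_mul_div, div_le_div_iff₀ (p0 _ hP') (p0 _ hP)]
    calc _ ≤ (hWV.areaDensity τ k W).toReal * ((hWV.areaDensity τ k P').toReal * c) := by gcongr
      _ = _ := by ring
  have b2 : a * c⁻¹ ≤ (hWV.areaFactor τ k P' : ℝ) := by
    rw [ha, hac P hP, hac P' hP', ← div_eq_mul_inv, div_div,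
      div_le_div_iff₀ (mul_pos (p0 _ hP) hc0) (p0 _ hP')]
    gcongr
  have hδε' : a * (c - c⁻¹) < ε := by
    rwa [Real.rpow_neg hδ'.le] at hδε
  rw [NNReal.dist_eq, abs_lt, ← ha]
  have hc1 : 1 ≤ c := Real.one_le_rpow (by have : 0 < δ := hδ; linarith) hτ.nonneg
  have hci : c⁻¹ ≤ 1 := inv_le_one_of_one_le₀ hc1
  constructor <;> nlinarith

variable [BorelSpace G]

/-- The measure that `τ` induces on a graph over `W`. -/
theorem exists_graph_measure (hτ : IsHomogeneousHaar W d τ) {S : Set G} (hS : MeasurableSet S)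
    (hinj : InjOn hWV.proj S) : ∃ μ : Measure G, IsFiniteMeasureOnCompacts μ ∧
      ∀ E, μ E = τ (hWV.proj '' (E ∩ S)) := by
  -- Lusin–Souslin: an injective continuous image of a Borel set is Borel, so `τ` can be pulled back
  -- to `S`.
  have hemb := hWV.continuous_proj.continuousOn.measurableEmbedding hS hinj
  have hval := MeasurableEmbedding.subtype_coe hS
  have happ : ∀ E, ((τ.comap (S.domRestrict hWV.proj)).map (Subtype.val : S → G)) E =
      τ (hWV.proj '' (E ∩ S)) := by
    intro E
    rw [hval.map_apply, hemb.comap_apply]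
    congr 1
    ext x
    simp only [mem_image, Subtype.exists, mem_preimage, Set.domRestrict_apply, mem_inter_iff]
    constructor
    · rintro ⟨a, ha, haE, rfl⟩
      exact ⟨a, ⟨haE, ha⟩, rfl⟩
    · rintro ⟨a, ⟨haE, ha⟩, rfl⟩
      exact ⟨a, ha, haE, rfl⟩
  refine ⟨_, ⟨fun K hK => ?_⟩, happ⟩
  have := hτ.finite
  rw [happ]
  exact (measure_mono (image_mono inter_subset_left)).trans_lt
    (hK.image hWV.continuous_proj).measure_lt_top

/-- On a homogeneous subgroup `P` that is complementary to `V`, the measure induced by `τ` is a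
multiple of `ψ^d`. -/
theorem measure_proj_image_eq (hτ : IsHomogeneousHaar W d τ) (hP : P ∈ complements V) {B : Set G}
    (hB : MeasurableSet B) (hBP : B ⊆ P) :
    τ (hWV.proj '' B) = hWV.areaDensity τ k P * psi k d B := by
  obtain ⟨μ, hμfin, hμ⟩ := hWV.exists_graph_measure hτ hP.1.isClosed.measurableSet
    (hWV.complementary.injOn_fst hP.2)
  have hmul : ∀ p ∈ P, ∀ E, μ ((fun x => p * x) '' E) = μ E := by
    intro p hp E
    rw [hμ, hμ, ← hWV.measure_proj_image_mul hτ p (E ∩ P)]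
    congr 2
    ext x
    constructor
    · rintro ⟨⟨y, hy, rfl⟩, hx⟩
      exact ⟨y, ⟨hy, (P.mul_mem_cancel_left hp).1 hx⟩, rfl⟩
    · rintro ⟨y, ⟨hy, hyP⟩, rfl⟩
      exact ⟨⟨y, hy, rfl⟩, P.mul_mem hp hyP⟩
  have hmain := measure_eq_setLIntegral_of_forall_le (μ := μ) (ν := psi k d)
    (g := fun _ => hWV.areaDensity τ k P) measurable_const (S := P)
    (fun _ _ => hWV.areaDensity_ne_zero hτ hP) (fun _ _ => hWV.areaDensity_ne_top hτ)
    (fun B hBP t ht hlt => ?_) (fun B hBP t ht hlt => ?_) hB hBP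
  · rw [setLIntegral_const, hμ, inter_eq_left.2 hBP] at hmain
    exact hmain
  · refine measure_le_mul_psi hτ.nonneg ht fun p hp => ⟨1, one_pos, fun E s hpE hs _ hE => ?_⟩
    rw [← hmul p⁻¹ (P.inv_mem (hBP hp)) E, hμ]
    refine (hWV.measure_le_areaDensity_mul hτ hP (E := (fun x => p⁻¹ * x) '' E)
      ⟨p, hpE, inv_mul_cancel p⟩ hs
      (hE.mul_left p⁻¹)).trans ?_
    gcongr
    exact (hlt p hp).le
  -- A competitor for the supremum at the identity, dilated to size `δ` and translated to `p`,
  -- realizes the density at every scale.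
  · refine mul_psi_le_measure hτ.nonneg ht fun p hp δ hδ => ?_
    obtain ⟨E, h1E, hE, hlt'⟩ := hWV.exists_lt_of_lt_areaDensity (hlt p hp)
    refine ⟨closure ((fun x => p * x) '' ((dil δ : G → G) '' E)), δ, isClosed_closure,
      subset_closure ⟨1, ⟨1, h1E, dil_one_right _⟩, mul_one p⟩, hδ, le_rfl, ?_, ?_⟩
    · have := ((hE.dil hδ).mul_left p).closure
      rwa [mul_one] at this
    · refine le_trans ?_ (measure_mono subset_closure)
      rw [hmul p (hBP hp), hμ]
      have h : (dil δ : G → G) '' (E ∩ P) ⊆ (dil δ : G → G) '' E ∩ P := by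
        rintro _ ⟨x, ⟨hx, hxP⟩, rfl⟩
        exact ⟨⟨x, hx, rfl⟩, hP.1.dil_mem hδ hxP⟩
      refine le_trans ?_ (measure_mono (image_mono h))
      rw [hWV.measure_proj_image_dil hτ hδ, mul_comm]
      gcongr

/-! ### Homogeneous subgroups that are graphs -/

section Graph

variable {φ : W → V}

theorem isAreaFactor (hτ : IsHomogeneousHaar W d τ) :
    IsAreaFactor k d W V (hWV.areaFactor τ k) := by
  intro P φ h
  have hP := hWV.mem_complements_of_isHomogeneousGraph h
  refine ⟨hWV.areaFactor_pos hτ hP, ?_⟩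
  have hWm : MeasurableSet (W : Set G) := hWV.homogeneous_left.isClosed.measurableSet
  have hPm : MeasurableSet (P : Set G) := hP.1.isClosed.measurableSet
  have hval : MeasurableEmbedding (Subtype.val : W → G) := MeasurableEmbedding.subtype_coe hWm
  have hΦ : Measurable fun w : W => (w : G) * (φ w : G) := by
    simp only [hWV.graph_eq_fst h]
    exact ((hP.2.continuous_fst hP.1 hWV.homogeneous_right).comp continuous_subtype_val).measurable
  ext E hE
  rw [Measure.restrict_apply hE, Measure.smul_apply, smul_eq_mul, Measure.map_apply hΦ hE,
    hval.comap_apply]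
  set Y : Set G := Subtype.val '' ((fun w : W => (w : G) * (φ w : G)) ⁻¹' E) with hY
  have hYW : Y ⊆ W := by
    rintro _ ⟨w, _, rfl⟩
    exact w.2
  have hYm : MeasurableSet Y := hval.measurableSet_image.2 (hΦ hE)
  have hYE : hWV.proj '' (E ∩ P) = Y := by
    ext x
    constructor
    · rintro ⟨p, ⟨hpE, hp⟩, rfl⟩
      obtain ⟨w, hw, hpw⟩ := hWV.map_eq_of_isHomogeneousGraph h hp
      exact ⟨w, by rwa [mem_preimage, ← hpw], hw⟩
    · rintro ⟨w, hw, rfl⟩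
      exact ⟨_, ⟨hw, mul_mem_of_isHomogeneousGraph h w⟩, hWV.complementary.fst_eq w.2 (by simp)⟩
  have hYY : hWV.proj '' Y = Y := by
    ext x
    constructor
    · rintro ⟨y, hy, rfl⟩
      rwa [proj, hWV.complementary.fst_of_mem (hYW hy)]
    · intro hx
      exact ⟨x, hx, hWV.complementary.fst_of_mem (hYW hx)⟩
  -- The same set `Y` is measured twice, as the projection of `E ∩ P` and as a subset of `W`;
  -- eliminating `τ Y` gives the ratio of the densities.
  have e1 := hWV.measure_proj_image_eq (k := k) hτ hP (hE.inter hPm) inter_subset_right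
  have e2 := hWV.measure_proj_image_eq (k := k) hτ hWV.left_mem_complements hYm hYW
  rw [hYE] at e1
  rw [hYY, e1] at e2
  have e3 : psi k d (E ∩ P) = hWV.areaDensity τ k W * psi k d Y / hWV.areaDensity τ k P :=
    (ENNReal.eq_div_iff (hWV.areaDensity_ne_zero hτ hP) (hWV.areaDensity_ne_top hτ)).2 e2
  rw [hWV.coe_areaFactor hτ hP, e3, ENNReal.div_eq_inv_mul, ENNReal.div_eq_inv_mul, mul_assoc]

end Graph

end IsSplitting

end AreaDensity

/-! ### Tangent subgroups -/

section Tangent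

variable {G : Type u} [CarnotGroup G]

/-- Near `p`, the set `S` is close to the translate `p T` of a complement `T` of `V`. -/
def HasTangent (V : Subgroup G) (S : Set G) (p : G) (T : Subgroup G) : Prop :=
  ∃ hT : T ∈ complements V, ∀ ε > 0, ∃ r > 0, ∀ q ∈ S, dist p q < r →
    dist (p⁻¹ * q) (hT.2.fst (p⁻¹ * q)) ≤ ε * gnorm (p⁻¹ * q)

theorem HasTangent.mono {V : Subgroup G} {S S' : Set G} {p : G} {T : Subgroup G}
    (h : HasTangent V S p T) (hS : S' ⊆ S) : HasTangent V S' p T := by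
  obtain ⟨hT, h⟩ := h
  refine ⟨hT, fun ε hε => ?_⟩
  obtain ⟨r, hr, h⟩ := h ε hε
  exact ⟨r, hr, fun q hq => h q (hS hq)⟩

theorem HomogeneousHom.continuous {H : Type v} [CarnotGroup H] (L : HomogeneousHom G H) :
    Continuous L.toLieHom :=
  continuous_of_linear L.toLieHom.toLinearMap

/-- On the compact set of unit vectors at distance at least `ε` from their `T`-component, `L` never
vanishes, so its norm has a positive minimum; homogeneity does the rest. -/
theorem exists_dist_fst_le {H : Type v} [CarnotGroup H] {L : HomogeneousHom G H} {T V : Subgroup G}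
    (hT : T ∈ complements V) (hV : IsHomogeneous V) (hL : (T : Set G) = {x | L.toLieHom x = 0})
    {ε : ℝ} (hε : 0 < ε) :
    ∃ η > 0, ∀ x : G, gnorm (L.toLieHom x) < η * gnorm x → dist x (hT.2.fst x) ≤ ε * gnorm x := by
  have hfst := hT.2.continuous_fst hT.1 hV
  obtain ⟨η, hη, h⟩ : ∃ η > 0, ∀ x : G, gnorm x = 1 → gnorm (L.toLieHom x) < η →
      dist x (hT.2.fst x) < ε := by
    have hK : IsCompact (Metric.sphere (1 : G) 1 ∩ {x | ε ≤ dist x (hT.2.fst x)}) :=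
      (isCompact_sphere _ _).inter_right (isClosed_le continuous_const (continuous_id.dist hfst))
    rcases (Metric.sphere (1 : G) 1 ∩ {x | ε ≤ dist x (hT.2.fst x)}).eq_empty_or_nonempty with h0 | h0
    · refine ⟨1, one_pos, fun x hx _ => ?_⟩
      by_contra! h
      have : x ∈ Metric.sphere (1 : G) 1 ∩ {x | ε ≤ dist x (hT.2.fst x)} :=
        ⟨by rwa [Metric.mem_sphere, dist_comm], h⟩
      rw [h0] at this
      exact this
    · obtain ⟨z, hz, hmin⟩ := hK.exists_isMinOn h0 (continuous_gnorm.comp L.continuous).continuousOn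
      refine ⟨gnorm (L.toLieHom z), ?_, fun x hx hlt => ?_⟩
      · refine lt_of_le_of_ne (gnorm_nonneg _) fun h => ?_
        rw [eq_comm, gnorm_eq_zero, one_eq_zero] at h
        have hzT : z ∈ (T : Set G) := by rw [hL]; exact h
        have := hz.2
        rw [mem_ofPred_eq, hT.2.fst_of_mem hzT, dist_self] at this
        exact this.not_gt hε
      · by_contra! h
        exact hlt.not_ge (hmin ⟨by rwa [Metric.mem_sphere, dist_comm], h⟩)
  refine ⟨η, hη, fun x hx => ?_⟩
  have hpos : 0 < gnorm x := by
    refine lt_of_le_of_ne (gnorm_nonneg x) fun h0 => ?_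
    rw [← h0, mul_zero] at hx
    exact hx.not_ge (gnorm_nonneg _)
  have hi := inv_pos.2 hpos
  have h1 := h (dil (gnorm x)⁻¹ x) (by rw [gnorm_dil hi, inv_mul_cancel₀ hpos.ne'])
    (by rwa [L.map_dil, gnorm_dil hi, inv_mul_lt_iff₀ hpos, mul_comm])
  rw [hT.2.fst_dil hT.1 hV hi, dist_dil hi, inv_mul_lt_iff₀ hpos, mul_comm] at h1
  exact h1.le

/-- The defining map vanishes at `p` and `q`, so Pansu differentiability makes `L (p⁻¹ * q)` small
compared with `gnorm (p⁻¹ * q)`. -/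
theorem IsLevelSetNear.hasTangent {H : Type v} [CarnotGroup H] {S : Set G} {p : G}
    {T V : Subgroup G} (h : IsLevelSetNear H S p T) (hp : p ∈ S) (hT : T ∈ complements V)
    (hV : IsHomogeneous V) : HasTangent V S p T := by
  obtain ⟨Ω, f, hΩ, hpΩ, -, ⟨L, hL, -, hker, -⟩, hS⟩ := h
  have hzero : ∀ q ∈ S, q ∈ Ω → f q = 1 := by
    intro q hq hqΩ
    have : q ∈ {x ∈ Ω | f x = 0} := hS ▸ ⟨hq, hqΩ⟩
    rw [this.2, one_eq_zero]
  refine ⟨hT, fun ε hε => ?_⟩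
  obtain ⟨η, hη, hLη⟩ := exists_dist_fst_le hT hV hker hε
  have hev : ∀ᶠ q in 𝓝[≠] p,
      dist ((f p)⁻¹ * f q) (L.toLieHom (p⁻¹ * q)) / dist p q < η ∧ q ∈ Ω :=
    (hL.eventually (gt_mem_nhds hη)).and (mem_nhdsWithin_of_mem_nhds (hΩ.mem_nhds hpΩ))
  rw [eventually_nhdsWithin_iff] at hev
  obtain ⟨r, hr, hball⟩ := Metric.eventually_nhds_iff.1 hev
  refine ⟨r, hr, fun q hq hpq => ?_⟩
  rcases eq_or_ne q p with rfl | hne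
  · rw [inv_mul_cancel, hT.2.fst_one, dist_self, gnorm_one, mul_zero]
  obtain ⟨h1, h2⟩ := hball (by rwa [dist_comm]) hne
  have hpos : 0 < dist p q := dist_pos.2 hne.symm
  rw [hzero p hp hpΩ, hzero q hq h2, inv_one, mul_one, div_lt_iff₀ hpos, dist_eq_gnorm p q] at h1
  exact hLη _ h1

theorem HasPansuDifferentialAt.continuousAt {H : Type v} [CarnotGroup H] {f : G → H}
    {L : HomogeneousHom G H} {p : G} (h : HasPansuDifferentialAt f L p) : ContinuousAt f p := by
  rw [← continuousWithinAt_compl_self]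
  refine tendsto_iff_dist_tendsto_zero.2 ?_
  have h1 : Tendsto (fun x => dist p x) (𝓝[≠] p) (𝓝 0) := by
    have : Continuous fun x => dist p x := continuous_const.dist continuous_id
    have := this.tendsto p
    rw [dist_self] at this
    exact this.mono_left nhdsWithin_le_nhds
  have h2 : Tendsto (fun x => gnorm (L.toLieHom (p⁻¹ * x))) (𝓝[≠] p) (𝓝 0) := by
    have : Continuous fun x => gnorm (L.toLieHom (p⁻¹ * x)) :=
      continuous_gnorm.comp (L.continuous.comp (continuous_const.mul continuous_id))
    have := this.tendsto p
    rw [inv_mul_cancel, one_eq_zero, map_zero, ← one_eq_zero, gnorm_one] at this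
    exact this.mono_left nhdsWithin_le_nhds
  refine squeeze_zero' (Eventually.of_forall fun x => dist_nonneg) ?_
    (by simpa using (h.mul h1).add h2)
  filter_upwards [self_mem_nhdsWithin] with x hx
  have hpos : dist p x ≠ 0 := dist_ne_zero.2 (Ne.symm hx)
  rw [div_mul_cancel₀ _ hpos, dist_comm, dist_eq_gnorm]
  calc gnorm ((f p)⁻¹ * f x) = dist ((f p)⁻¹ * f x) 1 := by rw [dist_comm]; rfl
    _ ≤ dist ((f p)⁻¹ * f x) (L.toLieHom (p⁻¹ * x)) + dist (L.toLieHom (p⁻¹ * x)) 1 :=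
      dist_triangle _ _ _
    _ = _ := by rw [dist_comm _ (1 : H)]; rfl

theorem IsLevelSetNear.exists_isCompact {H : Type v} [CarnotGroup H] {S : Set G} {p : G}
    {T : Subgroup G} (h : IsLevelSetNear H S p T) :
    ∃ K, IsCompact K ∧ K ⊆ S ∧ K ∈ 𝓝[S] p := by
  obtain ⟨Ω, f, hΩ, hpΩ, ⟨D, hD, -⟩, -, hS⟩ := h
  obtain ⟨r, hr, hball⟩ := Metric.nhds_basis_closedBall.mem_iff.1 (hΩ.mem_nhds hpΩ)
  have hf : ContinuousOn f (Metric.closedBall p r) := fun q hq =>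
    (hD q (hball hq)).continuousAt.continuousWithinAt
  have heq : S ∩ Metric.closedBall p r = Metric.closedBall p r ∩ f ⁻¹' {0} := by
    ext x
    have : x ∈ S ∩ Ω ↔ x ∈ {x ∈ Ω | f x = 0} := by rw [hS]
    constructor
    · rintro ⟨h1, h2⟩
      exact ⟨h2, (this.1 ⟨h1, hball h2⟩).2⟩
    · rintro ⟨h1, h2⟩
      exact ⟨(this.2 ⟨hball h1, h2⟩).1, h1⟩
  refine ⟨S ∩ Metric.closedBall p r, ?_, inter_subset_left,
    inter_mem self_mem_nhdsWithin (mem_nhdsWithin_of_mem_nhds (Metric.closedBall_mem_nhds p hr))⟩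
  rw [heq]
  exact (isCompact_closedBall p r).of_isClosed_subset
    (hf.preimage_isClosed_of_isClosed Metric.isClosed_closedBall isClosed_singleton)
    inter_subset_left

/-- The set is locally a closed level set in a proper space, and countably many of the compact
neighbourhoods suffice by the Lindelöf property. -/
theorem IsC1HSubmanifold.isSigmaCompact {S : Set G} (h : IsC1HSubmanifold S) :
    IsSigmaCompact S := by
  obtain ⟨H, _, hS⟩ := h
  choose! T hT using hS
  choose! K hK hKS hKp using fun p hp => (hT p hp).exists_isCompact
  obtain ⟨t, htS, htc, hcov⟩ := TopologicalSpace.countable_cover_nhdsWithin (f := K) hKp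
  have : S = ⋃ p ∈ t, K p :=
    Subset.antisymm hcov (iUnion₂_subset fun p hp => hKS p (htS hp))
  rw [this]
  exact isSigmaCompact_biUnion htc fun p => fun hp => (hK p (htS hp)).isSigmaCompact

end Tangent

/-! ### Densities of graphs -/

section Density

variable {G : Type u} [CarnotGroup G] {W V : Subgroup G}

namespace IsSplitting

/-- A set with a tangent that is complementary to `V` satisfies a cone condition. -/
theorem exists_cone (hWV : IsSplitting W V) {S : Set G} {p : G} {T : Subgroup G}
    (h : HasTangent V S p T) :
    ∃ n : ℕ, ∀ q ∈ S, dist p q < 1 / ((n : ℝ) + 1) →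
      gnorm (p⁻¹ * q) ≤ n * gnorm (hWV.proj (p⁻¹ * q)) := by
  obtain ⟨hT, h⟩ := h
  obtain ⟨C, hC, hbound⟩ := hT.2.exists_gnorm_fst_le hT.1 hWV.homogeneous_right
  obtain ⟨r, hr, h⟩ := h (1 / 2) (by norm_num)
  obtain ⟨m, hm⟩ := exists_nat_one_div_lt hr
  -- One integer serves both as the aperture of the cone and as the inverse of the radius, so that
  -- points can later be sorted into countably many classes. The factor 2 comes from absorbing
  -- `gnorm x / 2`.
  obtain ⟨n, hn⟩ := exists_nat_ge (max (2 * C) m)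
  refine ⟨n, fun q hq hpq => ?_⟩
  have hmn : (m : ℝ) ≤ n := (le_max_right _ _).trans hn
  have h1 := h q hq (hpq.trans_le ((one_div_le_one_div_of_le (by positivity)
    (by linarith)).trans hm.le))
  set x := p⁻¹ * q
  have h2 : hT.2.fst x = hT.2.fst (hWV.proj x) := (hT.2.fst_fst hWV.complementary x).symm
  have h3 := hbound (hWV.proj x)
  rw [← h2] at h3
  have h4 : gnorm x ≤ gnorm (hT.2.fst x) + dist x (hT.2.fst x) := by
    rw [gnorm, gnorm, dist_comm x]
    exact dist_triangle _ _ _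
  calc gnorm x ≤ 2 * C * gnorm (hWV.proj x) := by linarith
    _ ≤ n * gnorm (hWV.proj x) :=
      mul_le_mul_of_nonneg_right ((le_max_left _ _).trans hn) (gnorm_nonneg _)

/-- On the unit sphere the cone is compact and stays at positive distance from `V`. If `b` and `c`
were tiny relative to `b * u * c`, rescaling to the sphere would place a cone vector too close to
`V`; the tube lemma makes this two-sided perturbation uniform. -/
theorem exists_gnorm_le_of_cone (hWV : IsSplitting W V) (n : ℝ) :
    ∃ C > 0, ∀ (b u c : G) (ρ : ℝ), u ∈ V → gnorm b ≤ ρ → gnorm c ≤ ρ →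
      gnorm (b * u * c) ≤ n * gnorm (hWV.proj (b * u * c)) → gnorm (b * u * c) ≤ C * ρ := by
  have hπ := hWV.continuous_proj
  have hK : IsCompact (Metric.sphere (1 : G) 1 ∩ {x | 1 ≤ n * gnorm (hWV.proj x)}) :=
    (isCompact_sphere _ _).inter_right (isClosed_le continuous_const
      (continuous_const.mul (continuous_gnorm.comp hπ)))
  have hdisj : Disjoint (Metric.sphere (1 : G) 1 ∩ {x | 1 ≤ n * gnorm (hWV.proj x)})
      (V : Set G) := by
    refine Set.disjoint_left.2 fun x hx hxV => ?_
    have := hx.2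
    rw [mem_ofPred_eq, proj, hWV.complementary.fst_of_mem_right hxV, gnorm_one, mul_zero] at this
    exact this.not_gt one_pos
  obtain ⟨r, hr, hrV⟩ := Metric.exists_pos_forall_lt_edist hK
    hWV.homogeneous_right.isClosed hdisj
  have hr' : (0 : ℝ) < r := hr
  have hO : IsOpen {a : (G × G) × G | dist a.2 (a.1.1⁻¹ * a.2 * a.1.2⁻¹) < r} :=
    isOpen_lt (by fun_prop) continuous_const
  obtain ⟨u, v, hu, -, h1u, hv, huv⟩ := generalized_tube_lemma
    (isCompact_singleton (x := ((1 : G), (1 : G))))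
    (isCompact_sphere (1 : G) 1) hO (by
      rintro ⟨a, x⟩ ⟨ha, -⟩
      rw [mem_singleton_iff] at ha
      subst ha
      simpa using hr')
  obtain ⟨ρ₀, hρ₀, hball⟩ := Metric.isOpen_iff.1 hu (1, 1) (h1u rfl)
  have key : ∀ b y c : G, y ∈ V → gnorm b < ρ₀ → gnorm c < ρ₀ → gnorm (b * y * c) = 1 →
      ¬ 1 ≤ n * gnorm (hWV.proj (b * y * c)) := by
    intro b y c hy hb hc h1 hcone
    have hs : b * y * c ∈ Metric.sphere (1 : G) 1 := by rwa [Metric.mem_sphere, dist_comm]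
    have h2 := hrV _ ⟨hs, hcone⟩ y hy
    have h3 : ((b, c), b * y * c) ∈ {a : (G × G) × G | dist a.2 (a.1.1⁻¹ * a.2 * a.1.2⁻¹) < r} := by
      refine huv ⟨hball ?_, hv hs⟩
      rw [Metric.mem_ball, Prod.dist_eq, max_lt_iff, dist_comm _ (1 : G), dist_comm _ (1 : G)]
      exact ⟨hb, hc⟩
    have h4 : b⁻¹ * (b * y * c) * c⁻¹ = y := by group
    rw [mem_ofPred_eq] at h3
    simp only [h4] at h3
    rw [edist_dist, ← ENNReal.ofReal_coe_nnreal] at h2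
    exact h3.not_gt ((ENNReal.ofReal_lt_ofReal_iff_of_nonneg r.coe_nonneg).1 h2)
  refine ⟨2 / ρ₀, by positivity, fun b y c ρ hy hb hc hcone => ?_⟩
  by_contra! hlt
  have hρ : 0 ≤ ρ := (gnorm_nonneg b).trans hb
  set R := gnorm (b * y * c) with hR
  have hRpos : 0 < R := lt_of_le_of_lt (by positivity) hlt
  have hi := inv_pos.2 hRpos
  have hlt' : R⁻¹ * ρ < ρ₀ := by
    rw [inv_mul_lt_iff₀ hRpos]
    rw [div_mul_eq_mul_div, div_lt_iff₀ hρ₀] at hlt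
    linarith
  refine key (dil R⁻¹ b) (dil R⁻¹ y) (dil R⁻¹ c) (hWV.homogeneous_right.dil_mem hi hy) ?_ ?_ ?_ ?_
  · rw [gnorm_dil hi]
    exact (mul_le_mul_of_nonneg_left hb hi.le).trans_lt hlt'
  · rw [gnorm_dil hi]
    exact (mul_le_mul_of_nonneg_left hc hi.le).trans_lt hlt'
  · rw [← dil_mul, ← dil_mul, gnorm_dil hi, ← hR, inv_mul_cancel₀ hRpos.ne']
  · rw [← dil_mul, ← dil_mul, hWV.proj_dil hi, gnorm_dil hi, mul_left_comm, ← div_eq_inv_mul,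
      one_le_div₀ hRpos]
    exact hcone

variable [MeasurableSpace G] [BorelSpace G] {d : ℝ} {τ : Measure G} {k : MeasureKind}

/-- A set that satisfies a cone condition is `ψ^d`-null if its projection is `ν`-null, where `ν` is
a measure with positive upper density at its points. -/
theorem psi_eq_zero_of_cone (hWV : IsSplitting W V) (hd : 0 ≤ d) {Z : Set G} {n : ℝ}
    (hcone : ∀ p ∈ Z, ∀ q ∈ Z, gnorm (p⁻¹ * q) ≤ n * gnorm (hWV.proj (p⁻¹ * q)))
    {ν : Measure G} [ν.OuterRegular] (hν : ν (hWV.proj '' Z) = 0) {η : ℝ≥0∞} (hη : η ≠ 0)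
    (hη' : η ≠ ∞)
    (h : ∀ p ∈ Z, ∀ δ > 0, ∃ s, 0 < s ∧ s ≤ δ ∧
      η * ENNReal.ofReal s ^ d ≤ ν (hWV.proj '' Metric.closedBall p s)) : psi k d Z = 0 := by
  obtain ⟨C, hC, hbound⟩ := hWV.exists_gnorm_le_of_cone n
  have key : ∀ ε : ℝ≥0∞, ε ≠ 0 → ε ≠ ∞ →
      psi k d Z ≤ ENNReal.ofReal (4 * C) ^ d * (ε / η) := by
    intro ε hε hε'
    refine psi_le_of_psiPre_le fun δ hδ => ?_
    obtain ⟨U, hZU, hU, hνU⟩ := (hWV.proj '' Z).exists_isOpen_lt_add (μ := ν) (by rw [hν]; simp) hε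
    rw [hν, zero_add] at hνU
    let Q : G × ℝ → Set G := fun a => hWV.proj '' Metric.closedBall a.1 a.2
    -- The disjoint family is chosen among projected balls inside an open set of small `ν`-measure.
    -- The balls of radius `2 * C * a.2` upstairs have admissible size `4 * C * a.2`, hence the
    -- bound on `a.2`.
    let F : Set (G × ℝ) := {a | a.1 ∈ Z ∧ 0 < a.2 ∧ a.2 ≤ δ / (4 * C) ∧ Q a ⊆ U ∧
      η * ENNReal.ofReal a.2 ^ d ≤ ν (Q a)}
    obtain ⟨u, huF, hdisj, hu⟩ := Vitali.exists_disjoint_subfamily_covering_enlargement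
      Q F (fun a => a.2) 2 one_lt_two (fun a ha => ha.2.1.le) (δ / (4 * C))
      (fun a ha => ha.2.2.1) (fun a ha => ⟨_, mem_image_of_mem _
        (Metric.mem_closedBall_self ha.2.1.le)⟩)
    have hdisj' : Pairwise (Function.onFun Disjoint fun a : u => Q a.1) := fun a b hab =>
      hdisj a.2 b.2 (fun h => hab (Subtype.ext h))
    have hmeas : ∀ a : u, MeasurableSet (Q a.1) := fun a =>
      ((isCompact_closedBall _ _).image hWV.continuous_proj).measurableSet
    have hsubU : ⋃ a : u, Q a.1 ⊆ U := iUnion_subset fun a => (huF a.2).2.2.2.1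
    have hsum : ∑' a : u, ENNReal.ofReal a.1.2 ^ d ≤ ε / η := by
      rw [ENNReal.le_div_iff_mul_le (Or.inl hη) (Or.inl hη'), mul_comm, ← ENNReal.tsum_mul_left]
      calc _ ≤ ∑' a : u, ν (Q a.1) := ENNReal.tsum_le_tsum fun a => (huF a.2).2.2.2.2
        _ ≤ ν (⋃ a : u, Q a.1) := tsum_meas_le_meas_iUnion_of_disjoint ν hmeas hdisj'
        _ ≤ ε := (measure_mono hsubU).trans hνU.le
    have hcount : Countable u := by
      have h1 := Measure.countable_meas_pos_of_disjoint_of_meas_iUnion_ne_top ν hmeas hdisj'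
        (ne_top_of_le_ne_top hνU.ne_top (measure_mono hsubU))
      have h2 : {a : u | 0 < ν (Q a.1)} = univ := by
        refine eq_univ_of_forall fun a => lt_of_lt_of_le ?_ (huF a.2).2.2.2.2
        exact ENNReal.mul_pos hη (ofReal_rpow_ne_zero (huF a.2).2.1 d)
      rw [h2] at h1
      exact countable_univ_iff.1 h1
    have hcover : Z ⊆ ⋃ a : u, Metric.closedBall a.1.1 (2 * C * a.1.2) := by
      intro p hp
      have hπ : hWV.proj ⁻¹' U ∈ 𝓝 p :=
        (hU.preimage hWV.continuous_proj).mem_nhds (hZU (mem_image_of_mem _ hp))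
      obtain ⟨r, hr, hrU⟩ := Metric.nhds_basis_closedBall.mem_iff.1 hπ
      obtain ⟨s, hs, hsle, hsν⟩ := h p hp (min r (δ / (4 * C))) (by positivity)
      obtain ⟨b, hbu, ⟨_, ⟨x, hx, rfl⟩, ⟨y, hy, hxy⟩⟩, hsb⟩ := hu (p, s) ⟨hp, hs,
        hsle.trans (min_le_right _ _), image_subset_iff.2
          ((Metric.closedBall_subset_closedBall (hsle.trans (min_le_left _ _))).trans hrU), hsν⟩
      refine mem_iUnion.2 ⟨⟨b, hbu⟩, ?_⟩
      have hbpos : 0 < b.2 := (huF hbu).2.1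
      -- Projected balls can meet while the balls are far apart along `V`. The cone condition
      -- between the two centers excludes this up to the constant `C`.
      have hV : y⁻¹ * x ∈ V := hWV.complementary.fst_eq_fst_iff.1 hxy
      have e : (b.1)⁻¹ * y * (y⁻¹ * x) * (x⁻¹ * p) = (b.1)⁻¹ * p := by group
      have h1 := hbound ((b.1)⁻¹ * y) (y⁻¹ * x) (x⁻¹ * p) (2 * b.2) hV
        (by
          rw [← dist_eq_gnorm, dist_comm]
          exact (Metric.mem_closedBall.1 hy).trans (by linarith))
        (by
          rw [← dist_eq_gnorm]
          exact (Metric.mem_closedBall.1 hx).trans hsb)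
        (by
          rw [e]
          exact hcone _ (huF hbu).1 _ hp)
      rw [e, ← dist_eq_gnorm, dist_comm] at h1
      rw [Metric.mem_closedBall]
      linarith
    calc psiPre k d δ Z ≤ ∑' a : u, psiPre k d δ (Metric.closedBall a.1.1 (2 * C * a.1.2)) :=
          (measure_mono hcover).trans (measure_iUnion_le _)
      _ ≤ ∑' a : u, ENNReal.ofReal (4 * C) ^ d * ENNReal.ofReal a.1.2 ^ d := by
          refine ENNReal.tsum_le_tsum fun a => ?_
          have ha := huF a.2
          rw [← ENNReal.mul_rpow_of_nonneg _ _ hd, ← ENNReal.ofReal_mul (by positivity)]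
          have ha2 := ha.2.2.1
          rw [le_div_iff₀ (by positivity)] at ha2
          exact psiPre_le hd (by have := ha.2.1; positivity) (by linarith)
            ((Adm.closedBall k _ _).mono Subset.rfl (by linarith))
      _ ≤ _ := by
          rw [ENNReal.tsum_mul_left]
          gcongr
  have hlim : Tendsto (fun ε : ℝ≥0∞ => ENNReal.ofReal (4 * C) ^ d * (ε / η)) (𝓝[>] 0)
      (𝓝 (ENNReal.ofReal (4 * C) ^ d * (0 / η))) := by
    refine ENNReal.Tendsto.const_mul ?_ (Or.inr
      (ENNReal.rpow_ne_top_of_nonneg hd ENNReal.ofReal_ne_top))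
    exact ((ENNReal.continuous_div_const η hη).tendsto 0).mono_left nhdsWithin_le_nhds
  rw [ENNReal.zero_div, mul_zero] at hlim
  have hev : ∀ᶠ ε in 𝓝[>] (0 : ℝ≥0∞), psi k d Z ≤ ENNReal.ofReal (4 * C) ^ d * (ε / η) := by
    filter_upwards [Ioo_mem_nhdsGT (zero_lt_one' ℝ≥0∞)] with ε hε
    exact key ε hε.1.ne' (hε.2.trans ENNReal.one_lt_top).ne
  exact le_antisymm (ge_of_tendsto hlim hev) zero_le

end IsSplitting

end Density

/-! ### Densities at the points of a graph with tangents -/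

section GraphDensity

theorem tendsto_mul_ofReal_rpow {a : ℝ≥0∞} (ha : a ≠ ∞) (c d : ℝ) :
    Tendsto (fun ε : ℝ => a * ENNReal.ofReal (1 + c * ε) ^ d) (𝓝[>] 0) (𝓝 a) := by
  have h1 : Continuous fun ε : ℝ => ENNReal.ofReal (1 + c * ε) :=
    ENNReal.continuous_ofReal.comp (by fun_prop)
  have h2 := (ENNReal.continuous_rpow_const (y := d)).comp h1
  have h3 := ENNReal.Tendsto.const_mul (a := a) (h2.tendsto 0) (Or.inr ha)
  simp only [Function.comp_apply, mul_zero, add_zero, ENNReal.ofReal_one, ENNReal.one_rpow,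
    mul_one] at h3
  exact h3.mono_left nhdsWithin_le_nhds

variable {G : Type u} [CarnotGroup G] {W V : Subgroup G}

namespace IsSplitting

variable (hWV : IsSplitting W V)

/-- This is continuity of the inverse of the projection on a compact set: the part of `K` away from
`p` has a compact projection that misses that of `p`. It takes the place of continuity of the graph
map. -/
theorem exists_dist_lt_of_proj_eq {K : Set G} (hK : IsCompact K) (hinj : InjOn hWV.proj K) {p : G}
    (hp : p ∈ K) {r : ℝ} (hr : 0 < r) :
    ∃ s > 0, ∀ x, dist p x ≤ s → ∀ q ∈ K, hWV.proj q = hWV.proj x → dist p q < r := by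
  have hC : IsCompact (hWV.proj '' (K \ Metric.ball p r)) :=
    (hK.diff Metric.isOpen_ball).image hWV.continuous_proj
  have hpC : hWV.proj p ∉ hWV.proj '' (K \ Metric.ball p r) := by
    rintro ⟨q, ⟨hq, hqr⟩, hpq⟩
    rw [hinj hq hp hpq] at hqr
    exact hqr (Metric.mem_ball_self hr)
  have hnhds : hWV.proj ⁻¹' (hWV.proj '' (K \ Metric.ball p r))ᶜ ∈ 𝓝 p :=
    hWV.continuous_proj.continuousAt.preimage_mem_nhds (hC.isClosed.isOpen_compl.mem_nhds hpC)
  obtain ⟨s, hs, hball⟩ := Metric.nhds_basis_closedBall.mem_iff.1 hnhds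
  refine ⟨s, hs, fun x hx q hq hqx => ?_⟩
  by_contra h
  refine hball (Metric.mem_closedBall'.2 hx) ⟨q, ⟨hq, fun hqr => h ?_⟩, hqx⟩
  rwa [Metric.mem_ball, dist_comm] at hqr

variable [MeasurableSpace G] {d : ℝ} {τ : Measure G} {k : MeasureKind} {S K : Set G} {p : G}
  {T : Subgroup G}

/-- Sliding along cosets of `V` moves the points of `E ∩ S` into `p T` at distance at most `ε * s`
without changing their projections, so an `ε * s`-thickening of `E` captures them. -/
theorem exists_measure_proj_image_le (hτ : IsHomogeneousHaar W d τ) (h : HasTangent V S p T)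
    {t : ℝ≥0∞} (ht : hWV.areaDensity τ k T < t) :
    ∃ δ > 0, ∀ (E : Set G) (s : ℝ), p ∈ E → 0 < s → s ≤ δ → Adm k E s →
      τ (hWV.proj '' (E ∩ S)) ≤ t * ENNReal.ofReal s ^ d := by
  obtain ⟨ε, hεt, hε⟩ := (((tendsto_mul_ofReal_rpow (hWV.areaDensity_ne_top hτ) 2 d).eventually
    (gt_mem_nhds ht)).and self_mem_nhdsWithin).exists
  have hε : 0 < ε := hε
  obtain ⟨hT, h⟩ := h
  obtain ⟨r, hr, h⟩ := h ε hε
  refine ⟨r / 2, half_pos hr, fun E s hpE hs hsr hE => ?_⟩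
  have hE' : Adm k {y | ∃ x ∈ (fun x => p⁻¹ * x) '' E, dist y x ≤ ε * s} (s * (1 + 2 * ε)) := by
    have := (hE.mul_left p⁻¹).thicken (ε * s)
    rwa [show s + 2 * (ε * s) = s * (1 + 2 * ε) by ring] at this
  have hsub : hWV.proj '' (E ∩ S) ⊆ hWV.proj '' ((fun x => p * x) ''
      ({y | ∃ x ∈ (fun x => p⁻¹ * x) '' E, dist y x ≤ ε * s} ∩ T)) := by
    rintro _ ⟨q, ⟨hqE, hqS⟩, rfl⟩
    have hpq : dist p q ≤ s := hE.dist_le hpE hqE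
    have h1 := h q hqS (by linarith)
    refine ⟨_, ⟨hT.2.fst (p⁻¹ * q), ⟨⟨_, ⟨q, hqE, rfl⟩, ?_⟩, hT.2.fst_mem _⟩, rfl⟩, ?_⟩
    · rw [dist_comm]
      refine h1.trans (mul_le_mul_of_nonneg_left ?_ hε.le)
      rwa [← dist_eq_gnorm]
    · refine hWV.complementary.fst_eq_fst_iff.2 ?_
      have := hT.2.inv_fst_mul_mem (p⁻¹ * q)
      rwa [mul_inv_rev, mul_assoc]
  calc τ (hWV.proj '' (E ∩ S)) ≤ _ := measure_mono hsub
    _ ≤ hWV.areaDensity τ k T * ENNReal.ofReal (s * (1 + 2 * ε)) ^ d := by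
      rw [hWV.measure_proj_image_mul hτ]
      exact hWV.measure_le_areaDensity_mul hτ hT
        ⟨1, ⟨p, hpE, inv_mul_cancel p⟩, by rw [dist_self]; positivity⟩ (by positivity) hE'
    _ = hWV.areaDensity τ k T * ENNReal.ofReal (1 + 2 * ε) ^ d * ENNReal.ofReal s ^ d := by
      rw [mul_comm s, ENNReal.ofReal_mul (by positivity), ENNReal.mul_rpow_of_nonneg _ _ hτ.nonneg,
        mul_assoc]
    _ ≤ t * ENNReal.ofReal s ^ d := by gcongr

/-- Take a nearly optimal competitor for `T`, dilated by `s` and translated to `p`. Above the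
projection of each of its tangent points there is a nearby point of `K`, except over a set that
`hpK` makes negligible. -/
theorem exists_le_measure_proj_image (hτ : IsHomogeneousHaar W d τ) (h : HasTangent V S p T)
    (hK : IsCompact K) (hKS : K ⊆ S) (hinj : InjOn hWV.proj S) (hp : p ∈ K)
    (hpK : ∀ η : ℝ≥0∞, η ≠ 0 → ∃ δ > 0, ∀ s, 0 < s → s ≤ δ →
      τ (hWV.proj '' Metric.closedBall p s \ hWV.proj '' K) ≤ η * ENNReal.ofReal s ^ d)
    {t : ℝ≥0∞} (ht : t < hWV.areaDensity τ k T) {δ : ℝ} (hδ : 0 < δ) :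
    ∃ (E : Set G) (s : ℝ), IsClosed E ∧ p ∈ interior E ∧ 0 < s ∧ s ≤ δ ∧ Adm k E s ∧
      t * ENNReal.ofReal s ^ d ≤ τ (hWV.proj '' (E ∩ S)) := by
  have hlim : Tendsto (fun ε : ℝ => t * ENNReal.ofReal (1 + 4 * ε) ^ d + ENNReal.ofReal ε)
      (𝓝[>] 0) (𝓝 (t + ENNReal.ofReal 0)) :=
    (tendsto_mul_ofReal_rpow ht.ne_top 4 d).add
      ((ENNReal.continuous_ofReal.tendsto 0).mono_left nhdsWithin_le_nhds)
  rw [ENNReal.ofReal_zero, add_zero] at hlim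
  obtain ⟨ε, hεt, hε, hε2⟩ := ((hlim.eventually (gt_mem_nhds ht)).and
    (Ioo_mem_nhdsGT (show (0 : ℝ) < 1 / 2 by norm_num))).exists
  obtain ⟨E₀, h1E, hE₀, hlt⟩ := hWV.exists_lt_of_lt_areaDensity hεt
  obtain ⟨hT, h⟩ := h
  obtain ⟨r, hr, h⟩ := h ε hε
  obtain ⟨s₀, hs₀, hs₀r⟩ := hWV.exists_dist_lt_of_proj_eq hK (hinj.mono hKS) hp hr
  obtain ⟨δ₁, hδ₁, hδ₁K⟩ := hpK (ENNReal.ofReal ε) (by simpa using hε)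
  obtain ⟨s, hs, hsle⟩ : ∃ s > 0, s ≤ min (min s₀ δ₁) (δ / (1 + 4 * ε)) :=
    ⟨_, by positivity, le_rfl⟩
  have hss₀ : s ≤ s₀ := hsle.trans ((min_le_left _ _).trans (min_le_left _ _))
  have hsδ₁ : s ≤ δ₁ := hsle.trans ((min_le_left _ _).trans (min_le_right _ _))
  have hsδ : (1 + 4 * ε) * s ≤ δ := by
    have := hsle.trans (min_le_right _ _)
    rwa [le_div_iff₀ (by positivity), mul_comm] at this
  let F : Set G := (fun x => p * x) '' ((dil s : G → G) '' E₀)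
  -- The thickening catches the points of `K` above the tangent, which are within `2 * ε * s` since
  -- `ε < 1 / 2` gives `gnorm (p⁻¹ * q) ≤ 2 * s`. It also puts `p` in the interior, as
  -- `upperDensity` requires.
  let E : Set G := {y | ∃ x ∈ F, dist y x ≤ 2 * ε * s}
  have hpF : p ∈ F := ⟨1, ⟨1, h1E, dil_one_right _⟩, mul_one p⟩
  have hE : Adm k E ((1 + 4 * ε) * s) := by
    have := ((hE₀.dil hs).mul_left p).thicken (2 * ε * s)
    rwa [show s * 1 + 2 * (2 * ε * s) = (1 + 4 * ε) * s by ring] at this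
  refine ⟨closure E, (1 + 4 * ε) * s, isClosed_closure, ?_, by positivity, hsδ, hE.closure, ?_⟩
  · refine mem_interior_iff_mem_nhds.2 (mem_of_superset
      (Metric.ball_mem_nhds p (show 0 < 2 * ε * s by positivity)) fun y hy => ?_)
    exact subset_closure ⟨p, hpF, (Metric.mem_ball.1 hy).le⟩
  have hsub : hWV.proj '' ((fun x => p * x) '' ((dil s : G → G) '' (E₀ ∩ T))) ⊆
      hWV.proj '' (closure E ∩ S) ∪ hWV.proj '' Metric.closedBall p s \ hWV.proj '' K := by
    rintro _ ⟨_, ⟨_, ⟨e, ⟨heE, heT⟩, rfl⟩, rfl⟩, rfl⟩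
    have htT : dil s e ∈ T := hT.1.dil_mem hs heT
    have hts : gnorm (dil s e) ≤ s := by
      rw [gnorm_dil hs]
      exact mul_le_of_le_one_right hs.le (hE₀.dist_le h1E heE)
    have hdist : dist p (p * dil s e) ≤ s := by rwa [dist_eq_gnorm, inv_mul_cancel_left]
    by_cases hz : hWV.proj (p * dil s e) ∈ hWV.proj '' K
    · left
      obtain ⟨q, hq, hqz⟩ := hz
      have hpq := hs₀r _ (hdist.trans hss₀) q hq hqz
      have h1 := h q (hKS hq) hpq
      have hfst : hT.2.fst (p⁻¹ * q) = dil s e := by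
        refine hT.2.fst_eq htT ?_
        have := hWV.complementary.fst_eq_fst_iff.1 hqz.symm
        rwa [mul_inv_rev, mul_assoc] at this
      rw [hfst] at h1
      have h2 : gnorm (p⁻¹ * q) ≤ gnorm (dil s e) + dist (p⁻¹ * q) (dil s e) := by
        rw [gnorm, gnorm, dist_comm (p⁻¹ * q)]
        exact dist_triangle _ _ _
      have h3 : gnorm (p⁻¹ * q) ≤ 2 * s := by nlinarith [gnorm_nonneg (p⁻¹ * q)]
      refine ⟨q, ⟨subset_closure ⟨p * dil s e, ⟨_, ⟨e, heE, rfl⟩, rfl⟩, ?_⟩, hKS hq⟩, hqz⟩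
      calc dist q (p * dil s e) = dist (p⁻¹ * q) (dil s e) := by
            rw [← dist_mul_left p⁻¹ q, inv_mul_cancel_left]
        _ ≤ ε * gnorm (p⁻¹ * q) := h1
        _ ≤ ε * (2 * s) := mul_le_mul_of_nonneg_left h3 hε.le
        _ = 2 * ε * s := by ring
    · exact Or.inr ⟨⟨_, Metric.mem_closedBall'.2 hdist, rfl⟩, hz⟩
  have hfin : ENNReal.ofReal ε * ENNReal.ofReal s ^ d ≠ ∞ :=
    ENNReal.mul_ne_top ENNReal.ofReal_ne_top (ofReal_rpow_ne_top hs d)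
  refine (ENNReal.add_le_add_iff_right hfin).1 ?_
  calc _ = (t * ENNReal.ofReal (1 + 4 * ε) ^ d + ENNReal.ofReal ε) * ENNReal.ofReal s ^ d := by
        rw [ENNReal.ofReal_mul (by positivity), ENNReal.mul_rpow_of_nonneg _ _ hτ.nonneg, add_mul,
          mul_assoc]
    _ ≤ τ (hWV.proj '' (E₀ ∩ T)) * ENNReal.ofReal s ^ d := by gcongr
    _ = τ (hWV.proj '' ((fun x => p * x) '' ((dil s : G → G) '' (E₀ ∩ T)))) := by
        rw [hWV.measure_proj_image_mul hτ, hWV.measure_proj_image_dil hτ hs, mul_comm]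
    _ ≤ _ := (measure_mono hsub).trans (measure_union_le _ _)
    _ ≤ _ := by
        gcongr
        exact hδ₁K s hs hsδ₁

variable [BorelSpace G]

/-- At `ψ^d`-almost every point of `K`, the projection of `K` has density one. -/
theorem psi_setOf_not_density (hτ : IsHomogeneousHaar W d τ) (hK : IsCompact K)
    (hT : ∀ p ∈ K, ∃ T, HasTangent V K p T) :
    psi k d {p ∈ K | ¬ ∀ η : ℝ≥0∞, η ≠ 0 → ∃ δ > 0, ∀ s, 0 < s → s ≤ δ →
      τ (hWV.proj '' Metric.closedBall p s \ hWV.proj '' K) ≤ η * ENNReal.ofReal s ^ d} = 0 := by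
  have := hτ.finite
  have hKm : MeasurableSet (hWV.proj '' K) := (hK.image hWV.continuous_proj).measurableSet
  let ν : Measure G := τ.restrict (hWV.proj '' K)ᶜ
  have hν : ∀ F, IsCompact F → ν (hWV.proj '' F) = τ (hWV.proj '' F \ hWV.proj '' K) := by
    intro F hF
    rw [Measure.restrict_apply (hF.image hWV.continuous_proj).measurableSet, sdiff_eq]
  -- The bad points are sorted by a lower bound for the density of the missing part (`j`), by the
  -- constant of the cone (`n`), and by location (`i`), so that any two points of a class are within
  -- the radius where the cone condition holds.
  let Z : ℕ → ℕ → ℕ → Set G := fun j n i => {p ∈ K | dist p (TopologicalSpace.denseSeq G i) <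
      1 / (2 * ((n : ℝ) + 1)) ∧
    (∀ q ∈ K, dist p q < 1 / ((n : ℝ) + 1) → gnorm (p⁻¹ * q) ≤ n * gnorm (hWV.proj (p⁻¹ * q))) ∧
    ∀ δ > 0, ∃ s, 0 < s ∧ s ≤ δ ∧ ((j : ℝ≥0∞) + 1)⁻¹ * ENNReal.ofReal s ^ d ≤
      ν (hWV.proj '' Metric.closedBall p s)}
  refine measure_mono_null (t := ⋃ (j) (n) (i), Z j n i) ?_ (measure_iUnion_null fun j =>
    measure_iUnion_null fun n => measure_iUnion_null fun i => ?_)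
  · rintro p ⟨hp, h⟩
    push Not at h
    obtain ⟨η, hη, h⟩ := h
    obtain ⟨T, hpT⟩ := hT p hp
    obtain ⟨n, hn⟩ := hWV.exists_cone hpT
    obtain ⟨j, hj⟩ := ENNReal.exists_inv_nat_lt hη
    obtain ⟨i, hi⟩ := (TopologicalSpace.denseRange_denseSeq G).exists_dist_lt p
      (show 0 < 1 / (2 * ((n : ℝ) + 1)) by positivity)
    refine mem_iUnion.2 ⟨j, mem_iUnion.2 ⟨n, mem_iUnion.2 ⟨i, hp, hi, hn, fun δ hδ => ?_⟩⟩⟩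
    obtain ⟨s, hs, hsδ, hlt⟩ := h δ hδ
    refine ⟨s, hs, hsδ, ?_⟩
    rw [hν _ (isCompact_closedBall p s)]
    refine le_trans ?_ hlt.le
    gcongr
    exact (ENNReal.inv_le_inv.2 le_self_add).trans hj.le
  · refine hWV.psi_eq_zero_of_cone hτ.nonneg (n := n) (ν := ν) (η := ((j : ℝ≥0∞) + 1)⁻¹)
      (fun p hp q hq => hp.2.2.1 q hq.1 ?_) ?_ ?_ ?_ (fun p hp => hp.2.2.2)
    · calc dist p q ≤ dist p (TopologicalSpace.denseSeq G i) +
            dist q (TopologicalSpace.denseSeq G i) := dist_triangle_right _ _ _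
        _ < 1 / (2 * ((n : ℝ) + 1)) + 1 / (2 * ((n : ℝ) + 1)) := add_lt_add hp.2.1 hq.2.1
        _ = 1 / ((n : ℝ) + 1) := by field_simp; norm_num
    · refine measure_mono_null (image_mono fun p hp => hp.1) ?_
      rw [hν K hK, sdiff_self, measure_empty]
    · exact ENNReal.inv_ne_zero.2 (by simp)
    · simp

/-- The measure that `τ` induces on a graph with tangents has a density with respect to `ψ^d`,
given by the tangents. -/
theorem exists_density (hτ : IsHomogeneousHaar W d τ) (hS : IsSigmaCompact S)
    (hinj : InjOn hWV.proj S) {T : G → Subgroup G} (hT : ∀ p ∈ S, HasTangent V S p (T p)) :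
    ∃ D : G → ℝ≥0∞, Measurable D ∧
      (∃ N, MeasurableSet N ∧ psi k d N = 0 ∧
        ∀ p ∈ S, p ∉ N → D p = hWV.areaDensity τ k (T p)) ∧
      ∀ B ⊆ S, MeasurableSet B → τ (hWV.proj '' B) = ∫⁻ p in B, D p ∂psi k d := by
  have hSm : MeasurableSet S := by
    obtain ⟨K, hK, rfl⟩ := hS
    exact MeasurableSet.iUnion fun m => (hK m).measurableSet
  obtain ⟨μ, hμfin, hμ⟩ := hWV.exists_graph_measure hτ hSm hinj
  have hμB : ∀ B ⊆ S, μ B = τ (hWV.proj '' B) := fun B hB => by rw [hμ, inter_eq_left.2 hB]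
  obtain ⟨Z, hZ, hlower⟩ : ∃ Z, psi k d Z = 0 ∧ ∀ p ∈ S, p ∉ Z → ∀ t : ℝ≥0,
      t < hWV.areaDensity τ k (T p) → ∀ δ > 0, ∃ (E : Set G) (s : ℝ), IsClosed E ∧
        p ∈ interior E ∧ 0 < s ∧ s ≤ δ ∧ Adm k E s ∧ t * ENNReal.ofReal s ^ d ≤ μ E := by
    obtain ⟨K, hK, rfl⟩ := hS
    refine ⟨_, measure_iUnion_null fun m => hWV.psi_setOf_not_density hτ (hK m) fun p hp =>
      ⟨T p, (hT p (mem_iUnion_of_mem m hp)).mono (subset_iUnion K m)⟩, ?_⟩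
    intro p hp hpZ t ht δ hδ
    obtain ⟨m, hm⟩ := mem_iUnion.1 hp
    simp only [hμ]
    refine hWV.exists_le_measure_proj_image hτ (hT p hp) (hK m) (subset_iUnion K m) hinj hm ?_ ht hδ
    by_contra hcon
    exact hpZ (mem_iUnion_of_mem m ⟨hm, hcon⟩)
  have hupper : ∀ p ∈ S, ∀ t : ℝ≥0, hWV.areaDensity τ k (T p) < t → ∃ δ > 0, ∀ (E : Set G)
      (s : ℝ), p ∈ E → 0 < s → s ≤ δ → Adm k E s → μ E ≤ t * ENNReal.ofReal s ^ d := by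
    intro p hp t ht
    simp only [hμ]
    exact hWV.exists_measure_proj_image_le hτ (hT p hp) ht
  set N := toMeasurable (psi k d) Z with hN
  have hNm : MeasurableSet N := measurableSet_toMeasurable _ _
  have hN0 : psi k d N = 0 := by rw [hN, measure_toMeasurable, hZ]
  have hD : ∀ p ∈ S, p ∉ N → upperDensity k d μ p = hWV.areaDensity τ k (T p) := fun p hp hpN =>
    upperDensity_eq (hupper p hp) (hlower p hp fun hpZ => hpN (subset_toMeasurable _ _ hpZ))
  refine ⟨upperDensity k d μ, measurable_upperDensity k d μ, ⟨N, hNm, hN0, hD⟩,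
    fun B hBS hB => ?_⟩
  rw [← hμB B hBS]
  -- The upper bound holds at every point, including those of `N`. The density is finite there, so
  -- `N` is null for `μ` as well as for `psi`.
  have hnull : μ (B ∩ N) = 0 := by
    refine measure_mono_null (t := ⋃ j : ℕ, {p ∈ S ∩ N | hWV.areaDensity τ k (T p) < (j + 1 : ℕ)})
      ?_ (measure_iUnion_null fun j => ?_)
    · rintro p ⟨hpB, hpN⟩
      obtain ⟨j, hj⟩ := ENNReal.exists_nat_gt (hWV.areaDensity_ne_top (k := k) (P := T p) hτ)
      exact mem_iUnion_of_mem j ⟨⟨hBS hpB, hpN⟩, hj.trans_le (by simp)⟩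
    · refine le_antisymm ?_ zero_le
      calc _ ≤ ((j + 1 : ℕ) : ℝ≥0) * psi k d {p ∈ S ∩ N | hWV.areaDensity τ k (T p) <
            (j + 1 : ℕ)} := measure_le_mul_psi hτ.nonneg (by simp) fun p hp =>
              hupper p hp.1.1 _ (by exact_mod_cast hp.2)
        _ = 0 := by
          rw [measure_mono_null (fun p hp => hp.1.2) hN0, mul_zero]
  have hmain := measure_eq_setLIntegral_of_forall_le (μ := μ) (ν := psi k d)
    (measurable_upperDensity k d μ) (S := S \ N)
    (fun p hp => by rw [hD p hp.1 hp.2]; exact hWV.areaDensity_ne_zero hτ (hT p hp.1).1)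
    (fun p hp => by rw [hD p hp.1 hp.2]; exact hWV.areaDensity_ne_top hτ)
    (fun B hB t ht hlt => measure_le_mul_psi hτ.nonneg ht fun p hp =>
      hupper p (hB hp).1 t (by rw [← hD p (hB hp).1 (hB hp).2]; exact hlt p hp))
    (fun B hB t ht hlt => mul_psi_le_measure hτ.nonneg ht fun p hp δ hδ => by
      obtain ⟨E, s, hE, hpE, h⟩ := hlower p (hB hp).1
        (fun hpZ => (hB hp).2 (subset_toMeasurable _ _ hpZ)) t
        (by rw [← hD p (hB hp).1 (hB hp).2]; exact hlt p hp) δ hδ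
      exact ⟨E, s, hE, interior_subset hpE, h⟩)
    (hB.diff hNm) (sdiff_subset_sdiff_left hBS)
  rw [← measure_inter_add_sdiff B hNm, hnull, zero_add, hmain]
  refine setLIntegral_congr ?_
  exact sdiff_null_ae_eq_self hN0

end IsSplitting

end GraphDensity

/-! ### The area formula -/

section AreaFormula

variable {G : Type u} [CarnotGroup G] {W V : Subgroup G}

/-- The chosen tangent subgroup comes with a defining map of its own, so no comparison of kernels of
different maps is needed. -/
theorem exists_isLevelSetNear_tangentSubgroup {S : Set G} (hS : IsC1HSubmanifold S) {p : G}
    (hp : p ∈ S) :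
    ∃ (H : Type u) (_ : CarnotGroup H), IsLevelSetNear H S p (tangentSubgroup S p) := by
  obtain ⟨H, hH, hS⟩ := hS
  obtain ⟨T, hT⟩ := hS p hp
  have h : ∃ (T : Subgroup G) (H : Type u) (_ : CarnotGroup H), p ∈ S ∧ IsLevelSetNear H S p T :=
    ⟨T, H, hH, hp, hT⟩
  obtain ⟨H', hH', -, h'⟩ := h.choose_spec
  refine ⟨H', hH', ?_⟩
  rwa [tangentSubgroup, dif_pos h]

theorem IsSplitting.proj_graphMap (hWV : IsSplitting W V) {A : Set W} (φ : A → V) (w : A) :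
    hWV.proj (graphMap φ w) = w :=
  hWV.complementary.fst_eq w.1.2 (by simp [graphMap])

theorem IsSplitting.injOn_proj_intrinsicGraph (hWV : IsSplitting W V) {A : Set W} (φ : A → V) :
    InjOn hWV.proj (intrinsicGraph φ) := by
  rintro _ ⟨w, rfl⟩ _ ⟨w', rfl⟩ h
  rw [hWV.proj_graphMap, hWV.proj_graphMap] at h
  rw [Subtype.ext (Subtype.ext h)]

variable [MeasurableSpace G] [BorelSpace G] {d : ℝ} {τ : Measure G}

/-- The formula is first an identity of measures: the graph map sends `psi` on `A` to `psi` on the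
graph with density `D / θ`. Integrating `h * (θ / D)` and replacing `D` almost everywhere by the
area density of the tangent gives the claim; measurability is needed only for `D`. -/
theorem IsSplitting.lintegral_intrinsicGraph (hWV : IsSplitting W V) (hτ : IsHomogeneousHaar W d τ)
    (k : MeasureKind) {A : Set W} {φ : A → V} (hA : MeasurableSet A) (hφ : IsC1WV φ)
    {h : intrinsicGraph φ → ℝ≥0∞} (hh : Measurable h) :
    ∫⁻ p, h p ∂(psi k d).comap (Subtype.val : intrinsicGraph φ → G) =
      ∫⁻ w : A, h ⟨graphMap φ w, mem_range_self w⟩ *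
        (hWV.areaFactor τ k (tangentSubgroup (intrinsicGraph φ) (graphMap φ w)) : ℝ≥0∞)
          ∂(psi k d).comap (fun w : A => ((w : W) : G)) := by
  set ψ : Measure G := psi k d with hψ
  have hT : ∀ p ∈ intrinsicGraph φ,
      HasTangent V (intrinsicGraph φ) p (tangentSubgroup (intrinsicGraph φ) p) := by
    intro p hp
    obtain ⟨H, _, hH⟩ := exists_isLevelSetNear_tangentSubgroup hφ.1 hp
    obtain ⟨w, rfl⟩ := hp
    exact hH.hasTangent (mem_range_self w) (hφ.2 w) hWV.homogeneous_right
  have hSσ := hφ.1.isSigmaCompact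
  have hSm : MeasurableSet (intrinsicGraph φ) := by
    obtain ⟨K, hK, hKS⟩ := hSσ
    rw [← hKS]
    exact MeasurableSet.iUnion fun m => (hK m).measurableSet
  obtain ⟨D, hDm, ⟨N, hNm, hN0, hD⟩, hmain⟩ :=
    hWV.exists_density (k := k) hτ hSσ (hWV.injOn_proj_intrinsicGraph φ) hT
  have hval : MeasurableEmbedding (Subtype.val : intrinsicGraph φ → G) :=
    MeasurableEmbedding.subtype_coe hSm
  have hι : MeasurableEmbedding (fun w : A => ((w : W) : G)) :=
    (MeasurableEmbedding.subtype_coe hWV.homogeneous_left.isClosed.measurableSet).comp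
      (MeasurableEmbedding.subtype_coe hA)
  let e : A → intrinsicGraph φ := fun w => ⟨graphMap φ w, mem_range_self w⟩
  have himage : ∀ B : Set (intrinsicGraph φ), (fun w : A => ((w : W) : G)) '' (e ⁻¹' B) =
      hWV.proj '' (Subtype.val '' B) := by
    intro B
    ext x
    constructor
    · rintro ⟨w, hw, rfl⟩
      exact ⟨_, ⟨e w, hw, rfl⟩, hWV.proj_graphMap φ w⟩
    · rintro ⟨_, ⟨⟨_, w, rfl⟩, hb, rfl⟩, rfl⟩
      exact ⟨w, hb, (hWV.proj_graphMap φ w).symm⟩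
  have himm : ∀ B : Set (intrinsicGraph φ), MeasurableSet B →
      MeasurableSet (hWV.proj '' (Subtype.val '' B)) :=
    fun B hB => (hval.measurableSet_image.2 hB).image_of_continuousOn_injOn
      hWV.continuous_proj.continuousOn
      ((hWV.injOn_proj_intrinsicGraph φ).mono (Subtype.coe_image_subset (intrinsicGraph φ) B))
  -- Preimages under the graph map are projections of Borel subsets of the graph, hence Borel by
  -- Lusin–Souslin; no regularity of `φ` has to be known beforehand.
  have he : Measurable e := fun B hB => by
    rw [← hι.measurableSet_image, himage]
    exact himm B hB
  set θ := hWV.areaDensity τ k W with hθ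
  have hθ0 : θ ≠ 0 := hWV.areaDensity_ne_zero hτ hWV.left_mem_complements
  have hθtop : θ ≠ ∞ := hWV.areaDensity_ne_top hτ
  have hDS : Measurable fun p : (intrinsicGraph φ) => D p := hDm.comp measurable_subtype_coe
  have hmap : (ψ.comap (fun w : A => ((w : W) : G))).map e =
      θ⁻¹ • (ψ.comap (Subtype.val : intrinsicGraph φ → G)).withDensity fun p => D p := by
    ext B hB
    have hBW : hWV.proj '' (Subtype.val '' B) ⊆ W := by
      rintro _ ⟨x, -, rfl⟩
      exact hWV.complementary.fst_mem x
    have h1 := hWV.measure_proj_image_eq (k := k) hτ hWV.left_mem_complements (himm B hB) hBW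
    have h2 : hWV.proj '' (hWV.proj '' (Subtype.val '' B)) = hWV.proj '' (Subtype.val '' B) := by
      rw [image_image]
      exact image_congr fun x _ => hWV.complementary.fst_of_mem (hWV.complementary.fst_mem x)
    rw [h2, hmain _ (Subtype.coe_image_subset _ B) (hval.measurableSet_image.2 hB)] at h1
    rw [Measure.map_apply he hB, hι.comap_apply, himage, Measure.smul_apply, smul_eq_mul,
      withDensity_apply _ hB]
    have h3 : ((ψ.comap (Subtype.val : intrinsicGraph φ → G)).restrict B).map Subtype.val =
        ψ.restrict (Subtype.val '' B) := by
      ext E hE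
      rw [hval.map_apply, Measure.restrict_apply (hval.measurable hE), hval.comap_apply,
        Measure.restrict_apply hE, image_preimage_inter]
    rw [← hval.lintegral_map, h3, h1, ENNReal.inv_mul_cancel_left hθ0 hθtop]
  have hN : ∀ᵐ p : intrinsicGraph φ ∂ψ.comap Subtype.val, (p : G) ∉ N := by
    rw [ae_iff, hval.comap_apply]
    refine measure_mono_null ?_ hN0
    rintro _ ⟨p, hp, rfl⟩
    exact not_not.1 hp
  -- The exceptional set is also negligible on the domain, because the image of the measure on `A`
  -- is absolutely continuous with respect to `psi` on the graph.
  have hNA : ∀ᵐ w ∂ψ.comap (fun w : A => ((w : W) : G)), (e w : G) ∉ N := by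
    refine ae_of_ae_map he.aemeasurable (p := fun p : intrinsicGraph φ => (p : G) ∉ N) ?_
    rw [hmap]
    exact ((withDensity_absolutelyContinuous _ _).smul_left _).ae_le hN
  calc ∫⁻ p, h p ∂ψ.comap (Subtype.val : intrinsicGraph φ → G)
      = θ⁻¹ * ∫⁻ p, D p * (h p * (θ / D p)) ∂ψ.comap (Subtype.val : intrinsicGraph φ → G) := by
        rw [← lintegral_const_mul _ (by fun_prop)]
        refine lintegral_congr_ae ?_
        filter_upwards [hN] with p hp
        have hDp := hD p p.2 hp
        have h0 : D p ≠ 0 := by rw [hDp]; exact hWV.areaDensity_ne_zero hτ (hT p p.2).1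
        have htop : D p ≠ ∞ := by rw [hDp]; exact hWV.areaDensity_ne_top hτ
        rw [mul_left_comm (D (p : G)), ENNReal.mul_div_cancel h0 htop, mul_comm (h p),
          ENNReal.inv_mul_cancel_left hθ0 hθtop]
    _ = ∫⁻ p, h p * (θ / D p) ∂(ψ.comap (fun w : A => ((w : W) : G))).map e := by
        rw [hmap, lintegral_smul_measure, lintegral_withDensity_eq_lintegral_mul _ hDS (by fun_prop)]
        rfl
    _ = ∫⁻ w, h (e w) * (θ / D (e w)) ∂ψ.comap (fun w : A => ((w : W) : G)) :=
        lintegral_map (by fun_prop) he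
    _ = _ := by
        refine lintegral_congr_ae ?_
        filter_upwards [hNA] with w hw
        rw [hWV.coe_areaFactor hτ (hφ.2 w), ← hD _ (mem_range_self w) hw]

end AreaFormula

end Carnot

theorem theorem1p1 {G : Type*} [Carnot.CarnotGroup G] [MeasurableSpace G] [BorelSpace G]
    (W V : Subgroup G) (hWV : Carnot.IsSplitting W V)
    (d : ℝ) (hd : Carnot.IsHomogeneousDimension W d) (k : Carnot.MeasureKind) :
    ∃ 𝒜 : Subgroup G → ℝ≥0,
      Carnot.IsAreaFactor k d W V 𝒜 ∧ Carnot.IsContinuousOnGraphs W V 𝒜 ∧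
      ∀ (A : Set W) (φ : A → V), IsOpen A → Carnot.IsC1WV φ →
        ∀ h : Carnot.intrinsicGraph φ → ℝ≥0, Measurable h →
          ∫⁻ p, (h p : ℝ≥0∞) ∂((Carnot.psi k d).comap
              (Subtype.val : Carnot.intrinsicGraph φ → G)) =
            ∫⁻ w : A, (h ⟨Carnot.graphMap φ w, mem_range_self w⟩ : ℝ≥0∞) *
                (𝒜 (Carnot.tangentSubgroup (Carnot.intrinsicGraph φ) (Carnot.graphMap φ w)) : ℝ≥0∞)
              ∂((Carnot.psi k d).comap (fun w : A => ((w : W) : G))) := by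
  obtain ⟨τ, hτ⟩ := hWV.exists_isHomogeneousHaar hd
  exact ⟨hWV.areaFactor τ k, hWV.isAreaFactor hτ, hWV.isContinuousOnGraphs hτ,
    fun A φ hA hφ h hh =>
      hWV.lintegral_intrinsicGraph hτ k hA.measurableSet hφ hh.coe_nnreal_ennreal⟩
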